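/- **Theorem 1.1.** Let $\{s_{ij}: i,j=1,2,\dots\}$ be i.i.d. complex random variables with $\mathbb{E}s_{11}=0$, $\mathbb{E}|s_{11}|^2=1$, and put $\mathbf{s}_k=\mathbf{s}_k(N)=(s_{1k},\dots,s_{Nk})^T$. Let $K=K(N)$ with $K/N\to c>0$ as $N\to\infty$, let $L\ge 1$ be a fixed integer and $\sigma^2>0$. For each $N$ let $T_k=T_k^N\ge 0$ and $\gamma_k(\ell)=\gamma_k^N(\ell)\in\mathbb{C}$ ($1\le k\le K$, $1\le \ell\le L$) be random variables such that the family of all of them is independent of $(\mathbf{s}_1(N),\dots,\mathbf{s}_K(N))$. Put $\boldsymbol{\alpha}_k=\boldsymbol{\alpha}_k^N=\sqrt{T_k}\,(\gamma_k(1),\dots,\gamma_k(L))^T$ and assume that, almost surely, the empirical distribution of $\boldsymbol{\alpha}_1,\dots,\boldsymbol{\alpha}_K$ converges weakly, as $N\to\infty$, to a (nonrandom) probability distribution $H$ on $\mathbb{C}^L$. Define $$\boldsymbol{\beta}_k=\sqrt{T_k}\,(\gamma_k(1)\mathbf{s}_k^T,\dots,\gamma_k(L)\mathbf{s}_k^T)^T\in\mathbb{C}^{NL},\qquad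 C=\frac1N\sum_{k=2}^K\boldsymbol{\beta}_k\boldsymbol{\beta}_k^*,\qquad \mathrm{SIR}_1=\frac1N\boldsymbol{\beta}_1^*(C+\sigma^2 I)^{-1}\boldsymbol{\beta}_1 .$$ Then there is exactly one Hermitian positive definite $L\times L$ matrix $A=(a_{\ell\ell'})$ with $$A=\Big(c\,\mathbb{E}\,\frac{\boldsymbol{\alpha}\boldsymbol{\alpha}^*}{1+\boldsymbol{\alpha}^*A\boldsymbol{\alpha}}+\sigma^2 I_L\Big)^{-1},\qquad \boldsymbol{\alpha}\sim H,$$ and, with this nonrandom $A$, the following holds with probability one. 1. If $T_1^N\to T_1$ and $\gamma_1^N(\ell)\to\gamma_1(\ell)$ for all $\ell$ as $N\to\infty$ (in particular if $T_1$ and $\gamma_1(\ell)$ do not depend on $N$), then $$\lim_{N\to\infty}\mathrm{SIR}_1=T_1\sum_{\ell,\ell'=1}^L\bar\gamma_1(\ell)\,\gamma_1(\ell')\,a_{\ell\ell'} .$$ 2. More generally, if the sequence $(\boldsymbol{\alpha}_1^N)_N$ is bounded, then $$\lim_{N\to\infty}\Big(\mathrm{SIR}_1-T_1^N\sum_{\ell,\ell'=1}^L\overline{\gamma_1^N(\ell)}\,\gamma_1^N(\ell')\,a_{\ell\ell'}\Big)=0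 .$$ -/

import Mathlib

open MeasureTheory ProbabilityTheory Filter Topology
open scoped NNReal ComplexConjugate ComplexOrder

noncomputable section

namespace CDMA

/-! Users and signature coordinates are numbered from `0`: the distinguished first user is user `0`,
its interferers are the users `1, …, K - 1`, and `s i k` is coordinate `i` of the signature of
user `k`. All definitions in this group are for one realization. -/

/-- The vector `α = √T (γ(1), …, γ(L))ᵀ` of a user with transmit power `T` and gains `γ`. -/
def gainVec {L : ℕ} (T : ℝ) (γ : Fin L → ℂ) : Fin L → ℂ :=
  fun l => (Real.sqrt T : ℂ) * γ l

/-- The vector `β = √T (γ(1) sᵀ, …, γ(L) sᵀ)ᵀ ∈ ℂ^{NL}`; the coordinate `(l, i)` is the `i`-th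
coordinate of the `l`-th block. -/
def beta {L N : ℕ} (T : ℝ) (γ : Fin L → ℂ) (s : Fin N → ℂ) : Fin L × Fin N → ℂ :=
  fun p => (Real.sqrt T : ℂ) * (γ p.1 * s p.2)

/-- The vector `β_k(N)` of user `k`, whose signature is the first `N` entries of column `k`. -/
def userBeta {L : ℕ} (N : ℕ) (T : ℕ → ℝ) (γ : ℕ → Fin L → ℂ) (s : ℕ → ℕ → ℂ) (k : ℕ) :
    Fin L × Fin N → ℂ :=
  beta (T k) (γ k) (fun i : Fin N => s i k)

/-- The interference matrix `C = (1/N) ∑ β_k β_k^*`, over all users except the first one. -/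
def interference {L : ℕ} (N K : ℕ) (T : ℕ → ℝ) (γ : ℕ → Fin L → ℂ) (s : ℕ → ℕ → ℂ) :
    Matrix (Fin L × Fin N) (Fin L × Fin N) ℂ :=
  (1 / (N : ℂ)) • ∑ k ∈ Finset.Ico 1 K,
    Matrix.vecMulVec (userBeta N T γ s k) (star (userBeta N T γ s k))

/-- `SIR = (1/N) β^* (C + σ² I)⁻¹ β`, with `β` the vector of the first user. -/
def sir {L : ℕ} (N K : ℕ) (σ : ℝ) (T : ℕ → ℝ) (γ : ℕ → Fin L → ℂ) (s : ℕ → ℕ → ℂ) : ℂ :=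
  (1 / (N : ℂ)) *
    (star (userBeta N T γ s 0) ⬝ᵥ
      ((interference N K T γ s +
        ((σ ^ 2 : ℝ) : ℂ) • (1 : Matrix (Fin L × Fin N) (Fin L × Fin N) ℂ))⁻¹.mulVec
          (userBeta N T γ s 0)))

/-- The empirical distribution `(1/K) ∑_{k < K} δ_{α k}` of `K` points of `ℂ^L` (a probability
measure as soon as `K ≠ 0`). -/
def empiricalDist {L : ℕ} (K : ℕ) (α : ℕ → Fin L → ℂ) : FiniteMeasure (Fin L → ℂ) :=
  (K : ℝ≥0)⁻¹ • ∑ k ∈ Finset.range K, (diracProba (α k)).toFiniteMeasure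

/-- The matrix `E [α α^* / (1 + α^* A α)]`, where `α` has distribution `H`. For positive definite `A`
the integrands are bounded and continuous. -/
def expMatrix {L : ℕ} (H : ProbabilityMeasure (Fin L → ℂ)) (A : Matrix (Fin L) (Fin L) ℂ) :
    Matrix (Fin L) (Fin L) ℂ :=
  Matrix.of fun l l' =>
    ∫ α : Fin L → ℂ, α l * conj (α l') / (1 + star α ⬝ᵥ A.mulVec α) ∂(H : Measure (Fin L → ℂ))

/-- `A` is Hermitian positive definite and `A = (c E [α α^* / (1 + α^* A α)] + σ² I)⁻¹`. -/
def IsSolution {L : ℕ} (c σ : ℝ) (H : ProbabilityMeasure (Fin L → ℂ))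
    (A : Matrix (Fin L) (Fin L) ℂ) : Prop :=
  A.PosDef ∧
    A = ((c : ℂ) • expMatrix H A +
      ((σ ^ 2 : ℝ) : ℂ) • (1 : Matrix (Fin L) (Fin L) ℂ))⁻¹

/-- The deterministic expression `T ∑_{l, l'} conj(γ(l)) γ(l') a_{l l'}`. -/
def limitValue {L : ℕ} (T : ℝ) (γ : Fin L → ℂ) (A : Matrix (Fin L) (Fin L) ℂ) : ℂ :=
  (T : ℂ) * ∑ l, ∑ l', conj (γ l) * γ l' * A l l'

end CDMA

end

/-! The block traces of the resolvent `(C + σ²)⁻¹` form a random `L × L` matrix `D`. Expanding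
`1 = (C + σ²)⁻¹ (C + σ²)` and removing one user at a time by the rank one formula for inverses
gives `1 = σ² D + (1/N) ∑ D_k α_k α_k^* / (1 + α_k^* D_k α_k)`, where `D_k` is the quadratic form
of the signature of user `k` in the resolvent without user `k`, hence close to the trace `D`: `D`
almost solves the fixed point equation. Fourth moments of truncated signatures, bounded differences
over the users and Borel–Cantelli make the error vanish almost surely as long as the gains are
bounded, and unbounded gains are cut off at the price of a change of small rank. By compactness
every limit point of `D` is a solution, and there is only one: if `θ A⁻¹ ≤ B⁻¹` for two solutions
and some `θ < 1`, the equation gives the same with a larger `θ`, since its summand `σ²` is not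
scaled; iterating, `A⁻¹ ≤ B⁻¹`. The SIR is a quadratic form of the first signature in a resolvent
that does not involve it, so it has the same limit as the trace. -/

noncomputable section

namespace CDMA

open Matrix
open scoped ENNReal

section QuadraticForms

variable {ι : Type*} [Fintype ι]

/-- The squared Euclidean norm of a vector (the norm of `ι → ℂ` itself is the supremum norm). -/
def sqNorm (x : ι → ℂ) : ℝ := ∑ i, ‖x i‖ ^ 2

lemma sqNorm_nonneg (x : ι → ℂ) : 0 ≤ sqNorm x := Finset.sum_nonneg fun _ _ => sq_nonneg _

lemma sqNorm_pos {x : ι → ℂ} (hx : x ≠ 0) : 0 < sqNorm x := by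
  obtain ⟨i, hi⟩ := Function.ne_iff.1 hx
  exact Finset.sum_pos' (fun _ _ => sq_nonneg _)
    ⟨i, Finset.mem_univ i, pow_pos (norm_pos_iff.2 hi) 2⟩

lemma star_dotProduct_self (x : ι → ℂ) : star x ⬝ᵥ x = (sqNorm x : ℂ) := by
  simp [dotProduct, sqNorm, ← Complex.conj_mul']

lemma sq_norm_dotProduct_le (x y : ι → ℂ) : ‖x ⬝ᵥ y‖ ^ 2 ≤ sqNorm x * sqNorm y :=
  calc ‖x ⬝ᵥ y‖ ^ 2 ≤ (∑ i, ‖x i‖ * ‖y i‖) ^ 2 := by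
        gcongr
        exact norm_sum_le_of_le _ fun i _ => (norm_mul _ _).le
    _ ≤ sqNorm x * sqNorm y := Finset.sum_mul_sq_le_sq_mul_sq _ _ _

lemma norm_dotProduct_le (x y : ι → ℂ) : ‖x ⬝ᵥ y‖ ≤ √(sqNorm x) * √(sqNorm y) := by
  rw [← Real.sqrt_mul (sqNorm_nonneg x)]
  exact Real.le_sqrt_of_sq_le (sq_norm_dotProduct_le x y)

@[simp] lemma sqNorm_star (x : ι → ℂ) : sqNorm (star x) = sqNorm x := by simp [sqNorm]

lemma sqNorm_smul (c : ℂ) (x : ι → ℂ) : sqNorm (c • x) = ‖c‖ ^ 2 * sqNorm x := by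
  simp [sqNorm, mul_pow, Finset.mul_sum]

lemma sqNorm_single [DecidableEq ι] (i : ι) (c : ℂ) : sqNorm (Pi.single i c) = ‖c‖ ^ 2 := by
  rw [sqNorm, Finset.sum_eq_single i] <;> simp +contextual

lemma norm_sq_le_sqNorm (x : ι → ℂ) (i : ι) : ‖x i‖ ^ 2 ≤ sqNorm x :=
  Finset.single_le_sum (f := fun i => ‖x i‖ ^ 2) (fun _ _ => sq_nonneg _) (Finset.mem_univ i)

/-- The real part of `v^* A v`; it is the full value of the form when `A` is Hermitian. -/
def quadForm (A : Matrix ι ι ℂ) (v : ι → ℂ) : ℝ := (star v ⬝ᵥ A *ᵥ v).re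

lemma quadForm_add (A B : Matrix ι ι ℂ) (v : ι → ℂ) :
    quadForm (A + B) v = quadForm A v + quadForm B v := by
  simp [quadForm, add_mulVec]

lemma quadForm_sub (A B : Matrix ι ι ℂ) (v : ι → ℂ) :
    quadForm (A - B) v = quadForm A v - quadForm B v := by
  simp [quadForm, sub_mulVec]

lemma quadForm_smul (r : ℝ) (A : Matrix ι ι ℂ) (v : ι → ℂ) :
    quadForm ((r : ℂ) • A) v = r * quadForm A v := by
  simp [quadForm, smul_mulVec]

lemma quadForm_sum {κ : Type*} (S : Finset κ) (A : κ → Matrix ι ι ℂ) (v : ι → ℂ) :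
    quadForm (∑ k ∈ S, A k) v = ∑ k ∈ S, quadForm (A k) v := by
  simp [quadForm, sum_mulVec, dotProduct_sum]

lemma quadForm_one [DecidableEq ι] (v : ι → ℂ) : quadForm (1 : Matrix ι ι ℂ) v = sqNorm v := by
  simp [quadForm, star_dotProduct_self]

lemma star_dotProduct_mulVec_comm {A : Matrix ι ι ℂ} (hA : A.IsHermitian) (v w : ι → ℂ) :
    star v ⬝ᵥ A *ᵥ w = conj (star w ⬝ᵥ A *ᵥ v) := by
  rw [starRingEnd_apply, star_dotProduct, star_mulVec, hA.eq, dotProduct_mulVec]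

lemma star_dotProduct_mulVec_eq_quadForm {A : Matrix ι ι ℂ} (hA : A.IsHermitian) (v : ι → ℂ) :
    star v ⬝ᵥ A *ᵥ v = (quadForm A v : ℂ) :=
  (Complex.conj_eq_iff_re.1 (star_dotProduct_mulVec_comm hA v v).symm).symm

lemma quadForm_nonneg {A : Matrix ι ι ℂ} (hA : A.PosSemidef) (v : ι → ℂ) : 0 ≤ quadForm A v :=
  (Complex.le_def.1 (hA.dotProduct_mulVec_nonneg v)).1

lemma posSemidef_of_quadForm_nonneg {A : Matrix ι ι ℂ} (hA : A.IsHermitian)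
    (h : ∀ v, 0 ≤ quadForm A v) : A.PosSemidef :=
  .of_dotProduct_mulVec_nonneg hA fun v => by
    rw [star_dotProduct_mulVec_eq_quadForm hA]; exact_mod_cast h v

open scoped MatrixOrder in
lemma eq_of_quadForm_eq {A B : Matrix ι ι ℂ} (hA : A.IsHermitian) (hB : B.IsHermitian)
    (h : ∀ v, quadForm A v = quadForm B v) : A = B := by
  refine le_antisymm (le_iff.2 ?_) (le_iff.2 ?_)
  · exact posSemidef_of_quadForm_nonneg (hB.sub hA) fun v => by rw [quadForm_sub, h, sub_self]
  · exact posSemidef_of_quadForm_nonneg (hA.sub hB) fun v => by rw [quadForm_sub, h, sub_self]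

end QuadraticForms

section Coercive

variable {ι : Type*} [Fintype ι] {D : Matrix ι ι ℂ} {τ : ℝ}

/-- `D` is Hermitian and `D ≥ τ I`. This quantitative form of positive definiteness gives the bounds
on `D⁻¹` that do not depend on the dimension. -/
structure CoerciveWith (τ : ℝ) (D : Matrix ι ι ℂ) : Prop where
  isHermitian : D.IsHermitian
  mul_sqNorm_le (v : ι → ℂ) : τ * sqNorm v ≤ quadForm D v

lemma CoerciveWith.posDef (h : CoerciveWith τ D) (hτ : 0 < τ) : D.PosDef :=
  .of_dotProduct_mulVec_pos h.isHermitian fun {v} hv => by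
    rw [star_dotProduct_mulVec_eq_quadForm h.isHermitian]
    exact_mod_cast (mul_pos hτ (sqNorm_pos hv)).trans_le (h.mul_sqNorm_le v)

variable [DecidableEq ι]

lemma mul_inv_of_posDef (hD : D.PosDef) : D * D⁻¹ = 1 :=
  mul_nonsing_inv _ ((isUnit_iff_isUnit_det _).1 hD.isUnit)

lemma inv_mul_of_posDef (hD : D.PosDef) : D⁻¹ * D = 1 :=
  nonsing_inv_mul _ ((isUnit_iff_isUnit_det _).1 hD.isUnit)

lemma quadForm_inv_mulVec (hD : D.PosDef) (v : ι → ℂ) :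
    quadForm D (D⁻¹ *ᵥ v) = quadForm D⁻¹ v := by
  rw [quadForm, mulVec_mulVec, mul_inv_of_posDef hD, one_mulVec, star_mulVec,
    hD.inv.isHermitian.eq, ← dotProduct_mulVec, quadForm]

lemma CoerciveWith.sqNorm_inv_mulVec_le (h : CoerciveWith τ D) (hτ : 0 < τ) (v : ι → ℂ) :
    sqNorm (D⁻¹ *ᵥ v) ≤ (1 / τ) ^ 2 * sqNorm v := by
  set w := D⁻¹ *ᵥ v
  have hw : D *ᵥ w = v := by
    rw [mulVec_mulVec, mul_inv_of_posDef (h.posDef hτ), one_mulVec]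
  have cauchy_schwarz : τ * sqNorm w ≤ √(sqNorm w) * √(sqNorm v) :=
    calc τ * sqNorm w ≤ quadForm D w := h.mul_sqNorm_le w
      _ ≤ ‖star w ⬝ᵥ v‖ := by rw [quadForm, hw]; exact Complex.re_le_norm _
      _ ≤ √(sqNorm w) * √(sqNorm v) := by simpa using norm_dotProduct_le (star w) v
  have hroot : τ * √(sqNorm w) ≤ √(sqNorm v) := by
    rcases (Real.sqrt_nonneg (sqNorm w)).eq_or_lt with h0 | h0
    · rw [← h0, mul_zero]; exact Real.sqrt_nonneg _
    · nth_rw 1 [← Real.mul_self_sqrt (sqNorm_nonneg w)] at cauchy_schwarz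
      nlinarith
  have hsq : (τ * √(sqNorm w)) ^ 2 ≤ √(sqNorm v) ^ 2 := by gcongr
  rw [mul_pow, Real.sq_sqrt (sqNorm_nonneg _), Real.sq_sqrt (sqNorm_nonneg _)] at hsq
  rwa [div_pow, one_pow, one_div, ← div_eq_inv_mul, le_div_iff₀' (by positivity)]

lemma CoerciveWith.sum_norm_sq_inv_col_le (h : CoerciveWith τ D) (hτ : 0 < τ) (q : ι) :
    ∑ p, ‖D⁻¹ p q‖ ^ 2 ≤ (1 / τ) ^ 2 := by
  have := h.sqNorm_inv_mulVec_le hτ (Pi.single q 1)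
  rwa [sqNorm_single, norm_one, one_pow, mul_one, mulVec_single_one] at this

lemma CoerciveWith.sum_norm_sq_inv_row_le (h : CoerciveWith τ D) (hτ : 0 < τ) (p : ι) :
    ∑ q, ‖D⁻¹ p q‖ ^ 2 ≤ (1 / τ) ^ 2 := by
  refine le_of_eq_of_le (Finset.sum_congr rfl fun q _ => ?_) (h.sum_norm_sq_inv_col_le hτ p)
  rw [← h.isHermitian.inv.apply p q, norm_star]

lemma CoerciveWith.norm_inv_apply_le (h : CoerciveWith τ D) (hτ : 0 < τ) (p q : ι) :
    ‖D⁻¹ p q‖ ≤ 1 / τ :=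
  le_of_sq_le_sq ((norm_sq_le_sqNorm (D⁻¹ p) q).trans (h.sum_norm_sq_inv_row_le hτ p))
    (by positivity)

variable {E : Matrix ι ι ℂ} {b : ι → ℂ} {r : ℝ}

lemma rankOne_inv_mulVec (hD : D.PosDef) (hE : E.PosDef) (hr : 0 ≤ r)
    (h : E = D + (r : ℂ) • vecMulVec b (star b)) :
    E⁻¹ *ᵥ b = (1 + ((r * quadForm D⁻¹ b : ℝ) : ℂ))⁻¹ • (D⁻¹ *ᵥ b) := by
  have hq : (1 + ((r * quadForm D⁻¹ b : ℝ) : ℂ)) ≠ 0 := by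
    have : 0 ≤ r * quadForm D⁻¹ b := mul_nonneg hr (quadForm_nonneg hD.inv.posSemidef b)
    exact_mod_cast (by linarith : (1 + r * quadForm D⁻¹ b) ≠ 0)
  have h1 : E *ᵥ (D⁻¹ *ᵥ b) = (1 + ((r * quadForm D⁻¹ b : ℝ) : ℂ)) • b := by
    rw [h, add_mulVec, mulVec_mulVec, mul_inv_of_posDef hD, one_mulVec, smul_mulVec,
      vecMulVec_mulVec, star_dotProduct_mulVec_eq_quadForm hD.inv.isHermitian, add_smul, one_smul]
    ext i
    simp [mul_comm, mul_left_comm]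
  have h2 : D⁻¹ *ᵥ b = (1 + ((r * quadForm D⁻¹ b : ℝ) : ℂ)) • (E⁻¹ *ᵥ b) := by
    rw [← mulVec_smul, ← h1, mulVec_mulVec, inv_mul_of_posDef hE, one_mulVec]
  rw [h2, smul_smul, inv_mul_cancel₀ hq, one_smul]

lemma inv_sub_rankOne_inv (hD : D.PosDef) (hE : E.PosDef) (hr : 0 ≤ r)
    (h : E = D + (r : ℂ) • vecMulVec b (star b)) :
    D⁻¹ - E⁻¹ = ((r * (1 + r * quadForm D⁻¹ b)⁻¹ : ℝ) : ℂ) •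
      vecMulVec (D⁻¹ *ᵥ b) (star (D⁻¹ *ᵥ b)) := by
  have resolvent_identity : D⁻¹ - E⁻¹ = E⁻¹ * (E - D) * D⁻¹ := by
    rw [mul_sub, sub_mul, inv_mul_of_posDef hE, one_mul, mul_assoc, mul_inv_of_posDef hD,
      mul_one]
  have hdiff : E - D = (r : ℂ) • vecMulVec b (star b) := by rw [h, add_sub_cancel_left]
  rw [resolvent_identity, hdiff, mul_smul_comm, smul_mul_assoc, mul_vecMulVec, vecMulVec_mul,
    rankOne_inv_mulVec hD hE hr h, star_mulVec, hD.inv.isHermitian.eq, smul_vecMulVec, smul_smul]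
  push_cast
  rfl

lemma CoerciveWith.rankOne_coeff_mul_sqNorm_le (h : CoerciveWith τ D) (hτ : 0 < τ) (b : ι → ℂ)
    (hr : 0 ≤ r) :
    r * (1 + r * quadForm D⁻¹ b)⁻¹ * sqNorm (D⁻¹ *ᵥ b) ≤ 1 / τ := by
  have hP := h.posDef hτ
  have h0 := quadForm_nonneg hP.inv.posSemidef b
  have h1 : τ * sqNorm (D⁻¹ *ᵥ b) ≤ quadForm D⁻¹ b :=
    (h.mul_sqNorm_le _).trans_eq (quadForm_inv_mulVec hP b)
  rw [mul_right_comm, ← div_eq_mul_inv, div_le_div_iff₀ (by positivity) hτ]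
  nlinarith [mul_le_mul_of_nonneg_left h1 hr]

end Coercive

/-! ### Perturbation of `A α α^* / (1 + α^* A α)` -/

section RankOneTerm

variable {ι : Type*} [Fintype ι] {A B : Matrix ι ι ℂ} {α : ι → ℂ} {δ τ M : ℝ}

lemma norm_mulVec_le (hA : ∀ l m, ‖A l m‖ ≤ δ) (hα : ∀ l, ‖α l‖ ≤ M) (hδ : 0 ≤ δ) (l : ι) :
    ‖(A *ᵥ α) l‖ ≤ Fintype.card ι * (δ * M) := by
  refine (norm_sum_le_of_le _ fun m _ => ?_).trans_eq (b := ∑ _m : ι, δ * M) (by simp)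
  rw [norm_mul]
  exact mul_le_mul (hA l m) (hα m) (norm_nonneg _) hδ

lemma norm_star_dotProduct_mulVec_le (hA : ∀ l m, ‖A l m‖ ≤ δ) (hα : ∀ l, ‖α l‖ ≤ M)
    (hδ : 0 ≤ δ) (hM : 0 ≤ M) :
    ‖star α ⬝ᵥ A *ᵥ α‖ ≤ Fintype.card ι * (M * (Fintype.card ι * (δ * M))) := by
  refine (norm_sum_le_of_le _ fun m _ => ?_).trans_eq
    (b := ∑ _m : ι, M * (Fintype.card ι * (δ * M))) (by simp)
  rw [norm_mul, Pi.star_apply, norm_star]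
  exact mul_le_mul (hα m) (norm_mulVec_le hA hα hδ m) (norm_nonneg _) hM

lemma norm_denom_eq (hA : A.PosSemidef) (α : ι → ℂ) :
    ‖1 + star α ⬝ᵥ A *ᵥ α‖ = 1 + quadForm A α := by
  have h := quadForm_nonneg hA α
  rw [star_dotProduct_mulVec_eq_quadForm hA.isHermitian, ← Complex.ofReal_one,
    ← Complex.ofReal_add, Complex.norm_real, Real.norm_of_nonneg (by positivity)]

lemma one_le_norm_denom (hA : A.PosSemidef) (α : ι → ℂ) : 1 ≤ ‖1 + star α ⬝ᵥ A *ᵥ α‖ :=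
  (le_add_of_nonneg_right (quadForm_nonneg hA α)).trans_eq (norm_denom_eq hA α).symm

lemma denom_ne_zero (hA : A.PosSemidef) (α : ι → ℂ) : 1 + star α ⬝ᵥ A *ᵥ α ≠ 0 :=
  norm_pos_iff.1 (one_pos.trans_le (one_le_norm_denom hA α))

/-- The matrix `A α α^* / (1 + α^* A α)`, the contribution of a user with gain vector `α` to the
fixed point equation `I = σ² A + c E [A α α^* / (1 + α^* A α)]`. -/
def rankOneTerm (A : Matrix ι ι ℂ) (α : ι → ℂ) : Matrix ι ι ℂ :=
  (1 + star α ⬝ᵥ A *ᵥ α)⁻¹ • vecMulVec (A *ᵥ α) (star α)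

lemma rankOneTerm_apply (A : Matrix ι ι ℂ) (α : ι → ℂ) (l m : ι) :
    rankOneTerm A α l m = (A *ᵥ α) l * conj (α m) / (1 + star α ⬝ᵥ A *ᵥ α) := by
  simp [rankOneTerm, vecMulVec_apply, div_eq_inv_mul]

lemma norm_rankOneTerm_le (hA : A.PosSemidef) (hτ : 0 ≤ τ) (hM : 0 ≤ M)
    (hAτ : ∀ l m, ‖A l m‖ ≤ τ) (hα : ∀ l, ‖α l‖ ≤ M) (l m : ι) :
    ‖rankOneTerm A α l m‖ ≤ Fintype.card ι * (τ * M) * M := by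
  rw [rankOneTerm_apply, norm_div, norm_mul, RCLike.norm_conj]
  refine (div_le_self (by positivity) (one_le_norm_denom hA α)).trans ?_
  exact mul_le_mul (norm_mulVec_le hAτ hα hτ l) (hα m) (norm_nonneg _) (by positivity)

lemma rankOneTerm_sub_apply (hA : A.PosSemidef) (hB : B.PosSemidef) (α : ι → ℂ) (l m : ι) :
    rankOneTerm A α l m - rankOneTerm B α l m =
      ((A - B) *ᵥ α) l * conj (α m) / (1 + star α ⬝ᵥ A *ᵥ α) -
        (B *ᵥ α) l * conj (α m) * (star α ⬝ᵥ (A - B) *ᵥ α) /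
          ((1 + star α ⬝ᵥ A *ᵥ α) * (1 + star α ⬝ᵥ B *ᵥ α)) := by
  have hA0 := denom_ne_zero hA α
  have hB0 := denom_ne_zero hB α
  rw [rankOneTerm_apply, rankOneTerm_apply, sub_mulVec, Pi.sub_apply, dotProduct_sub]
  field_simp
  ring

/-- A Lipschitz constant of `A ↦ rankOneTerm A α` for the entrywise maximum norm, when `A` has size
`d` and entries bounded by `τ` and the entries of `α` are bounded by `M`. -/
def lipConst (d : ℕ) (τ M : ℝ) : ℝ := d * M * M + d * (τ * M) * M * (d * (M * (d * M)))

lemma lipConst_nonneg (d : ℕ) (hτ : 0 ≤ τ) (hM : 0 ≤ M) : 0 ≤ lipConst d τ M := by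
  unfold lipConst; positivity

lemma norm_rankOneTerm_sub_le (hA : A.PosSemidef) (hB : B.PosSemidef) (hτ : 0 ≤ τ) (hM : 0 ≤ M)
    (hδ : 0 ≤ δ) (hBτ : ∀ l m, ‖B l m‖ ≤ τ) (hα : ∀ l, ‖α l‖ ≤ M)
    (hAB : ∀ l m, ‖A l m - B l m‖ ≤ δ) (l m : ι) :
    ‖rankOneTerm A α l m - rankOneTerm B α l m‖ ≤ lipConst (Fintype.card ι) τ M * δ := by
  set d : ℝ := (Fintype.card ι : ℝ) with hd
  have hp := one_le_norm_denom hA α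
  have hq := one_le_norm_denom hB α
  have numerator : ‖((A - B) *ᵥ α) l * conj (α m) / (1 + star α ⬝ᵥ A *ᵥ α)‖ ≤
      d * (δ * M) * M := by
    rw [norm_div, norm_mul, RCLike.norm_conj]
    refine (div_le_self (by positivity) hp).trans ?_
    exact mul_le_mul (norm_mulVec_le hAB hα hδ l) (hα m) (norm_nonneg _) (by positivity)
  have denominator : ‖(B *ᵥ α) l * conj (α m) * (star α ⬝ᵥ (A - B) *ᵥ α) /
      ((1 + star α ⬝ᵥ A *ᵥ α) * (1 + star α ⬝ᵥ B *ᵥ α))‖ ≤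
      d * (τ * M) * M * (d * (M * (d * (δ * M)))) := by
    rw [norm_div, norm_mul, norm_mul, norm_mul, RCLike.norm_conj]
    refine (div_le_self (by positivity) (one_le_mul_of_one_le_of_one_le hp hq)).trans ?_
    exact mul_le_mul
      (mul_le_mul (norm_mulVec_le hBτ hα hτ l) (hα m) (norm_nonneg _) (by positivity))
      (norm_star_dotProduct_mulVec_le hAB hα hδ hM) (norm_nonneg _) (by positivity)
  rw [rankOneTerm_sub_apply hA hB]
  refine (norm_sub_le _ _).trans ((add_le_add numerator denominator).trans_eq ?_)
  rw [lipConst, ← hd]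
  ring

end RankOneTerm

/-! ### Block traces and block quadratic forms -/

section Blocks

variable {ι : Type*} {N : ℕ}

/-- The tensor product of a gain vector and a signature. -/
def tensorVec (a : ι → ℂ) (x : Fin N → ℂ) : ι × Fin N → ℂ := fun p => a p.1 * x p.2

lemma tensorVec_zero (x : Fin N → ℂ) : tensorVec (0 : ι → ℂ) x = 0 := by
  ext; simp [tensorVec]

/-- The `N × N` block of `R` in position `(l, m)`. -/
def block (R : Matrix (ι × Fin N) (ι × Fin N) ℂ) (l m : ι) : Matrix (Fin N) (Fin N) ℂ :=
  Matrix.of fun i j => R (l, i) (m, j)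

/-- The matrix whose entry `(l, m)` is the trace of the block `(l, m)` of `R`, divided by `N`. -/
def blockTrace : Matrix (ι × Fin N) (ι × Fin N) ℂ →ₗ[ℂ] Matrix ι ι ℂ where
  toFun R := Matrix.of fun l m => ((1 / (N : ℝ) : ℝ) : ℂ) * ∑ i, R (l, i) (m, i)
  map_add' R S := by ext; simp [Finset.sum_add_distrib, mul_add]
  map_smul' c R := by ext; simp [Finset.mul_sum, mul_left_comm]

lemma blockTrace_apply (R : Matrix (ι × Fin N) (ι × Fin N) ℂ) (l m : ι) :
    blockTrace R l m = ((1 / (N : ℝ) : ℝ) : ℂ) * ∑ i, R (l, i) (m, i) := rfl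

lemma blockTrace_posSemidef {R : Matrix (ι × Fin N) (ι × Fin N) ℂ} (hR : R.PosSemidef) :
    (blockTrace R).PosSemidef := by
  have h : blockTrace R =
      ((1 / (N : ℝ) : ℝ) : ℂ) • ∑ i, R.submatrix (fun l => (l, i)) (fun l => (l, i)) := by
    ext l m
    simp [blockTrace_apply, Matrix.sum_apply]
  rw [h]
  refine PosSemidef.smul (posSemidef_sum _ fun i _ => hR.submatrix _) ?_
  rw [Complex.zero_le_real]; positivity

lemma blockTrace_one [DecidableEq ι] (hN : N ≠ 0) :
    blockTrace (1 : Matrix (ι × Fin N) (ι × Fin N) ℂ) = 1 := by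
  ext l m
  simp only [blockTrace_apply, one_apply, Prod.mk.injEq, and_true, Finset.sum_const,
    Finset.card_univ, Fintype.card_fin]
  have : (N : ℂ) ≠ 0 := by exact_mod_cast hN
  split_ifs <;> simp [this]

/-- The matrix whose entry `(l, m)` is the value at `y` of the quadratic form of the block `(l, m)`,
divided by `N`. -/
def blockForm (R : Matrix (ι × Fin N) (ι × Fin N) ℂ) (y : Fin N → ℂ) : Matrix ι ι ℂ :=
  Matrix.of fun l m => ((1 / (N : ℝ) : ℝ) : ℂ) * (star y ⬝ᵥ block R l m *ᵥ y)

lemma blockForm_isHermitian {R : Matrix (ι × Fin N) (ι × Fin N) ℂ} (hR : R.IsHermitian)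
    (y : Fin N → ℂ) : (blockForm R y).IsHermitian := by
  ext l m
  have h : (block R m l)ᴴ = block R l m := by
    ext i j
    exact hR.apply (l, i) (m, j)
  rw [conjTranspose_apply]
  simp only [blockForm, of_apply]
  rw [star_mul', ← h, star_dotProduct, star_mulVec, dotProduct_mulVec, star_star]
  congr 1
  exact Complex.conj_ofReal _

variable [Fintype ι]

lemma norm_blockTrace_vecMulVec_le (w : ι × Fin N → ℂ) (l m : ι) :
    ‖blockTrace (vecMulVec w (star w)) l m‖ ≤ 1 / (N : ℝ) * sqNorm w := by
  have hrow (l : ι) : ∑ i, ‖w (l, i)‖ ^ 2 ≤ sqNorm w := by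
    rw [sqNorm, Fintype.sum_prod_type]
    exact Finset.single_le_sum (f := fun l => ∑ i, ‖w (l, i)‖ ^ 2)
      (fun _ _ => Finset.sum_nonneg fun _ _ => sq_nonneg _) (Finset.mem_univ l)
  rw [blockTrace_apply, norm_mul, Complex.norm_real, Real.norm_of_nonneg (by positivity)]
  gcongr
  calc ‖∑ i, vecMulVec w (star w) (l, i) (m, i)‖
      ≤ ∑ i, (‖w (l, i)‖ ^ 2 / 2 + ‖w (m, i)‖ ^ 2 / 2) := norm_sum_le_of_le _ fun i _ => by
        rw [vecMulVec_apply, Pi.star_apply, norm_mul, norm_star]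
        nlinarith [sq_nonneg (‖w (l, i)‖ - ‖w (m, i)‖)]
    _ ≤ sqNorm w := by
        rw [Finset.sum_add_distrib, ← Finset.sum_div, ← Finset.sum_div]
        linarith [hrow l, hrow m]

lemma tensorVec_dotProduct_mulVec (R : Matrix (ι × Fin N) (ι × Fin N) ℂ) (y : Fin N → ℂ)
    (α : ι → ℂ) :
    ((1 / (N : ℝ) : ℝ) : ℂ) * (star (tensorVec α y) ⬝ᵥ R *ᵥ tensorVec α y) =
      star α ⬝ᵥ blockForm R y *ᵥ α := by
  simp only [blockForm, of_apply, Fintype.sum_prod_type, dotProduct, mulVec, block, Pi.star_apply,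
    tensorVec, star_mul', Finset.mul_sum, Finset.sum_mul]
  refine Finset.sum_congr rfl fun l _ => ?_
  rw [Finset.sum_comm]
  refine Finset.sum_congr rfl fun m _ => ?_
  refine Finset.sum_congr rfl fun i _ => ?_
  refine Finset.sum_congr rfl fun j _ => ?_
  ring

omit [Fintype ι] in
lemma blockForm_posSemidef [Finite ι] {R : Matrix (ι × Fin N) (ι × Fin N) ℂ} (hR : R.PosSemidef)
    (y : Fin N → ℂ) : (blockForm R y).PosSemidef := by
  have := Fintype.ofFinite ι
  refine .of_dotProduct_mulVec_nonneg (blockForm_isHermitian hR.isHermitian y) fun α => ?_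
  rw [← tensorVec_dotProduct_mulVec]
  refine mul_nonneg ?_ (hR.dotProduct_mulVec_nonneg _)
  rw [Complex.zero_le_real]; positivity

lemma blockTrace_vecMulVec_tensorVec (R : Matrix (ι × Fin N) (ι × Fin N) ℂ) (α : ι → ℂ)
    (y : Fin N → ℂ) : blockTrace (vecMulVec (R *ᵥ tensorVec α y) (star (tensorVec α y))) =
      vecMulVec (blockForm R y *ᵥ α) (star α) := by
  ext l m
  simp only [blockTrace_apply, blockForm, of_apply, Fintype.sum_prod_type, dotProduct, mulVec,
    block, Pi.star_apply, vecMulVec_apply, tensorVec, star_mul', Finset.mul_sum, Finset.sum_mul]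
  rw [Finset.sum_comm]
  refine Finset.sum_congr rfl fun n _ => ?_
  refine Finset.sum_congr rfl fun i _ => ?_
  refine Finset.sum_congr rfl fun j _ => ?_
  ring

end Blocks

/-! ### The resolvent of the interference matrix -/

section Resolvent

variable {ι : Type*} [DecidableEq ι] {N : ℕ} {κ : Type*} [Fintype κ] {σ : ℝ}

/-- The matrix `(1/N) ∑ β_k β_k^* + σ² I` with `β_k = a_k ⊗ x_k`, for gain vectors `a k` and
signatures `x k`. A user `k` is removed from the system by setting its gain vector to `0`. -/
def covMatrix (σ : ℝ) (a : κ → ι → ℂ) (x : κ → Fin N → ℂ) : Matrix (ι × Fin N) (ι × Fin N) ℂ :=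
  ((1 / (N : ℝ) : ℝ) : ℂ) •
      ∑ k, vecMulVec (tensorVec (a k) (x k)) (star (tensorVec (a k) (x k))) +
    ((σ ^ 2 : ℝ) : ℂ) • (1 : Matrix (ι × Fin N) (ι × Fin N) ℂ)

lemma covMatrix_congr {a a' : κ → ι → ℂ} {x x' : κ → Fin N → ℂ}
    (h : ∀ k, tensorVec (a k) (x k) = tensorVec (a' k) (x' k)) :
    covMatrix σ a x = covMatrix σ a' x' := by
  simp only [covMatrix, h]

lemma covMatrix_eq_update_add [DecidableEq κ] (σ : ℝ) (a : κ → ι → ℂ) (x : κ → Fin N → ℂ) (k : κ) :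
    covMatrix σ a x = covMatrix σ (Function.update a k 0) x +
      ((1 / (N : ℝ) : ℝ) : ℂ) •
        vecMulVec (tensorVec (a k) (x k)) (star (tensorVec (a k) (x k))) := by
  have hrest : ∑ j ∈ Finset.univ.erase k, vecMulVec (tensorVec (Function.update a k 0 j) (x j))
      (star (tensorVec (Function.update a k 0 j) (x j))) =
      ∑ j ∈ Finset.univ.erase k, vecMulVec (tensorVec (a j) (x j)) (star (tensorVec (a j) (x j))) :=
    Finset.sum_congr rfl fun j hj => by rw [Function.update_of_ne (Finset.ne_of_mem_erase hj)]
  rw [covMatrix, covMatrix, add_right_comm, ← smul_add,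
    ← Finset.sum_erase_add _ _ (Finset.mem_univ k),
    ← Finset.sum_erase_add (a := k) _ _ (Finset.mem_univ k), hrest]
  simp [tensorVec_zero]

lemma covMatrix_update_zero [DecidableEq κ] (σ : ℝ) (a : κ → ι → ℂ) (x : κ → Fin N → ℂ) (k : κ)
    (y : Fin N → ℂ) :
    covMatrix σ (Function.update a k 0) (Function.update x k y) =
      covMatrix σ (Function.update a k 0) x := by
  refine covMatrix_congr fun j => ?_
  by_cases hj : j = k
  · subst hj; simp [tensorVec_zero]
  · simp [hj]

variable [Fintype ι]

lemma covMatrix_coercive (σ : ℝ) (a : κ → ι → ℂ) (x : κ → Fin N → ℂ) :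
    CoerciveWith (σ ^ 2) (covMatrix σ a x) := by
  have hβ (k : κ) : (vecMulVec (tensorVec (a k) (x k)) (star (tensorVec (a k) (x k)))).PosSemidef :=
    posSemidef_vecMulVec_self_star _
  constructor
  · refine .add (.smul (posSemidef_sum _ fun k _ => hβ k).isHermitian ?_) (.smul isHermitian_one ?_)
    <;> exact Complex.conj_ofReal _
  · intro v
    rw [covMatrix, quadForm_add, quadForm_smul, quadForm_smul, quadForm_one, quadForm_sum]
    exact le_add_of_nonneg_left
      (mul_nonneg (by positivity) (Finset.sum_nonneg fun k _ => quadForm_nonneg (hβ k) v))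

omit [Fintype ι] in
lemma covMatrix_posDef [Finite ι] (hσ : 0 < σ) (a : κ → ι → ℂ) (x : κ → Fin N → ℂ) :
    (covMatrix σ a x).PosDef :=
  have := Fintype.ofFinite ι
  (covMatrix_coercive σ a x).posDef (by positivity)

/-- The matrix of the normalized block traces of the resolvent `(covMatrix σ a x)⁻¹`. It is the
random approximation of the solution of the fixed point equation. -/
def resolventTrace (σ : ℝ) (a : κ → ι → ℂ) (x : κ → Fin N → ℂ) : Matrix ι ι ℂ :=
  blockTrace (covMatrix σ a x)⁻¹

lemma resolventTrace_posSemidef (hσ : 0 < σ) (a : κ → ι → ℂ) (x : κ → Fin N → ℂ) :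
    (resolventTrace σ a x).PosSemidef :=
  blockTrace_posSemidef (covMatrix_posDef hσ a x).inv.posSemidef

lemma norm_resolventTrace_le (hσ : 0 < σ) (a : κ → ι → ℂ) (x : κ → Fin N → ℂ) (l m : ι) :
    ‖resolventTrace σ a x l m‖ ≤ 1 / σ ^ 2 := by
  have h : ‖∑ i : Fin N, (covMatrix σ a x)⁻¹ (l, i) (m, i)‖ ≤ N * (1 / σ ^ 2) := by
    refine (norm_sum_le_of_le _ fun i _ => (covMatrix_coercive σ a x).norm_inv_apply_le
      (by positivity) (l, i) (m, i)).trans_eq ?_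
    simp
  rw [resolventTrace, blockTrace_apply, norm_mul, Complex.norm_real,
    Real.norm_of_nonneg (by positivity)]
  calc 1 / (N : ℝ) * ‖∑ i : Fin N, (covMatrix σ a x)⁻¹ (l, i) (m, i)‖
      ≤ 1 / (N : ℝ) * (N * (1 / σ ^ 2)) := by gcongr
    _ = (N / N : ℝ) * (1 / σ ^ 2) := by ring
    _ ≤ 1 / σ ^ 2 := mul_le_of_le_one_left (by positivity) (div_self_le_one _)

lemma norm_resolventTrace_sub_update_le [DecidableEq κ] (hσ : 0 < σ) (a : κ → ι → ℂ)
    (x : κ → Fin N → ℂ) (k : κ) (l m : ι) :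
    ‖resolventTrace σ (Function.update a k 0) x l m - resolventTrace σ a x l m‖ ≤
      1 / (N * σ ^ 2) := by
  set D := covMatrix σ (Function.update a k 0) x
  set b := tensorVec (a k) (x k)
  have hD : CoerciveWith (σ ^ 2) D := covMatrix_coercive σ _ x
  have hDpos : D.PosDef := covMatrix_posDef hσ _ x
  have h0 := quadForm_nonneg hDpos.inv.posSemidef b
  have hr : 0 ≤ 1 / (N : ℝ) := by positivity
  rw [resolventTrace, resolventTrace, ← Matrix.sub_apply, ← map_sub,
    inv_sub_rankOne_inv hDpos (covMatrix_posDef hσ a x) hr (covMatrix_eq_update_add σ a x k),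
    map_smul, Matrix.smul_apply, norm_smul, Complex.norm_real, Real.norm_of_nonneg (by positivity)]
  set q : ℝ := 1 / (N : ℝ) * (1 + 1 / (N : ℝ) * quadForm D⁻¹ b)⁻¹
  calc q * ‖blockTrace (vecMulVec (D⁻¹ *ᵥ b) (star (D⁻¹ *ᵥ b))) l m‖
      ≤ q * (1 / (N : ℝ) * sqNorm (D⁻¹ *ᵥ b)) := by
        gcongr
        exact norm_blockTrace_vecMulVec_le _ l m
    _ = 1 / (N : ℝ) * (q * sqNorm (D⁻¹ *ᵥ b)) := by ring
    _ ≤ 1 / (N : ℝ) * (1 / σ ^ 2) := by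
        gcongr
        exact hD.rankOne_coeff_mul_sqNorm_le (by positivity) b hr
    _ = 1 / (N * σ ^ 2) := one_div_mul_one_div _ _

lemma norm_resolventTrace_sub_le (hσ : 0 < σ) (S : Finset κ) {a a' : κ → ι → ℂ}
    {x x' : κ → Fin N → ℂ} (h : ∀ k ∉ S, tensorVec (a k) (x k) = tensorVec (a' k) (x' k))
    (l m : ι) :
    ‖resolventTrace σ a x l m - resolventTrace σ a' x' l m‖ ≤ S.card * (2 / (N * σ ^ 2)) := by
  classical
  induction S using Finset.induction_on generalizing a a' with
  | empty =>
    rw [resolventTrace, resolventTrace, covMatrix_congr fun k => h k (Finset.notMem_empty k)]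
    simp
  | insert k S hk ih =>
    have hremove := norm_resolventTrace_sub_update_le hσ a x k l m
    have hremove' := norm_resolventTrace_sub_update_le hσ a' x' k l m
    have hrest := ih (a := Function.update a k 0) (a' := Function.update a' k 0) fun j hj => by
      by_cases hjk : j = k
      · subst hjk; simp [tensorVec_zero]
      · simpa [hjk] using h j (by simp [hjk, hj])
    rw [norm_sub_rev] at hremove
    rw [Finset.card_insert_of_notMem hk]
    push_cast
    set t := resolventTrace σ a x l m
    set t' := resolventTrace σ a' x' l m
    set u := resolventTrace σ (Function.update a k 0) x l m
    set u' := resolventTrace σ (Function.update a' k 0) x' l m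
    calc ‖t - t'‖ = ‖(t - u) + (u - u') + (u' - t')‖ := by congr 1; ring
      _ ≤ ‖t - u‖ + ‖u - u'‖ + ‖u' - t'‖ := norm_add₃_le
      _ ≤ 1 / (N * σ ^ 2) + S.card * (2 / (N * σ ^ 2)) + 1 / (N * σ ^ 2) := by gcongr
      _ = (S.card + 1) * (2 / (N * σ ^ 2)) := by ring

/-- The defect of `A` in the fixed point equation
`I = σ² A + (1/N) ∑ A a_k a_k^* / (1 + a_k^* A a_k)` of the gain vectors `a k`. -/
def defect (σ : ℝ) (N : ℕ) (a : κ → ι → ℂ) (A : Matrix ι ι ℂ) : Matrix ι ι ℂ :=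
  1 - ((σ ^ 2 : ℝ) : ℂ) • A - ((1 / (N : ℝ) : ℝ) : ℂ) • ∑ k, rankOneTerm A (a k)

/-- The block form of the signature of user `k` in the resolvent of the system of the other
users. -/
def userForm [DecidableEq κ] (σ : ℝ) (a : κ → ι → ℂ) (x : κ → Fin N → ℂ) (k : κ) : Matrix ι ι ℂ :=
  blockForm (covMatrix σ (Function.update a k 0) x)⁻¹ (x k)

lemma userForm_posSemidef [DecidableEq κ] (hσ : 0 < σ) (a : κ → ι → ℂ) (x : κ → Fin N → ℂ) (k : κ) :
    (userForm σ a x k).PosSemidef :=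
  blockForm_posSemidef (covMatrix_posDef hσ _ x).inv.posSemidef _

lemma one_eq_resolventTrace_add [DecidableEq κ] (hσ : 0 < σ) (hN : N ≠ 0) (a : κ → ι → ℂ)
    (x : κ → Fin N → ℂ) :
    (1 : Matrix ι ι ℂ) = ((σ ^ 2 : ℝ) : ℂ) • resolventTrace σ a x +
      ((1 / (N : ℝ) : ℝ) : ℂ) • ∑ k, rankOneTerm (userForm σ a x k) (a k) := by
  set D := covMatrix σ a x with hDdef
  have hinv : D⁻¹ * D = 1 := inv_mul_of_posDef (covMatrix_posDef hσ a x)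
  nth_rw 2 [hDdef] at hinv
  rw [covMatrix, mul_add, mul_smul_comm, mul_smul_comm, mul_one, Finset.mul_sum] at hinv
  rw [← blockTrace_one hN, ← hinv, map_add, map_smul, map_smul, map_sum, add_comm]
  congr 2
  refine Finset.sum_congr rfl fun k _ => ?_
  have hr : 0 ≤ 1 / (N : ℝ) := by positivity
  have hP := covMatrix_posDef hσ (Function.update a k 0) x
  rw [mul_vecMulVec, rankOne_inv_mulVec hP (covMatrix_posDef hσ a x) hr
      (covMatrix_eq_update_add σ a x k),
    smul_vecMulVec, map_smul, blockTrace_vecMulVec_tensorVec, Complex.ofReal_mul,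
    ← star_dotProduct_mulVec_eq_quadForm hP.inv.isHermitian, tensorVec_dotProduct_mulVec]
  rfl

end Resolvent

/-! ### The limiting fixed point equation -/

section LoewnerOrder

variable {ι : Type*} [Fintype ι]

lemma quadForm_le_sum_mul_sqNorm (A : Matrix ι ι ℂ) (v : ι → ℂ) :
    quadForm A v ≤ (∑ i, ∑ j, ‖A i j‖) * sqNorm v := by
  refine (Complex.re_le_norm _).trans ?_
  simp only [dotProduct, mulVec, Finset.mul_sum, Finset.sum_mul]
  refine norm_sum_le_of_le _ fun i _ => norm_sum_le_of_le _ fun j _ => ?_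
  have am_gm : ‖v i‖ * ‖v j‖ ≤ sqNorm v := by
    nlinarith [sq_nonneg (‖v i‖ - ‖v j‖), norm_sq_le_sqNorm v i, norm_sq_le_sqNorm v j]
  calc ‖star v i * (A i j * v j)‖ = ‖A i j‖ * (‖v i‖ * ‖v j‖) := by
        rw [norm_mul, norm_mul, Pi.star_apply, norm_star]; ring
    _ ≤ ‖A i j‖ * sqNorm v := by gcongr

lemma exists_mul_quadForm_le (A : Matrix ι ι ℂ) {τ : ℝ} (hτ : 0 < τ) :
    ∃ ρ, 0 < ρ ∧ ρ ≤ 1 ∧ ∀ v, ρ * quadForm A v ≤ τ * sqNorm v := by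
  set s := ∑ i, ∑ j, ‖A i j‖
  have hs : 0 ≤ s := Finset.sum_nonneg fun _ _ => Finset.sum_nonneg fun _ _ => norm_nonneg _
  refine ⟨τ / (s + τ), by positivity, div_le_one_of_le₀ (by linarith) (by positivity), fun v => ?_⟩
  rw [div_mul_eq_mul_div, div_le_iff₀ (by positivity), mul_assoc]
  have := sqNorm_nonneg v
  gcongr
  nlinarith [quadForm_le_sum_mul_sqNorm A v]

variable [DecidableEq ι] {A B : Matrix ι ι ℂ}

lemma fenchel_young_quadForm (hA : A.PosDef) (v w : ι → ℂ) :
    2 * (star v ⬝ᵥ w).re ≤ quadForm A v + quadForm A⁻¹ w := by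
  have h : quadForm A (v - A⁻¹ *ᵥ w) =
      quadForm A v - 2 * (star v ⬝ᵥ w).re + quadForm A⁻¹ w := by
    have hAw : A *ᵥ A⁻¹ *ᵥ w = w := by rw [mulVec_mulVec, mul_inv_of_posDef hA, one_mulVec]
    have hcross : (star (A⁻¹ *ᵥ w) ⬝ᵥ A *ᵥ v).re = (star v ⬝ᵥ w).re := by
      rw [star_dotProduct_mulVec_comm hA.isHermitian, hAw, Complex.conj_re]
    rw [← quadForm_inv_mulVec hA w]
    simp only [quadForm, mulVec_sub, star_sub, sub_dotProduct, dotProduct_sub, Complex.sub_re,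
      hcross, hAw]
    ring
  linarith [quadForm_nonneg hA.posSemidef (v - A⁻¹ *ᵥ w)]

lemma quadForm_inv_antitone (hA : A.PosDef) (hB : B.PosDef) {θ : ℝ} (hθ : 0 ≤ θ)
    (h : ∀ v, θ * quadForm A⁻¹ v ≤ quadForm B⁻¹ v) (v : ι → ℂ) :
    θ * quadForm B v ≤ quadForm A v := by
  have hBv : quadForm B⁻¹ (B *ᵥ v) = quadForm B v := by
    have := quadForm_inv_mulVec hB.inv v
    rwa [nonsing_inv_nonsing_inv B ((isUnit_iff_isUnit_det _).1 hB.isUnit)] at this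
  have young := fenchel_young_quadForm hA v ((θ : ℂ) • B *ᵥ v)
  have hscale : quadForm A⁻¹ ((θ : ℂ) • B *ᵥ v) = θ * (θ * quadForm A⁻¹ (B *ᵥ v)) := by
    simp [quadForm, mulVec_smul]
  have hleft : (star v ⬝ᵥ (θ : ℂ) • B *ᵥ v).re = θ * quadForm B v := by simp [quadForm]
  have hθB := mul_le_mul_of_nonneg_left (h (B *ᵥ v)) hθ
  rw [hBv] at hθB
  rw [hscale, hleft] at young
  linarith

lemma sqNorm_le_mul_quadForm (hA : A.PosDef) {κ : ℝ} (hκ : 0 < κ)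
    (h : ∀ v, quadForm A⁻¹ v ≤ κ * sqNorm v) (v : ι → ℂ) : sqNorm v ≤ κ * quadForm A v := by
  have := quadForm_inv_antitone hA PosDef.one (inv_nonneg.2 hκ.le) (fun w => ?_) v
  · rwa [quadForm_one, inv_mul_le_iff₀ hκ] at this
  · rw [inv_one, quadForm_one, inv_mul_le_iff₀ hκ]
    exact h w

omit [DecidableEq ι] in
lemma exists_sqNorm_le_of_posDef (hA : A.PosDef) : ∃ κ > 0, ∀ v, sqNorm v ≤ κ * quadForm A v := by
  classical
  obtain ⟨ρ, hρ, -, h⟩ := exists_mul_quadForm_le A⁻¹ one_pos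
  refine ⟨ρ⁻¹, inv_pos.2 hρ, sqNorm_le_mul_quadForm hA (inv_pos.2 hρ) fun v => ?_⟩
  rw [← div_eq_inv_mul, le_div_iff₀' hρ, ← one_mul (sqNorm v)]
  exact h v

end LoewnerOrder

section FixedPoint

variable {L : ℕ} {H : ProbabilityMeasure (Fin L → ℂ)} {g : (Fin L → ℂ) → Fin L → ℂ}
  {A B : Matrix (Fin L) (Fin L) ℂ} {c σ : ℝ}

/-- The integrand `g(α) g(α)^* / (1 + g(α)^* A g(α))`, entrywise. The map `g` is the identity in the
fixed point equation itself, and a cut-off in its approximations. -/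
def kernelFun (g : (Fin L → ℂ) → Fin L → ℂ) (A : Matrix (Fin L) (Fin L) ℂ) (l m : Fin L)
    (α : Fin L → ℂ) : ℂ :=
  g α l * conj (g α m) / (1 + star (g α) ⬝ᵥ A *ᵥ g α)

/-- The matrix `c E [g(α) g(α)^* / (1 + g(α)^* A g(α))] + σ² I`, whose inverse is the right-hand
side of the fixed point equation. -/
def fixedPointRHS (c σ : ℝ) (H : ProbabilityMeasure (Fin L → ℂ)) (g : (Fin L → ℂ) → Fin L → ℂ)
    (A : Matrix (Fin L) (Fin L) ℂ) : Matrix (Fin L) (Fin L) ℂ :=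
  (c : ℂ) • Matrix.of (fun l m => ∫ α, kernelFun g A l m α ∂(H : Measure (Fin L → ℂ))) +
    ((σ ^ 2 : ℝ) : ℂ) • 1

lemma isSolution_iff : IsSolution c σ H A ↔ A.PosDef ∧ A = (fixedPointRHS c σ H id A)⁻¹ := Iff.rfl

lemma continuous_kernelFun (hg : Continuous g) (hA : A.PosSemidef) (l m : Fin L) :
    Continuous (kernelFun g A l m) := by
  refine .div (by fun_prop) ?_ fun α => denom_ne_zero hA (g α)
  exact continuous_const.add
    (.dotProduct (continuous_star.comp hg) (.matrix_mulVec continuous_const hg))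

/-- The integrands `kernelFun g A l m` are uniformly bounded, so that `fixedPointRHS` is defined by
convergent integrals. -/
def KernelBounded (g : (Fin L → ℂ) → Fin L → ℂ) (A : Matrix (Fin L) (Fin L) ℂ) : Prop :=
  ∃ C, ∀ l m α, ‖kernelFun g A l m α‖ ≤ C

lemma integrable_kernelFun (hg : Continuous g) (hA : A.PosSemidef) (hb : KernelBounded g A)
    (l m : Fin L) : Integrable (kernelFun g A l m) (H : Measure (Fin L → ℂ)) := by
  obtain ⟨C, hC⟩ := hb
  exact .of_bound (continuous_kernelFun hg hA l m).aestronglyMeasurable C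
    (Eventually.of_forall fun α => hC l m α)

lemma norm_mul_conj_le_sqNorm (v : Fin L → ℂ) (l m : Fin L) : ‖v l * conj (v m)‖ ≤ sqNorm v := by
  rw [norm_mul, RCLike.norm_conj]
  nlinarith [norm_sq_le_sqNorm v l, norm_sq_le_sqNorm v m, sq_nonneg (‖v l‖ - ‖v m‖)]

lemma norm_kernelFun_le {κ : ℝ} (hA : A.PosSemidef) (hκ : ∀ v, sqNorm v ≤ κ * quadForm A v)
    (hκ0 : 0 ≤ κ) (l m : Fin L) (α : Fin L → ℂ) : ‖kernelFun g A l m α‖ ≤ κ := by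
  have h := quadForm_nonneg hA (g α)
  rw [kernelFun, norm_div, norm_denom_eq hA, div_le_iff₀ (by positivity)]
  calc ‖g α l * conj (g α m)‖ ≤ sqNorm (g α) := norm_mul_conj_le_sqNorm _ _ _
    _ ≤ κ * quadForm A (g α) := hκ _
    _ ≤ κ * (1 + quadForm A (g α)) := by gcongr; linarith

lemma kernelBounded_of_posDef (hA : A.PosDef) : KernelBounded g A := by
  obtain ⟨κ, hκ0, hκ⟩ := exists_sqNorm_le_of_posDef hA
  exact ⟨κ, norm_kernelFun_le hA.posSemidef hκ hκ0.le⟩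

lemma kernelBounded_of_norm_le (hA : A.PosSemidef) {M : ℝ} (hM : 0 ≤ M)
    (hg : ∀ α l, ‖g α l‖ ≤ M) : KernelBounded g A := by
  refine ⟨M * M, fun l m α => ?_⟩
  rw [kernelFun, norm_div, norm_mul, RCLike.norm_conj]
  refine (div_le_self (by positivity) (one_le_norm_denom hA _)).trans ?_
  exact mul_le_mul (hg α l) (hg α m) (norm_nonneg _) hM

lemma fixedPointRHS_isHermitian (hA : A.PosSemidef) : (fixedPointRHS c σ H g A).IsHermitian := by
  refine IsHermitian.add (IsHermitian.smul ?_ (Complex.conj_ofReal _))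
    (IsHermitian.smul isHermitian_one (Complex.conj_ofReal _))
  ext l m
  rw [conjTranspose_apply, of_apply, of_apply, ← starRingEnd_apply, ← integral_conj]
  refine integral_congr_ae (Eventually.of_forall fun α => ?_)
  simp [kernelFun, star_dotProduct_mulVec_eq_quadForm hA.isHermitian, mul_comm]

/-- The value `|g(α)^* v|² / (1 + g(α)^* A g(α))` at `v` of the quadratic form of the matrix
`kernelFun g A · · α`. -/
def quadFormKernel (g : (Fin L → ℂ) → Fin L → ℂ) (A : Matrix (Fin L) (Fin L) ℂ) (v α : Fin L → ℂ) :
    ℝ :=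
  ‖star (g α) ⬝ᵥ v‖ ^ 2 / (1 + quadForm A (g α))

lemma quadFormKernel_nonneg (hA : A.PosSemidef) (v α : Fin L → ℂ) : 0 ≤ quadFormKernel g A v α := by
  have := quadForm_nonneg hA (g α)
  unfold quadFormKernel
  positivity

lemma sum_kernelFun_eq_quadFormKernel (hA : A.PosSemidef) (v α : Fin L → ℂ) :
    (∑ l, ∑ m, star (v l) * kernelFun g A l m α * v m) = (quadFormKernel g A v α : ℂ) := by
  have hconj : star v ⬝ᵥ g α = conj (star (g α) ⬝ᵥ v) := by
    rw [starRingEnd_apply, star_dotProduct]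
  rw [quadFormKernel, Complex.ofReal_div, Complex.ofReal_pow, ← Complex.conj_mul', ← hconj,
    Complex.ofReal_add, ← star_dotProduct_mulVec_eq_quadForm hA.isHermitian]
  simp only [kernelFun, dotProduct, Finset.sum_mul_sum, Finset.sum_div, Pi.star_apply]
  refine Finset.sum_congr rfl fun l _ => Finset.sum_congr rfl fun m _ => ?_
  rw [Complex.ofReal_one, starRingEnd_apply]
  ring

lemma integrable_quadFormKernel (hg : Continuous g) (hA : A.PosSemidef) (hb : KernelBounded g A)
    (v : Fin L → ℂ) : Integrable (quadFormKernel g A v) (H : Measure (Fin L → ℂ)) := by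
  have h : Integrable (fun α => (quadFormKernel g A v α : ℂ)) (H : Measure (Fin L → ℂ)) := by
    simp_rw [← sum_kernelFun_eq_quadFormKernel hA]
    exact integrable_finsetSum _ fun l _ => integrable_finsetSum _ fun m _ =>
      ((integrable_kernelFun hg hA hb l m).const_mul _).mul_const _
  simpa only [RCLike.re_eq_complex_re, Complex.ofReal_re] using h.re

lemma quadForm_fixedPointRHS (hg : Continuous g) (hA : A.PosSemidef) (hb : KernelBounded g A)
    (v : Fin L → ℂ) : quadForm (fixedPointRHS c σ H g A) v =
      c * ∫ α, quadFormKernel g A v α ∂(H : Measure (Fin L → ℂ)) + σ ^ 2 * sqNorm v := by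
  rw [fixedPointRHS, quadForm_add, quadForm_smul, quadForm_smul, quadForm_one]
  congr 2
  have hi := integrable_kernelFun (H := H) hg hA hb
  have h : star v ⬝ᵥ
      Matrix.of (fun l m => ∫ α, kernelFun g A l m α ∂(H : Measure (Fin L → ℂ))) *ᵥ v =
      ∫ α, (quadFormKernel g A v α : ℂ) ∂(H : Measure (Fin L → ℂ)) := by
    simp_rw [← sum_kernelFun_eq_quadFormKernel hA]
    rw [integral_finsetSum _ fun l _ => integrable_finsetSum _ fun m _ =>
      ((hi l m).const_mul _).mul_const _]
    simp only [dotProduct, mulVec, of_apply, Finset.mul_sum, Pi.star_apply]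
    refine Finset.sum_congr rfl fun l _ => ?_
    rw [integral_finsetSum _ fun m _ => ((hi l m).const_mul _).mul_const _]
    refine Finset.sum_congr rfl fun m _ => ?_
    rw [integral_mul_const, integral_const_mul, mul_assoc]
  rw [quadForm, h, integral_complex_ofReal, Complex.ofReal_re]

lemma fixedPointRHS_coercive (hc : 0 ≤ c) (hg : Continuous g) (hA : A.PosSemidef)
    (hb : KernelBounded g A) : CoerciveWith (σ ^ 2) (fixedPointRHS c σ H g A) where
  isHermitian := fixedPointRHS_isHermitian hA
  mul_sqNorm_le v := by
    rw [quadForm_fixedPointRHS hg hA hb]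
    exact le_add_of_nonneg_left
      (mul_nonneg hc (integral_nonneg fun α => quadFormKernel_nonneg hA v α))

lemma inv_eq_fixedPointRHS (hc : 0 ≤ c) (hσ : 0 < σ) (hg : Continuous g) (hA : A.PosSemidef)
    (hb : KernelBounded g A) (h : A = (fixedPointRHS c σ H g A)⁻¹) :
    A⁻¹ = fixedPointRHS c σ H g A := by
  rw [inv_eq_right_inv]
  nth_rw 1 [h]
  exact inv_mul_of_posDef ((fixedPointRHS_coercive hc hg hA hb).posDef (by positivity))

/-! #### Uniqueness -/

lemma IsSolution.inv_eq (hc : 0 ≤ c) (hσ : 0 < σ) (hA : IsSolution c σ H A) :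
    A⁻¹ = fixedPointRHS c σ H id A :=
  inv_eq_fixedPointRHS hc hσ continuous_id hA.1.posSemidef (kernelBounded_of_posDef hA.1) hA.2

lemma IsSolution.quadForm_inv (hc : 0 ≤ c) (hσ : 0 < σ) (hA : IsSolution c σ H A)
    (v : Fin L → ℂ) : quadForm A⁻¹ v =
      c * ∫ α, quadFormKernel id A v α ∂(H : Measure (Fin L → ℂ)) + σ ^ 2 * sqNorm v := by
  rw [hA.inv_eq hc hσ,
    quadForm_fixedPointRHS continuous_id hA.1.posSemidef (kernelBounded_of_posDef hA.1)]

lemma mul_quadFormKernel_le (hA : A.PosSemidef) (hB : B.PosSemidef) {θ : ℝ} (hθ : θ ≤ 1)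
    (h : ∀ v, θ * quadForm B v ≤ quadForm A v) (v α : Fin L → ℂ) :
    θ * quadFormKernel g A v α ≤ quadFormKernel g B v α := by
  have hA0 := quadForm_nonneg hA (g α)
  have hB0 := quadForm_nonneg hB (g α)
  have hdenom : θ * (1 + quadForm B (g α)) ≤ 1 + quadForm A (g α) := by linarith [h (g α)]
  rw [quadFormKernel, quadFormKernel, ← mul_div_assoc,
    div_le_div_iff₀ (by positivity) (by positivity)]
  calc θ * ‖star (g α) ⬝ᵥ v‖ ^ 2 * (1 + quadForm B (g α))
      = ‖star (g α) ⬝ᵥ v‖ ^ 2 * (θ * (1 + quadForm B (g α))) := by ring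
    _ ≤ ‖star (g α) ⬝ᵥ v‖ ^ 2 * (1 + quadForm A (g α)) := by gcongr

/- If `θ A⁻¹ ≤ B⁻¹` for two solutions, the integral terms satisfy the same inequality, and the
summand `σ² I`, which is not scaled, gives room to increase `θ`. -/
lemma quadForm_inv_le_improve (hc : 0 ≤ c) (hσ : 0 < σ) (hA : IsSolution c σ H A)
    (hB : IsSolution c σ H B) {θ ρ : ℝ} (hθ : 0 ≤ θ) (hθ1 : θ ≤ 1)
    (hρ : ∀ v, ρ * quadForm A⁻¹ v ≤ σ ^ 2 * sqNorm v)
    (h : ∀ v, θ * quadForm A⁻¹ v ≤ quadForm B⁻¹ v) (v : Fin L → ℂ) :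
    (θ + (1 - θ) * ρ) * quadForm A⁻¹ v ≤ quadForm B⁻¹ v := by
  have hAB := quadForm_inv_antitone hA.1 hB.1 hθ h
  have hint : θ * ∫ α, quadFormKernel id A v α ∂(H : Measure (Fin L → ℂ)) ≤
      ∫ α, quadFormKernel id B v α ∂(H : Measure (Fin L → ℂ)) := by
    rw [← integral_const_mul]
    exact integral_mono
      ((integrable_quadFormKernel continuous_id hA.1.posSemidef
        (kernelBounded_of_posDef hA.1) v).const_mul θ)
      (integrable_quadFormKernel continuous_id hB.1.posSemidef (kernelBounded_of_posDef hB.1) v)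
      fun α => mul_quadFormKernel_le hA.1.posSemidef hB.1.posSemidef hθ1 hAB v α
  have hroom := mul_le_mul_of_nonneg_left (hρ v) (sub_nonneg.2 hθ1)
  have hmain := mul_le_mul_of_nonneg_left hint hc
  rw [hB.quadForm_inv hc hσ]
  linear_combination hroom + hmain + θ * hA.quadForm_inv hc hσ v

lemma quadForm_inv_le_of_isSolution (hc : 0 ≤ c) (hσ : 0 < σ) (hA : IsSolution c σ H A)
    (hB : IsSolution c σ H B) (v : Fin L → ℂ) : quadForm A⁻¹ v ≤ quadForm B⁻¹ v := by
  obtain ⟨ρ, hρ0, hρ1, hρ⟩ := exists_mul_quadForm_le A⁻¹ (by positivity : 0 < σ ^ 2)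
  have hpow (n : ℕ) (v : Fin L → ℂ) : (1 - (1 - ρ) ^ n) * quadForm A⁻¹ v ≤ quadForm B⁻¹ v := by
    induction n generalizing v with
    | zero => simpa using quadForm_nonneg hB.1.inv.posSemidef v
    | succ n ih =>
      have h0 : 0 ≤ (1 - ρ) ^ n := pow_nonneg (by linarith) _
      have h1 : (1 - ρ) ^ n ≤ 1 := pow_le_one₀ (by linarith) (by linarith)
      refine le_of_eq_of_le ?_
        (quadForm_inv_le_improve hc hσ hA hB (by linarith) (by linarith) hρ ih v)
      ring
  have hlim : Tendsto (fun n : ℕ => (1 - (1 - ρ) ^ n) * quadForm A⁻¹ v) atTop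
      (𝓝 ((1 - 0) * quadForm A⁻¹ v)) :=
    (tendsto_const_nhds.sub
      (tendsto_pow_atTop_nhds_zero_of_lt_one (by linarith) (by linarith))).mul_const _
  rw [sub_zero, one_mul] at hlim
  exact le_of_tendsto hlim (Eventually.of_forall fun n => hpow n v)

theorem IsSolution.unique (hc : 0 ≤ c) (hσ : 0 < σ) (hA : IsSolution c σ H A)
    (hB : IsSolution c σ H B) : A = B := by
  have h : A⁻¹ = B⁻¹ := eq_of_quadForm_eq hA.1.inv.isHermitian hB.1.inv.isHermitian fun v =>
    le_antisymm (quadForm_inv_le_of_isSolution hc hσ hA hB v)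
      (quadForm_inv_le_of_isSolution hc hσ hB hA v)
  have hu : IsUnit A.det := (isUnit_iff_isUnit_det _).1 hA.1.isUnit
  have hv : IsUnit B.det := (isUnit_iff_isUnit_det _).1 hB.1.isUnit
  rw [← nonsing_inv_nonsing_inv A hu, h, nonsing_inv_nonsing_inv B hv]

/-! #### A lower bound for solutions -/

lemma continuous_sqNorm : Continuous (sqNorm : (Fin L → ℂ) → ℝ) := by unfold sqNorm; fun_prop

lemma norm_sqNorm_div_le_one {κ : ℝ} (hκ : 0 < κ) (α : Fin L → ℂ) :
    ‖sqNorm α / (κ + sqNorm α)‖ ≤ 1 := by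
  have := sqNorm_nonneg α
  rw [Real.norm_of_nonneg (by positivity), div_le_one (by positivity)]
  linarith

lemma continuous_sqNorm_div {κ : ℝ} (hκ : 0 < κ) :
    Continuous fun α : Fin L → ℂ => sqNorm α / (κ + sqNorm α) :=
  continuous_sqNorm.div (continuous_const.add continuous_sqNorm) fun α => by
    have := sqNorm_nonneg α
    positivity

/-- The constant in the bound `fixedPointRHS c σ H g A ≤ κ' · growthRate c σ H κ · I`, which holds
when `A ≥ κ'⁻¹ I` and `κ' ≥ κ`. -/
def growthRate (c σ : ℝ) (H : ProbabilityMeasure (Fin L → ℂ)) (κ : ℝ) : ℝ :=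
  σ ^ 2 / κ + c * ∫ α, sqNorm α / (κ + sqNorm α) ∂(H : Measure (Fin L → ℂ))

lemma exists_growthRate_le_half (c σ : ℝ) (H : ProbabilityMeasure (Fin L → ℂ)) :
    ∃ κ > 0, growthRate c σ H κ ≤ 1 / 2 := by
  have hκ : Tendsto (fun n : ℕ => (n : ℝ) + 1) atTop atTop :=
    tendsto_atTop_add_const_right _ _ tendsto_natCast_atTop_atTop
  have hint : Tendsto
      (fun n : ℕ => ∫ α, sqNorm α / (((n : ℝ) + 1) + sqNorm α) ∂(H : Measure (Fin L → ℂ)))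
      atTop (𝓝 (∫ _, (0 : ℝ) ∂(H : Measure (Fin L → ℂ)))) := by
    refine tendsto_integral_of_dominated_convergence (fun _ => 1)
      (fun n => (continuous_sqNorm_div n.cast_add_one_pos).aestronglyMeasurable)
      (integrable_const _)
      (fun n => Eventually.of_forall fun α => norm_sqNorm_div_le_one n.cast_add_one_pos α)
      (Eventually.of_forall fun α => ?_)
    exact tendsto_const_nhds.div_atTop (tendsto_atTop_add_const_right _ _ hκ)
  have hsum := (tendsto_const_nhds (x := σ ^ 2)).div_atTop hκ |>.add (hint.const_mul c)
  simp only [integral_zero, mul_zero, add_zero] at hsum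
  obtain ⟨n, hn⟩ := (hsum.eventually (ge_mem_nhds (by norm_num : (0 : ℝ) < 1 / 2))).exists
  exact ⟨n + 1, by positivity, hn⟩

lemma quadFormKernel_le {κ₀ κ : ℝ} (hκ₀ : 0 < κ₀) (hκ : κ₀ ≤ κ)
    (hgn : ∀ α, sqNorm (g α) ≤ sqNorm α) (hA : A.PosSemidef)
    (h : ∀ v, sqNorm v ≤ κ * quadForm A v) (v α : Fin L → ℂ) :
    quadFormKernel g A v α ≤ κ * sqNorm v * (sqNorm α / (κ₀ + sqNorm α)) := by
  have hα := sqNorm_nonneg α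
  have hgα := sqNorm_nonneg (g α)
  have hv := sqNorm_nonneg v
  have hAg := quadForm_nonneg hA (g α)
  have cauchy_schwarz : ‖star (g α) ⬝ᵥ v‖ ^ 2 ≤ sqNorm (g α) * sqNorm v := by
    simpa using sq_norm_dotProduct_le (star (g α)) v
  have hratio : sqNorm (g α) / (1 + quadForm A (g α)) ≤ κ * (sqNorm α / (κ₀ + sqNorm α)) := by
    rw [← mul_div_assoc, div_le_div_iff₀ (by positivity) (by positivity)]
    nlinarith [mul_le_mul_of_nonneg_left (h (g α)) hα,
      mul_le_mul hκ (hgn α) hgα (hκ₀.le.trans hκ)]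
  calc quadFormKernel g A v α ≤ sqNorm (g α) * sqNorm v / (1 + quadForm A (g α)) := by
        unfold quadFormKernel; gcongr
    _ = sqNorm v * (sqNorm (g α) / (1 + quadForm A (g α))) := by ring
    _ ≤ sqNorm v * (κ * (sqNorm α / (κ₀ + sqNorm α))) := by gcongr
    _ = κ * sqNorm v * (sqNorm α / (κ₀ + sqNorm α)) := by ring

lemma quadForm_fixedPointRHS_le (hc : 0 ≤ c) {κ₀ κ : ℝ} (hκ₀ : 0 < κ₀) (hκ : κ₀ ≤ κ)
    (hg : Continuous g) (hgn : ∀ α, sqNorm (g α) ≤ sqNorm α) (hA : A.PosSemidef)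
    (hb : KernelBounded g A) (h : ∀ v, sqNorm v ≤ κ * quadForm A v) (v : Fin L → ℂ) :
    quadForm (fixedPointRHS c σ H g A) v ≤ κ * growthRate c σ H κ₀ * sqNorm v := by
  have hint : ∫ α, quadFormKernel g A v α ∂(H : Measure (Fin L → ℂ)) ≤
      κ * sqNorm v * ∫ α, sqNorm α / (κ₀ + sqNorm α) ∂(H : Measure (Fin L → ℂ)) := by
    rw [← integral_const_mul]
    refine integral_mono (integrable_quadFormKernel hg hA hb v) (Integrable.const_mul ?_ _)
      (quadFormKernel_le hκ₀ hκ hgn hA h v)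
    exact .of_bound (continuous_sqNorm_div hκ₀).aestronglyMeasurable 1
      (Eventually.of_forall (norm_sqNorm_div_le_one hκ₀))
  have hσκ : σ ^ 2 ≤ κ * (σ ^ 2 / κ₀) := by
    rw [← mul_div_assoc, le_div_iff₀ hκ₀, mul_comm κ]
    gcongr
  have hv := sqNorm_nonneg v
  rw [quadForm_fixedPointRHS hg hA hb]
  calc c * ∫ α, quadFormKernel g A v α ∂(H : Measure (Fin L → ℂ)) + σ ^ 2 * sqNorm v
      ≤ c * (κ * sqNorm v * ∫ α, sqNorm α / (κ₀ + sqNorm α) ∂(H : Measure (Fin L → ℂ))) +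
          κ * (σ ^ 2 / κ₀) * sqNorm v := by gcongr
    _ = κ * growthRate c σ H κ₀ * sqNorm v := by rw [growthRate]; ring

/- A bound `A ≥ κ⁻¹ I` with `κ ≥ κ₀` improves itself to `A ≥ (κ / 2)⁻¹ I` through the equation. -/
lemma sqNorm_le_of_fixedPointRHS (hc : 0 ≤ c) (hσ : 0 < σ) {κ₀ : ℝ} (hκ₀ : 0 < κ₀)
    (h₀ : growthRate c σ H κ₀ ≤ 1 / 2) (hg : Continuous g) (hgn : ∀ α, sqNorm (g α) ≤ sqNorm α)
    (hA : A.PosDef) (h : A = (fixedPointRHS c σ H g A)⁻¹) (v : Fin L → ℂ) :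
    sqNorm v ≤ κ₀ * quadForm A v := by
  have hb : KernelBounded g A := kernelBounded_of_posDef hA
  have hA0 := quadForm_nonneg hA.posSemidef
  have halve {κ : ℝ} (hκ : κ₀ ≤ κ) (hκA : ∀ v, sqNorm v ≤ κ * quadForm A v) (v : Fin L → ℂ) :
      sqNorm v ≤ κ / 2 * quadForm A v := by
    have hκ_pos := hκ₀.trans_le hκ
    refine sqNorm_le_mul_quadForm hA (half_pos hκ_pos) (fun w => ?_) v
    have hw := sqNorm_nonneg w
    rw [inv_eq_fixedPointRHS hc hσ hg hA.posSemidef hb h]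
    calc quadForm (fixedPointRHS c σ H g A) w ≤ κ * growthRate c σ H κ₀ * sqNorm w :=
          quadForm_fixedPointRHS_le hc hκ₀ hκ hg hgn hA.posSemidef hb hκA w
      _ ≤ κ * (1 / 2) * sqNorm w := by gcongr
      _ = κ / 2 * sqNorm w := by ring
  obtain ⟨κ, -, hκ⟩ := exists_sqNorm_le_of_posDef hA
  have hpow (n : ℕ) (v : Fin L → ℂ) : sqNorm v ≤ max κ₀ (κ / 2 ^ n) * quadForm A v := by
    induction n generalizing v with
    | zero =>
      refine (hκ v).trans (mul_le_mul_of_nonneg_right ?_ (hA0 v))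
      simp
    | succ n ih =>
      refine (halve (le_max_left _ _) ih v).trans (mul_le_mul_of_nonneg_right ?_ (hA0 v))
      rw [div_le_iff₀ two_pos, max_mul_of_nonneg _ _ zero_le_two, pow_succ, div_mul,
        mul_div_cancel_right₀ _ two_ne_zero]
      exact max_le_max (by linarith) le_rfl
  obtain ⟨n, hn⟩ := pow_unbounded_of_one_lt (κ / κ₀) one_lt_two
  rw [div_lt_comm₀ hκ₀ (by positivity)] at hn
  simpa [max_eq_left hn.le] using hpow n v

end FixedPoint

/-! ### Passage to the limit for one realization -/

section Cutoff

variable {L : ℕ}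

/-- A continuous cutoff: the identity on the ball of radius `M + 1`, zero off the ball of radius
`M + 2`. -/
def cutoff (M : ℕ) (α : Fin L → ℂ) : Fin L → ℂ :=
  ((max 0 (min 1 ((M : ℝ) + 2 - ‖α‖)) : ℝ) : ℂ) • α

/-- A continuous function that is one wherever the cutoff is not the identity. -/
def tailFun (M : ℕ) (α : Fin L → ℂ) : ℝ := min 1 (max 0 (‖α‖ - M))

lemma continuous_cutoff (M : ℕ) : Continuous (cutoff M : (Fin L → ℂ) → Fin L → ℂ) := by
  unfold cutoff
  refine Continuous.smul (Complex.continuous_ofReal.comp ?_) continuous_id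
  fun_prop

lemma continuous_tailFun (M : ℕ) : Continuous (tailFun M : (Fin L → ℂ) → ℝ) := by
  unfold tailFun
  fun_prop

lemma cutoff_eq_self {M : ℕ} {α : Fin L → ℂ} (h : ‖α‖ ≤ M + 1) : cutoff M α = α := by
  rw [cutoff, min_eq_left (by linarith), max_eq_right zero_le_one, Complex.ofReal_one, one_smul]

lemma eventually_cutoff_eq_self (x : Fin L → ℂ) : ∀ᶠ M in atTop, cutoff M x = x := by
  obtain ⟨n, hn⟩ := exists_nat_ge ‖x‖
  filter_upwards [eventually_ge_atTop n] with M hM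
  have : (n : ℝ) ≤ M := by exact_mod_cast hM
  exact cutoff_eq_self (by linarith)

lemma norm_cutoff_coeff_le (M : ℕ) (α : Fin L → ℂ) :
    ‖((max 0 (min 1 ((M : ℝ) + 2 - ‖α‖)) : ℝ) : ℂ)‖ ≤ 1 := by
  rw [Complex.norm_real, Real.norm_of_nonneg (le_max_left _ _)]
  exact max_le zero_le_one (min_le_left _ _)

lemma norm_cutoff_apply_le (M : ℕ) (α : Fin L → ℂ) (l : Fin L) : ‖cutoff M α l‖ ≤ M + 2 := by
  refine (norm_le_pi_norm _ l).trans ?_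
  rcases le_total ‖α‖ (M + 2) with h | h
  · rw [cutoff, norm_smul]
    exact (mul_le_of_le_one_left (norm_nonneg _) (norm_cutoff_coeff_le M α)).trans h
  · rw [cutoff, max_eq_left ((min_le_right _ _).trans (by linarith))]
    simp only [Complex.ofReal_zero, zero_smul, norm_zero]
    positivity

lemma sqNorm_cutoff_le (M : ℕ) (α : Fin L → ℂ) : sqNorm (cutoff M α) ≤ sqNorm α := by
  rw [cutoff, sqNorm_smul]
  refine mul_le_of_le_one_left (sqNorm_nonneg α) ?_
  exact pow_le_one₀ (norm_nonneg _) (norm_cutoff_coeff_le M α)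

lemma tailFun_nonneg (M : ℕ) (α : Fin L → ℂ) : 0 ≤ tailFun M α :=
  le_min zero_le_one (le_max_left _ _)

lemma tailFun_le_one (M : ℕ) (α : Fin L → ℂ) : tailFun M α ≤ 1 := min_le_left _ _

lemma one_le_tailFun {M : ℕ} {α : Fin L → ℂ} (h : cutoff M α ≠ α) : 1 ≤ tailFun M α := by
  have : (M : ℝ) + 1 < ‖α‖ := by
    by_contra hn
    exact h (cutoff_eq_self (not_lt.1 hn))
  exact le_min le_rfl (le_max_of_le_right (by linarith))

lemma tendsto_integral_tailFun (H : ProbabilityMeasure (Fin L → ℂ)) :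
    Tendsto (fun M : ℕ => ∫ α, tailFun M α ∂(H : Measure (Fin L → ℂ))) atTop (𝓝 0) := by
  have h : Tendsto (fun M : ℕ => ∫ α, tailFun M α ∂(H : Measure (Fin L → ℂ)))
      atTop (𝓝 (∫ _, (0 : ℝ) ∂(H : Measure (Fin L → ℂ)))) := by
    refine tendsto_integral_of_dominated_convergence (fun _ => 1)
      (fun n => (continuous_tailFun n).aestronglyMeasurable) (integrable_const _)
      (fun n => Eventually.of_forall fun α => ?_) (Eventually.of_forall fun α => ?_)
    · rw [Real.norm_of_nonneg (tailFun_nonneg n α)]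
      exact tailFun_le_one n α
    · refine tendsto_const_nhds.congr' ?_
      obtain ⟨n, hn⟩ := exists_nat_ge ‖α‖
      filter_upwards [eventually_ge_atTop n] with m hm
      have : (n : ℝ) ≤ m := by exact_mod_cast hm
      rw [tailFun, max_eq_left (by linarith), min_eq_right zero_le_one]
  simpa using h

end Cutoff

/-! #### Limits of matrices -/

section MatrixLimit

variable {ι β : Type*} {F : Filter β} {A : β → Matrix ι ι ℂ} {B : Matrix ι ι ℂ}

lemma tendsto_matrix_iff : Tendsto A F (𝓝 B) ↔ ∀ l m, Tendsto (fun i => A i l m) F (𝓝 (B l m)) :=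
  tendsto_pi_nhds.trans (forall_congr' fun _ => tendsto_pi_nhds)

variable [Fintype ι]

lemma le_sum_sum {f : ι → ι → ℝ} (hf : ∀ l m, 0 ≤ f l m) (l m : ι) : f l m ≤ ∑ l, ∑ m, f l m :=
  (Finset.single_le_sum (f := f l) (fun m _ => hf l m) (Finset.mem_univ m)).trans
    (Finset.single_le_sum (f := fun l => ∑ m, f l m)
      (fun l _ => Finset.sum_nonneg fun m _ => hf l m) (Finset.mem_univ l))

lemma tendsto_sum_norm_sub (h : Tendsto A F (𝓝 B)) :
    Tendsto (fun i => ∑ l, ∑ m, ‖A i l m - B l m‖) F (𝓝 0) := by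
  have hsum : Tendsto (fun i => ∑ l, ∑ m, ‖A i l m - B l m‖) F (𝓝 (∑ l, ∑ m, ‖B l m - B l m‖)) :=
    tendsto_finsetSum _ fun l _ => tendsto_finsetSum _ fun m _ =>
      ((tendsto_matrix_iff.1 h l m).sub_const (B l m)).norm
  simpa using hsum

lemma tendsto_star_dotProduct_mulVec (h : Tendsto A F (𝓝 B)) (v : ι → ℂ) :
    Tendsto (fun i => star v ⬝ᵥ A i *ᵥ v) F (𝓝 (star v ⬝ᵥ B *ᵥ v)) :=
  ((Continuous.dotProduct continuous_const
    (continuous_id.matrix_mulVec continuous_const)).tendsto B).comp h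

lemma tendsto_quadForm (h : Tendsto A F (𝓝 B)) (v : ι → ℂ) :
    Tendsto (fun i => quadForm (A i) v) F (𝓝 (quadForm B v)) :=
  (Complex.continuous_re.tendsto _).comp (tendsto_star_dotProduct_mulVec h v)

end MatrixLimit

lemma posSemidef_of_tendsto {ι β : Type*} [Finite ι] {F : Filter β} [F.NeBot]
    {A : β → Matrix ι ι ℂ} {B : Matrix ι ι ℂ} (h : Tendsto A F (𝓝 B))
    (hA : ∀ i, (A i).PosSemidef) : B.PosSemidef := by
  have := Fintype.ofFinite ι
  refine posSemidef_of_quadForm_nonneg ?_ fun v =>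
    ge_of_tendsto' (tendsto_quadForm h v) fun i => quadForm_nonneg (hA i) v
  have hconj : Tendsto (fun i => (A i)ᴴ) F (𝓝 Bᴴ) :=
    (continuous_id.matrix_conjTranspose.tendsto B).comp h
  exact tendsto_nhds_unique (hconj.congr fun i => (hA i).isHermitian) h

/-! #### Limits of approximate solutions -/

section Limit

variable {L : ℕ} {H : ProbabilityMeasure (Fin L → ℂ)} {c σ : ℝ} {K : ℕ → ℕ}
  {α : ∀ N, Fin (K N) → Fin L → ℂ} {A : Matrix (Fin L) (Fin L) ℂ}
  {g : (Fin L → ℂ) → Fin L → ℂ}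

lemma rankOneTerm_eq_sum_kernelFun (g : (Fin L → ℂ) → Fin L → ℂ) (A : Matrix (Fin L) (Fin L) ℂ)
    (x : Fin L → ℂ) (l m : Fin L) :
    rankOneTerm A (g x) l m = ∑ n, A l n * kernelFun g A n m x := by
  rw [rankOneTerm_apply]
  simp only [kernelFun, mulVec, dotProduct, Finset.sum_mul, Finset.sum_div]
  refine Finset.sum_congr rfl fun n _ => ?_
  ring

lemma continuous_rankOneTerm (hg : Continuous g) (hA : A.PosSemidef) (l m : Fin L) :
    Continuous fun x => rankOneTerm A (g x) l m := by
  simp_rw [rankOneTerm_eq_sum_kernelFun]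
  exact continuous_finsetSum _ fun n _ => continuous_const.mul (continuous_kernelFun hg hA n m)

lemma mul_fixedPointRHS_apply (hg : Continuous g) (hA : A.PosSemidef) (hb : KernelBounded g A)
    (l m : Fin L) : (A * fixedPointRHS c σ H g A) l m =
      ((σ ^ 2 : ℝ) : ℂ) * A l m + c * ∫ x, rankOneTerm A (g x) l m ∂(H : Measure (Fin L → ℂ)) := by
  have hint : ∫ x, rankOneTerm A (g x) l m ∂(H : Measure (Fin L → ℂ)) =
      ∑ n, A l n * ∫ x, kernelFun g A n m x ∂(H : Measure (Fin L → ℂ)) := by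
    simp_rw [rankOneTerm_eq_sum_kernelFun]
    rw [integral_finsetSum _ fun n _ => (integrable_kernelFun hg hA hb n m).const_mul _]
    exact Finset.sum_congr rfl fun n _ => integral_const_mul _ _
  rw [hint, fixedPointRHS, mul_add, mul_smul_comm, mul_smul_comm, mul_one, Matrix.add_apply,
    Matrix.smul_apply, Matrix.smul_apply, mul_apply]
  simp only [of_apply, smul_eq_mul]
  ring

lemma posDef_of_mul_fixedPointRHS (hc : 0 ≤ c) (hσ : 0 < σ) (hg : Continuous g)
    (hA : A.PosSemidef) (hb : KernelBounded g A) (h : A * fixedPointRHS c σ H g A = 1) :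
    A.PosDef := by
  rw [← inv_eq_left_inv h]
  exact ((fixedPointRHS_coercive hc hg hA hb).posDef (by positivity)).inv

/-- Empirical averages, normalized by `N`, of bounded continuous functions of the gain vectors
converge to `c` times the expectation. -/
def AveragesTendsto (c : ℝ) (H : ProbabilityMeasure (Fin L → ℂ))
    (α : ∀ N, Fin (K N) → Fin L → ℂ) : Prop :=
  ∀ f : (Fin L → ℂ) → ℂ, Continuous f → (∃ C, ∀ x, ‖f x‖ ≤ C) →
    Tendsto (fun N : ℕ => ((1 / (N : ℝ) : ℝ) : ℂ) * ∑ k, f (α N k)) atTop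
      (𝓝 ((c : ℂ) * ∫ x, f x ∂(H : Measure (Fin L → ℂ))))

lemma AveragesTendsto.real (h : AveragesTendsto c H α) {f : (Fin L → ℂ) → ℝ} (hf : Continuous f)
    {C : ℝ} (hC : ∀ x, |f x| ≤ C) : Tendsto (fun N : ℕ => 1 / (N : ℝ) * ∑ k, f (α N k)) atTop
      (𝓝 (c * ∫ x, f x ∂(H : Measure (Fin L → ℂ)))) := by
  have hcomplex := h (fun x => (f x : ℂ)) (Complex.continuous_ofReal.comp hf)
    ⟨C, fun x => (Complex.norm_real _).trans_le (hC x)⟩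
  rw [integral_complex_ofReal] at hcomplex
  refine (((Complex.continuous_re.tendsto _).comp hcomplex).congr fun N => ?_).trans_eq ?_
  · rw [Function.comp_apply, ← Complex.ofReal_sum, ← Complex.ofReal_mul, Complex.ofReal_re]
  · rw [← Complex.ofReal_mul, Complex.ofReal_re]

lemma AveragesTendsto.ratio (h : AveragesTendsto c H α) :
    Tendsto (fun N : ℕ => (K N : ℝ) / N) atTop (𝓝 c) := by
  have := h.real (f := fun _ => 1) continuous_const (C := 1) (by simp)
  simpa [div_eq_inv_mul] using this

lemma AveragesTendsto.rankOneTerm {D : ℕ → Matrix (Fin L) (Fin L) ℂ} {ns : ℕ → ℕ} {M : ℝ}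
    (h : AveragesTendsto c H α) (hns : Tendsto ns atTop atTop) (hg : Continuous g) (hM : 0 ≤ M)
    (hgM : ∀ x l, ‖g x l‖ ≤ M) (hD : ∀ j, (D j).PosSemidef) (hlim : Tendsto D atTop (𝓝 A))
    (l m : Fin L) :
    Tendsto (fun j => ((1 / (ns j : ℝ) : ℝ) : ℂ) *
        ∑ k, rankOneTerm (D j) (g (α (ns j) k)) l m) atTop
      (𝓝 (c * ∫ x, rankOneTerm A (g x) l m ∂(H : Measure (Fin L → ℂ)))) := by
  have hA : A.PosSemidef := posSemidef_of_tendsto hlim hD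
  set τ := ∑ l, ∑ m, ‖A l m‖
  have hτ : 0 ≤ τ := by positivity
  have hAτ : ∀ l m, ‖A l m‖ ≤ τ := le_sum_sum fun _ _ => norm_nonneg _
  have hfix := (h (fun x => CDMA.rankOneTerm A (g x) l m) (continuous_rankOneTerm hg hA l m)
    ⟨_, fun x => norm_rankOneTerm_le hA hτ hM hAτ (hgM x) l m⟩).comp hns
  have hbound := ((h.ratio.comp hns).mul (tendsto_sum_norm_sub hlim)).mul_const
    (lipConst (Fintype.card (Fin L)) τ M)
  rw [mul_zero, zero_mul] at hbound
  refine tendsto_of_tendsto_of_dist hfix (squeeze_zero (fun _ => dist_nonneg) (fun j => ?_) hbound)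
  set δ := ∑ l, ∑ m, ‖D j l m - A l m‖ with hδ
  have hsum : ‖∑ k, (CDMA.rankOneTerm (D j) (g (α (ns j) k)) l m -
      CDMA.rankOneTerm A (g (α (ns j) k)) l m)‖ ≤
      K (ns j) * (lipConst (Fintype.card (Fin L)) τ M * δ) := by
    refine (norm_sum_le_of_le Finset.univ fun k _ => norm_rankOneTerm_sub_le (hD j) hA hτ hM
      (by positivity) hAτ (hgM (α (ns j) k)) (le_sum_sum fun _ _ => norm_nonneg _) l m).trans_eq ?_
    rw [Finset.sum_const, Finset.card_univ, Fintype.card_fin, nsmul_eq_mul, hδ]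
  rw [dist_comm, dist_eq_norm, Function.comp_apply, ← mul_sub, ← Finset.sum_sub_distrib, norm_mul,
    Complex.norm_real, Real.norm_of_nonneg (by positivity)]
  calc _ ≤ 1 / (ns j : ℝ) * (K (ns j) * (lipConst (Fintype.card (Fin L)) τ M * δ)) := by gcongr
    _ = _ := by rw [Function.comp_apply]; ring

lemma mul_fixedPointRHS_of_tendsto {D : ℕ → Matrix (Fin L) (Fin L) ℂ} {ns : ℕ → ℕ} {M : ℝ}
    (h : AveragesTendsto c H α) (hns : Tendsto ns atTop atTop) (hg : Continuous g) (hM : 0 ≤ M)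
    (hgM : ∀ x l, ‖g x l‖ ≤ M) (hD : ∀ j, (D j).PosSemidef) (hlim : Tendsto D atTop (𝓝 A))
    (hdefect : Tendsto (fun j => defect σ (ns j) (fun k => g (α (ns j) k)) (D j)) atTop (𝓝 0)) :
    A * fixedPointRHS c σ H g A = 1 := by
  have hA : A.PosSemidef := posSemidef_of_tendsto hlim hD
  ext l m
  have hsum := ((tendsto_matrix_iff.1 hdefect l m).add
    ((tendsto_matrix_iff.1 hlim l m).const_mul ((σ ^ 2 : ℝ) : ℂ))).add
    (h.rankOneTerm hns hg hM hgM hD hlim l m)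
  rw [Matrix.zero_apply, zero_add] at hsum
  rw [mul_fixedPointRHS_apply hg hA (kernelBounded_of_norm_le hA hM hgM)]
  refine tendsto_nhds_unique hsum (tendsto_const_nhds.congr fun j => ?_)
  simp only [defect, Matrix.sub_apply, Matrix.smul_apply, Matrix.sum_apply, smul_eq_mul]
  ring

lemma tendsto_fixedPointRHS_cutoff {D : ℕ → Matrix (Fin L) (Fin L) ℂ} (hlim : Tendsto D atTop (𝓝 A))
    (hD : ∀ M, (D M).PosSemidef) {κ : ℝ} (hκ0 : 0 ≤ κ)
    (hκ : ∀ M v, sqNorm v ≤ κ * quadForm (D M) v) :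
    Tendsto (fun M => fixedPointRHS c σ H (cutoff M) (D M)) atTop
      (𝓝 (fixedPointRHS c σ H id A)) := by
  have hA : A.PosSemidef := posSemidef_of_tendsto hlim hD
  refine Tendsto.add (Tendsto.const_smul (tendsto_matrix_iff.2 fun l m => ?_) _) tendsto_const_nhds
  refine tendsto_integral_of_dominated_convergence (fun _ => κ)
    (fun M => (continuous_kernelFun (continuous_cutoff M) (hD M) l m).aestronglyMeasurable)
    (integrable_const _)
    (fun M => Eventually.of_forall fun x => norm_kernelFun_le (hD M) (hκ M) hκ0 l m x)
    (Eventually.of_forall fun x => ?_)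
  have hx : Tendsto (fun M => kernelFun id (D M) l m x) atTop (𝓝 (kernelFun id A l m x)) :=
    Tendsto.div tendsto_const_nhds
      (tendsto_const_nhds.add (tendsto_star_dotProduct_mulVec hlim _)) (denom_ne_zero hA _)
  refine hx.congr' ?_
  filter_upwards [eventually_cutoff_eq_self x] with M hM
  rw [kernelFun, kernelFun, hM, id]

lemma isSolution_of_tendsto_cutoff {D : ℕ → Matrix (Fin L) (Fin L) ℂ} (hc : 0 ≤ c) (hσ : 0 < σ)
    (hD : ∀ M, (D M).PosDef) (h : ∀ M, D M * fixedPointRHS c σ H (cutoff M) (D M) = 1)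
    (hlim : Tendsto D atTop (𝓝 A)) : IsSolution c σ H A := by
  have hDpsd : ∀ M, (D M).PosSemidef := fun M => (hD M).posSemidef
  have hA : A.PosSemidef := posSemidef_of_tendsto hlim hDpsd
  obtain ⟨κ, hκ0, hκ⟩ := exists_growthRate_le_half c σ H
  have hlower : ∀ M v, sqNorm v ≤ κ * quadForm (D M) v := fun M =>
    sqNorm_le_of_fixedPointRHS hc hσ hκ0 hκ (continuous_cutoff M) (sqNorm_cutoff_le M) (hD M)
      (inv_eq_left_inv (h M)).symm
  have hb : KernelBounded id A := ⟨κ, norm_kernelFun_le hA (fun v =>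
    ge_of_tendsto' ((tendsto_quadForm hlim v).const_mul κ) fun M => hlower M v) hκ0.le⟩
  have hone : A * fixedPointRHS c σ H id A = 1 := tendsto_nhds_unique
    (hlim.mul (tendsto_fixedPointRHS_cutoff hlim hDpsd hκ0.le hlower))
    (tendsto_const_nhds.congr fun M => (h M).symm)
  exact isSolution_iff.2
    ⟨posDef_of_mul_fixedPointRHS hc hσ continuous_id hA hb hone, (inv_eq_left_inv hone).symm⟩

/-- Positive semidefinite matrices `D M N` that solve the fixed point equation of the gain vectors
cut off at `M` up to an error vanishing as `N → ∞`, and matrices `B N` whose distance to `D M N` is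
controlled by the number of gain vectors altered by the cut-off. The constants `τ` and `C` do not
depend on `M` and `N`. -/
structure IsCutoffApproximation (σ : ℝ) (α : ∀ N, Fin (K N) → Fin L → ℂ)
    (D : ℕ → ℕ → Matrix (Fin L) (Fin L) ℂ) (B : ℕ → Matrix (Fin L) (Fin L) ℂ) (τ C : ℝ) :
    Prop where
  posSemidef : ∀ M N, (D M N).PosSemidef
  norm_le : ∀ M N l m, ‖D M N l m‖ ≤ τ
  norm_le' : ∀ N l m, ‖B N l m‖ ≤ τ
  tendsto_defect : ∀ M, Tendsto (fun N => defect σ N (fun k => cutoff M (α N k)) (D M N)) atTop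
    (𝓝 0)
  norm_sub_le : ∀ M N l m, ‖D M N l m - B N l m‖ ≤
    (∑ k, tailFun M (α N k) + 1) * (C * (1 / (N : ℝ)))

namespace IsCutoffApproximation

variable {D : ℕ → ℕ → Matrix (Fin L) (Fin L) ℂ} {B : ℕ → Matrix (Fin L) (Fin L) ℂ} {τ C : ℝ}
  {ns : ℕ → ℕ}

lemma exists_tendsto_subseq (h : IsCutoffApproximation σ α D B τ C) (ns : ℕ → ℕ) :
    ∃ (D' : ℕ → Matrix (Fin L) (Fin L) ℂ) (A : Matrix (Fin L) (Fin L) ℂ) (φ : ℕ → ℕ),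
      StrictMono φ ∧ (∀ M, Tendsto (fun j => D M (ns (φ j))) atTop (𝓝 (D' M))) ∧
        Tendsto (fun j => B (ns (φ j))) atTop (𝓝 A) := by
  let S : Set (Matrix (Fin L) (Fin L) ℂ) :=
    Set.univ.pi fun _ => Set.univ.pi fun _ => Metric.closedBall (0 : ℂ) τ
  have hS : IsCompact S := isCompact_univ_pi fun _ => isCompact_univ_pi fun _ =>
    isCompact_closedBall _ _
  have hmem : ∀ X : Matrix (Fin L) (Fin L) ℂ, (∀ l m, ‖X l m‖ ≤ τ) → X ∈ S :=
    fun X hX l _ m _ => by simpa using hX l m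
  have : FirstCountableTopology (Matrix (Fin L) (Fin L) ℂ) :=
    inferInstanceAs (FirstCountableTopology (Fin L → Fin L → ℂ))
  obtain ⟨⟨D', A⟩, -, φ, hφ, hlim⟩ := ((isCompact_univ_pi fun _ : ℕ => hS).prod hS).tendsto_subseq
    (x := fun j => ((fun M => D M (ns j)), B (ns j)))
    fun j => ⟨fun M _ => hmem _ (h.norm_le M (ns j)), hmem _ (h.norm_le' (ns j))⟩
  rw [nhds_prod_eq, tendsto_prod_iff'] at hlim
  exact ⟨D', A, φ, hφ, fun M => tendsto_pi_nhds.1 hlim.1 M, hlim.2⟩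

lemma norm_limit_sub_le {D' : Matrix (Fin L) (Fin L) ℂ} (h : IsCutoffApproximation σ α D B τ C)
    (hav : AveragesTendsto c H α) (hns : Tendsto ns atTop atTop) {M : ℕ}
    (hD : Tendsto (fun j => D M (ns j)) atTop (𝓝 D'))
    (hB : Tendsto (fun j => B (ns j)) atTop (𝓝 A)) (l m : Fin L) :
    ‖D' l m - A l m‖ ≤ c * (∫ x, tailFun M x ∂(H : Measure (Fin L → ℂ))) * C := by
  have htail := (hav.real (continuous_tailFun M) (C := 1) fun x =>
    (abs_of_nonneg (tailFun_nonneg M x)).trans_le (tailFun_le_one M x)).comp hns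
  have hone : Tendsto (fun j => 1 / ((ns j : ℕ) : ℝ)) atTop (𝓝 0) :=
    tendsto_one_div_atTop_nhds_zero_nat.comp hns
  have hbound := (htail.add hone).mul_const C
  rw [add_zero] at hbound
  refine le_of_tendsto_of_tendsto' ((tendsto_matrix_iff.1 hD l m).sub
    (tendsto_matrix_iff.1 hB l m)).norm hbound fun j => ?_
  refine (h.norm_sub_le M (ns j) l m).trans_eq ?_
  rw [Function.comp_apply]
  ring

lemma exists_subseq_isSolution (h : IsCutoffApproximation σ α D B τ C) (hc : 0 ≤ c) (hσ : 0 < σ)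
    (hav : AveragesTendsto c H α) (hns : Tendsto ns atTop atTop) :
    ∃ (A : Matrix (Fin L) (Fin L) ℂ) (φ : ℕ → ℕ), IsSolution c σ H A ∧
      Tendsto (fun j => B (ns (φ j))) atTop (𝓝 A) := by
  obtain ⟨D', A, φ, hφ, hD, hB⟩ := h.exists_tendsto_subseq ns
  have hnφ : Tendsto (fun j => ns (φ j)) atTop atTop := hns.comp hφ.tendsto_atTop
  have hpsd : ∀ M, (D' M).PosSemidef := fun M => posSemidef_of_tendsto (hD M) fun j =>
    h.posSemidef M _
  have hone : ∀ M, D' M * fixedPointRHS c σ H (cutoff M) (D' M) = 1 := fun M =>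
    mul_fixedPointRHS_of_tendsto hav hnφ (continuous_cutoff M) (by positivity)
      (norm_cutoff_apply_le M) (fun j => h.posSemidef M _) (hD M) ((h.tendsto_defect M).comp hnφ)
  have hpos : ∀ M, (D' M).PosDef := fun M =>
    posDef_of_mul_fixedPointRHS hc hσ (continuous_cutoff M) (hpsd M)
      (kernelBounded_of_norm_le (hpsd M) (by positivity) (norm_cutoff_apply_le M)) (hone M)
  have hlim : Tendsto D' atTop (𝓝 A) := tendsto_matrix_iff.2 fun l m => by
    rw [tendsto_iff_norm_sub_tendsto_zero]
    refine squeeze_zero (fun _ => norm_nonneg _)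
      (fun M => h.norm_limit_sub_le hav hnφ (hD M) hB l m) ?_
    simpa using ((tendsto_integral_tailFun H).const_mul c).mul_const C
  exact ⟨A, φ, isSolution_of_tendsto_cutoff hc hσ hpos hone hlim, hB⟩

theorem exists_isSolution_tendsto (h : IsCutoffApproximation σ α D B τ C) (hc : 0 ≤ c)
    (hσ : 0 < σ) (hav : AveragesTendsto c H α) :
    ∃ A : Matrix (Fin L) (Fin L) ℂ, IsSolution c σ H A ∧ Tendsto B atTop (𝓝 A) := by
  obtain ⟨A, -, hA, -⟩ := h.exists_subseq_isSolution hc hσ hav tendsto_id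
  refine ⟨A, hA, tendsto_of_subseq_tendsto fun ns hns => ?_⟩
  obtain ⟨A', φ, hA', hlim⟩ := h.exists_subseq_isSolution hc hσ hav hns
  exact ⟨φ, hA'.unique hc hσ hA ▸ hlim⟩

end IsCutoffApproximation

end Limit

/-! ### Fourth moments -/

section FourthMoment

lemma norm_add_pow_four_le (S d : ℂ) :
    ‖S + d‖ ^ 4 ≤ ‖S‖ ^ 4 + 4 * (‖S‖ ^ 2 * (conj S * d).re) + 8 * (‖S‖ ^ 2 * ‖d‖ ^ 2) +
      3 * ‖d‖ ^ 4 := by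
  have hexpand : ‖S + d‖ ^ 4 = (‖S‖ ^ 2 + 2 * (conj S * d).re + ‖d‖ ^ 2) ^ 2 := by
    have hre : (S * conj d).re = (conj S * d).re := by simp
    rw [show ‖S + d‖ ^ 4 = (‖S + d‖ ^ 2) ^ 2 by ring, Complex.sq_norm, Complex.sq_norm,
      Complex.sq_norm, Complex.normSq_add, hre]
    ring
  have habs : |(conj S * d).re| ≤ ‖S‖ * ‖d‖ := by
    refine (Complex.abs_re_le_norm _).trans_eq ?_
    rw [norm_mul, RCLike.norm_conj]
  set r := (conj S * d).re
  have hsq : r ^ 2 ≤ ‖S‖ ^ 2 * ‖d‖ ^ 2 := by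
    rw [← mul_pow, ← sq_abs r]
    gcongr
  have hcubic : r * ‖d‖ ^ 2 ≤ ‖S‖ * ‖d‖ * ‖d‖ ^ 2 := by
    gcongr
    exact (le_abs_self r).trans habs
  have hamgm : 2 * (‖S‖ * ‖d‖ * ‖d‖ ^ 2) ≤ ‖S‖ ^ 2 * ‖d‖ ^ 2 + ‖d‖ ^ 4 := by
    nlinarith [sq_nonneg (‖S‖ * ‖d‖ - ‖d‖ ^ 2)]
  rw [hexpand]
  nlinarith

lemma add_three_pow_four_le (a b c : ℝ) :
    (a + b + c) ^ 4 ≤ 27 * (a ^ 4 + b ^ 4 + c ^ 4) := by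
  have hsq (x y z : ℝ) : (x + y + z) ^ 2 ≤ 3 * (x ^ 2 + y ^ 2 + z ^ 2) := by
    nlinarith [sq_nonneg (x - y), sq_nonneg (y - z), sq_nonneg (x - z)]
  calc (a + b + c) ^ 4 = ((a + b + c) ^ 2) ^ 2 := by ring
    _ ≤ (3 * (a ^ 2 + b ^ 2 + c ^ 2)) ^ 2 := by gcongr; exact hsq a b c
    _ ≤ _ := by nlinarith [hsq (a ^ 2) (b ^ 2) (c ^ 2)]

variable {Ω : Type*} [MeasurableSpace Ω] {P : Measure Ω}

lemma integral_add_three {F : Type*} [NormedAddCommGroup F] [NormedSpace ℝ F] {f g h : Ω → F}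
    (hf : Integrable f P) (hg : Integrable g P) (hh : Integrable h P) :
    ∫ ω, (f ω + g ω + h ω) ∂P = ∫ ω, f ω ∂P + ∫ ω, g ω ∂P + ∫ ω, h ω ∂P :=
  (integral_add (hf.add hg) hh).trans (congrArg (· + _) (integral_add hf hg))

lemma integral_mul_le_of_integral_sq_le {f g : Ω → ℝ} (hf : MemLp f 2 P) (hg : MemLp g 2 P)
    (hf0 : ∀ ω, 0 ≤ f ω) (hg0 : ∀ ω, 0 ≤ g ω) {a b : ℝ} (ha : 0 ≤ a) (hb : 0 ≤ b)
    (hfa : ∫ ω, f ω ^ 2 ∂P ≤ a ^ 2) (hgb : ∫ ω, g ω ^ 2 ∂P ≤ b ^ 2) :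
    ∫ ω, f ω * g ω ∂P ≤ a * b := by
  have htwo : ENNReal.ofReal 2 = 2 := by simp
  have hHolder := integral_mul_le_Lp_mul_Lq_of_nonneg Real.HolderConjugate.two_two
    (Eventually.of_forall hf0) (Eventually.of_forall hg0) (htwo ▸ hf) (htwo ▸ hg)
  simp only [Real.rpow_two, ← Real.sqrt_eq_rpow] at hHolder
  refine hHolder.trans (mul_le_mul ?_ ?_ (Real.sqrt_nonneg _) ha)
  · exact Real.sqrt_le_iff.2 ⟨ha, hfa⟩
  · exact Real.sqrt_le_iff.2 ⟨hb, hgb⟩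

section Bounded

variable {E : Type*} [NormedAddCommGroup E] [MeasurableSpace E] [BorelSpace E] {f : Ω → E}
  {C : ℝ}

lemma integrable_of_norm_le [SecondCountableTopology E] [IsFiniteMeasure P] (hf : Measurable f)
    (hC : ∀ ω, ‖f ω‖ ≤ C) : Integrable f P :=
  .of_bound hf.aestronglyMeasurable C (Eventually.of_forall hC)

lemma integrable_norm_pow_of_norm_le [IsFiniteMeasure P] (hf : Measurable f)
    (hC : ∀ ω, ‖f ω‖ ≤ C) (k : ℕ) : Integrable (fun ω => ‖f ω‖ ^ k) P :=
  integrable_of_norm_le (C := C ^ k) (hf.norm.pow_const k) fun ω => by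
    rw [norm_pow, norm_norm]
    gcongr
    exact hC ω

lemma integral_norm_pow_le_of_norm_le [IsProbabilityMeasure P] (hf : Measurable f)
    (hC : ∀ ω, ‖f ω‖ ≤ C) (k : ℕ) : ∫ ω, ‖f ω‖ ^ k ∂P ≤ C ^ k := by
  refine (integral_mono (integrable_norm_pow_of_norm_le hf hC k) (integrable_const (C ^ k))
    fun ω => ?_).trans_eq (by simp)
  simp only
  gcongr
  exact hC ω

end Bounded

variable [IsProbabilityMeasure P]

lemma integrable_norm_sq_mul_re {S d : Ω → ℂ} (hS : Measurable S) (hd : Measurable d) {C C' : ℝ}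
    (hSC : ∀ ω, ‖S ω‖ ≤ C) (hdC : ∀ ω, ‖d ω‖ ≤ C') :
    Integrable (fun ω => ‖S ω‖ ^ 2 * (conj (S ω) * d ω).re) P := by
  obtain ⟨ω₀⟩ : Nonempty Ω := P.nonempty_of_neZero
  have hC : 0 ≤ C := (norm_nonneg _).trans (hSC ω₀)
  have hmeas : Measurable fun ω => (conj (S ω) * d ω).re :=
    Complex.measurable_re.comp ((Complex.continuous_conj.measurable.comp hS).mul hd)
  refine integrable_of_norm_le (C := C ^ 2 * (C * C')) ((hS.norm.pow_const 2).mul hmeas)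
    fun ω => ?_
  calc ‖‖S ω‖ ^ 2 * (conj (S ω) * d ω).re‖
      ≤ ‖S ω‖ ^ 2 * ‖conj (S ω) * d ω‖ := by
        rw [norm_mul, norm_pow, norm_norm]
        gcongr
        exact Complex.abs_re_le_norm _
    _ = ‖S ω‖ ^ 2 * (‖S ω‖ * ‖d ω‖) := by rw [norm_mul, RCLike.norm_conj]
    _ ≤ C ^ 2 * (C * C') := by
        gcongr
        · exact hSC ω
        · exact hSC ω
        · exact hdC ω

lemma fourth_moment_add_le {S d : Ω → ℂ} (hS : Measurable S) (hd : Measurable d) {C C' : ℝ}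
    (hSC : ∀ ω, ‖S ω‖ ≤ C) (hdC : ∀ ω, ‖d ω‖ ≤ C')
    (h0 : ∫ ω, ‖S ω‖ ^ 2 * (conj (S ω) * d ω).re ∂P = 0) {A D : ℝ} (hA : 0 ≤ A) (hD : 0 ≤ D)
    (hSA : ∫ ω, ‖S ω‖ ^ 4 ∂P ≤ A ^ 2) (hdD : ∫ ω, ‖d ω‖ ^ 4 ∂P ≤ D ^ 2) :
    ∫ ω, ‖S ω + d ω‖ ^ 4 ∂P ≤ (A + 4 * D) ^ 2 := by
  have hS4 : Integrable (fun ω => ‖S ω‖ ^ 4) P := integrable_norm_pow_of_norm_le hS hSC 4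
  have hd4 : Integrable (fun ω => ‖d ω‖ ^ 4) P := integrable_norm_pow_of_norm_le hd hdC 4
  have hcross := (integrable_norm_sq_mul_re (P := P) hS hd hSC hdC).const_mul 4
  have hSd4 : Integrable (fun ω => ‖S ω + d ω‖ ^ 4) P :=
    integrable_norm_pow_of_norm_le (hS.add hd)
      (fun ω => (norm_add_le _ _).trans (add_le_add (hSC ω) (hdC ω))) 4
  have hS2 : MemLp (fun ω => ‖S ω‖ ^ 2) 2 P :=
    (memLp_two_iff_integrable_sq (by fun_prop)).2 (by simpa only [← pow_mul] using hS4)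
  have hd2 : MemLp (fun ω => ‖d ω‖ ^ 2) 2 P :=
    (memLp_two_iff_integrable_sq (by fun_prop)).2 (by simpa only [← pow_mul] using hd4)
  have hmixed : Integrable (fun ω => 8 * (‖S ω‖ ^ 2 * ‖d ω‖ ^ 2)) P :=
    (hS2.integrable_mul hd2).const_mul 8
  have hmixed_le : ∫ ω, ‖S ω‖ ^ 2 * ‖d ω‖ ^ 2 ∂P ≤ A * D :=
    integral_mul_le_of_integral_sq_le hS2 hd2 (fun _ => by positivity) (fun _ => by positivity)
      hA hD (by simpa only [← pow_mul] using hSA) (by simpa only [← pow_mul] using hdD)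
  calc ∫ ω, ‖S ω + d ω‖ ^ 4 ∂P
      ≤ ∫ ω, (‖S ω‖ ^ 4 + 4 * (‖S ω‖ ^ 2 * (conj (S ω) * d ω).re) +
          8 * (‖S ω‖ ^ 2 * ‖d ω‖ ^ 2) + 3 * ‖d ω‖ ^ 4) ∂P :=
        integral_mono hSd4 (((hS4.add hcross).add hmixed).add (hd4.const_mul 3))
          fun ω => norm_add_pow_four_le (S ω) (d ω)
    _ = ∫ ω, ‖S ω‖ ^ 4 ∂P + 8 * ∫ ω, ‖S ω‖ ^ 2 * ‖d ω‖ ^ 2 ∂P + 3 * ∫ ω, ‖d ω‖ ^ 4 ∂P := by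
        refine (integral_add ((hS4.add hcross).add hmixed) (hd4.const_mul 3)).trans ?_
        refine (congrArg (· + _) (integral_add_three hS4 hcross hmixed)).trans ?_
        rw [integral_const_mul, integral_const_mul, integral_const_mul, h0, mul_zero, add_zero]
    _ ≤ A ^ 2 + 8 * (A * D) + 3 * D ^ 2 := by gcongr
    _ ≤ (A + 4 * D) ^ 2 := by nlinarith [sq_nonneg D]

variable {X Y : Type*} [MeasurableSpace X] [MeasurableSpace Y] {ν : Measure X} {π : Measure Y}
  [IsProbabilityMeasure ν] [IsProbabilityMeasure π]

lemma fourth_moment_prod_le {S : Y → ℂ} {d : X × Y → ℂ} (hS : Measurable S) (hd : Measurable d)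
    {C C' : ℝ} (hSC : ∀ y, ‖S y‖ ≤ C) (hdC : ∀ p, ‖d p‖ ≤ C') (h0 : ∀ y, ∫ x, d (x, y) ∂ν = 0)
    {A D : ℝ} (hA : 0 ≤ A) (hD : 0 ≤ D) (hSA : ∫ y, ‖S y‖ ^ 4 ∂π ≤ A ^ 2)
    (hdD : ∫ p, ‖d p‖ ^ 4 ∂(ν.prod π) ≤ D ^ 2) :
    ∫ p, ‖S p.2 + d p‖ ^ 4 ∂(ν.prod π) ≤ (A + 4 * D) ^ 2 := by
  have hSm : Measurable fun p : X × Y => S p.2 := hS.comp measurable_snd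
  have hcross : ∫ p, ‖S p.2‖ ^ 2 * (conj (S p.2) * d p).re ∂(ν.prod π) = 0 := by
    rw [integral_prod_symm _ (integrable_norm_sq_mul_re hSm hd (fun p => hSC p.2) hdC)]
    refine integral_eq_zero_of_ae (Eventually.of_forall fun y => ?_)
    have hdi : Integrable (fun x => d (x, y)) ν :=
      integrable_of_norm_le (hd.comp measurable_prodMk_right) fun x => hdC (x, y)
    have hre : ∫ x, (conj (S y) * d (x, y)).re ∂ν = (∫ x, conj (S y) * d (x, y) ∂ν).re :=
      integral_re (hdi.const_mul _)
    simp only [Pi.zero_apply]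
    rw [integral_const_mul, hre, integral_const_mul, h0, mul_zero, Complex.zero_re, mul_zero]
  have hSA' : ∫ p : X × Y, ‖S p.2‖ ^ 4 ∂(ν.prod π) ≤ A ^ 2 := by
    rwa [integral_fun_snd (μ := ν) (ν := π) (fun y => ‖S y‖ ^ 4), probReal_univ, one_smul]
  exact fourth_moment_add_le hSm hd (fun p => hSC p.2) hdC hcross hA hD hSA' hdD

variable {E : Type*} [MeasurableSpace E] {ρ : Measure E} [IsProbabilityMeasure ρ] {n : ℕ}

lemma integral_pi_succ {F : Type*} [NormedAddCommGroup F] [NormedSpace ℝ F]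
    (f : (Fin (n + 1) → E) → F) :
    ∫ x, f x ∂(Measure.pi fun _ => ρ) =
      ∫ p : E × (Fin n → E), f (Fin.cons p.1 p.2) ∂(ρ.prod (Measure.pi fun _ => ρ)) := by
  rw [← (measurePreserving_piFinSuccAbove (fun _ : Fin (n + 1) => ρ) 0).symm.integral_comp' f]
  simp only [MeasurableEquiv.piFinSuccAbove_symm_apply, Fin.insertNthEquiv, Equiv.coe_fn_mk,
    Fin.insertNth_zero']

lemma measurable_cons :
    Measurable fun p : E × (Fin n → E) => (Fin.cons p.1 p.2 : Fin (n + 1) → E) := by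
  refine measurable_pi_iff.2 (Fin.cases ?_ fun i => ?_)
  · simpa only [Fin.cons_zero] using measurable_fst
  · simp only [Fin.cons_succ]
    fun_prop

/- One step of a martingale argument: the contribution `d` of the first coordinate has mean zero
given the others. -/
lemma fourth_moment_pi_succ_le {f : (Fin (n + 1) → E) → ℂ} {S : (Fin n → E) → ℂ}
    {d : E × (Fin n → E) → ℂ} (hf : ∀ x y, f (Fin.cons x y) = S y + d (x, y))
    (hS : Measurable S) (hd : Measurable d) {C C' : ℝ} (hSC : ∀ y, ‖S y‖ ≤ C)
    (hdC : ∀ p, ‖d p‖ ≤ C') (h0 : ∀ y, ∫ x, d (x, y) ∂ρ = 0) {A D : ℝ} (hA : 0 ≤ A) (hD : 0 ≤ D)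
    (hSA : ∫ y, ‖S y‖ ^ 4 ∂(Measure.pi fun _ => ρ) ≤ A ^ 2)
    (hdD : ∫ p, ‖d p‖ ^ 4 ∂(ρ.prod (Measure.pi fun _ => ρ)) ≤ D ^ 2) :
    ∫ x, ‖f x‖ ^ 4 ∂(Measure.pi fun _ => ρ) ≤ (A + 4 * D) ^ 2 := by
  rw [integral_pi_succ]
  simp only [hf]
  exact fourth_moment_prod_le hS hd hSC hdC h0 hA hD hSA hdD

end FourthMoment

/-! ### Bounded differences -/

section BoundedDifferences

variable {E : Type*} [MeasurableSpace E] (ρ : Measure E) {n : ℕ}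

/-- The conditional expectation of `f` given all coordinates except the first one, when the
coordinates are independent with distribution `ρ`. -/
def headIntegral (f : (Fin (n + 1) → E) → ℂ) (y : Fin n → E) : ℂ :=
  ∫ x, f (Fin.cons x y) ∂ρ

variable {ρ} [IsProbabilityMeasure ρ] {f : (Fin (n + 1) → E) → ℂ} {C δ : ℝ}

lemma norm_integral_le_of_forall_norm_le {g : E → ℂ} (hg : ∀ x, ‖g x‖ ≤ C) :
    ‖∫ x, g x ∂ρ‖ ≤ C :=
  (norm_integral_le_of_norm_le_const (Eventually.of_forall hg)).trans_eq (by simp)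

lemma integrable_cons (hf : Measurable f) (hC : ∀ x, ‖f x‖ ≤ C) (y : Fin n → E) :
    Integrable (fun x => f (Fin.cons x y)) ρ :=
  integrable_of_norm_le ((hf.comp measurable_cons).comp measurable_prodMk_right) fun _ => hC _

lemma measurable_headIntegral (hf : Measurable f) : Measurable (headIntegral ρ f) :=
  StronglyMeasurable.measurable (StronglyMeasurable.integral_prod_left
    (f := fun x (y : Fin n → E) => f (Fin.cons x y))
    (hf.comp measurable_cons).stronglyMeasurable)

lemma norm_headIntegral_le (hC : ∀ x, ‖f x‖ ≤ C) (y : Fin n → E) : ‖headIntegral ρ f y‖ ≤ C :=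
  norm_integral_le_of_forall_norm_le fun _ => hC _

lemma norm_headIntegral_update_sub_le (hf : Measurable f) (hC : ∀ x, ‖f x‖ ≤ C)
    (hδ : ∀ x k y, ‖f (Function.update x k y) - f x‖ ≤ δ) (x : Fin n → E) (k : Fin n) (y : E) :
    ‖headIntegral ρ f (Function.update x k y) - headIntegral ρ f x‖ ≤ δ := by
  rw [headIntegral, headIntegral,
    ← integral_sub (integrable_cons hf hC _) (integrable_cons hf hC _)]
  refine norm_integral_le_of_forall_norm_le fun z => ?_
  rw [Fin.cons_update]
  exact hδ _ _ _

lemma norm_sub_headIntegral_le (hf : Measurable f) (hC : ∀ x, ‖f x‖ ≤ C)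
    (hδ : ∀ x k y, ‖f (Function.update x k y) - f x‖ ≤ δ) (x : E) (y : Fin n → E) :
    ‖f (Fin.cons x y) - headIntegral ρ f y‖ ≤ δ := by
  have hsub : f (Fin.cons x y) - headIntegral ρ f y =
      ∫ z, (f (Fin.cons x y) - f (Fin.cons z y)) ∂ρ := by
    rw [integral_sub (integrable_const _) (integrable_cons hf hC y), integral_const,
      probReal_univ, one_smul, headIntegral]
  rw [hsub]
  refine norm_integral_le_of_forall_norm_le fun z => ?_
  simpa only [Fin.update_cons_zero] using hδ (Fin.cons z y) 0 x

lemma integral_headIntegral (hf : Measurable f) (hC : ∀ x, ‖f x‖ ≤ C) :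
    ∫ y, headIntegral ρ f y ∂(Measure.pi fun _ => ρ) = ∫ x, f x ∂(Measure.pi fun _ => ρ) := by
  rw [integral_pi_succ, integral_prod_symm]
  · rfl
  · exact integrable_of_norm_le (hf.comp measurable_cons) fun _ => hC _

lemma integral_sub_headIntegral (hf : Measurable f) (hC : ∀ x, ‖f x‖ ≤ C) (y : Fin n → E) :
    ∫ x, (f (Fin.cons x y) - headIntegral ρ f y) ∂ρ = 0 := by
  rw [integral_sub (integrable_cons hf hC y) (integrable_const _), integral_const, probReal_univ,
    one_smul, headIntegral, sub_self]

theorem fourth_moment_bddDiff (n : ℕ) {f : (Fin n → E) → ℂ} (hf : Measurable f)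
    (hC : ∀ x, ‖f x‖ ≤ C) (hδ : ∀ x k y, ‖f (Function.update x k y) - f x‖ ≤ δ) :
    ∫ x, ‖f x - ∫ z, f z ∂(Measure.pi fun _ => ρ)‖ ^ 4 ∂(Measure.pi fun _ => ρ) ≤
      (4 * n * δ ^ 2) ^ 2 := by
  induction n with
  | zero =>
    have hconst (x z : Fin 0 → E) : f z = f x := congrArg f (Subsingleton.elim z x)
    have hzero (x : Fin 0 → E) : f x - ∫ z, f z ∂(Measure.pi fun _ => ρ) = 0 := by
      simp [hconst x]
    simp [hzero]
  | succ n ih =>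
    rw [← integral_headIntegral hf hC]
    set c := ∫ y, headIntegral ρ f y ∂(Measure.pi fun _ => ρ)
    have hg : Measurable (headIntegral ρ f) := measurable_headIntegral hf
    have hgC := norm_headIntegral_le (ρ := ρ) hC
    have hd : Measurable fun p : E × (Fin n → E) =>
        f (Fin.cons p.1 p.2) - headIntegral ρ f p.2 :=
      (hf.comp measurable_cons).sub (hg.comp measurable_snd)
    have hdδ (p : E × (Fin n → E)) := norm_sub_headIntegral_le (ρ := ρ) hf hC hδ p.1 p.2
    refine (fourth_moment_pi_succ_le (S := fun y => headIntegral ρ f y - c)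
      (d := fun p => f (Fin.cons p.1 p.2) - headIntegral ρ f p.2)
      (fun x y => by ring) (hg.sub_const c) hd
      (fun y => (norm_sub_le _ _).trans (add_le_add_left (hgC y) _)) hdδ
      (integral_sub_headIntegral hf hC) (A := 4 * n * δ ^ 2) (D := δ ^ 2) (by positivity)
      (by positivity) (ih hg hgC (norm_headIntegral_update_sub_le hf hC hδ)) ?_).trans_eq ?_
    · exact (integral_norm_pow_le_of_norm_le hd hdδ 4).trans_eq (by ring)
    · push_cast
      ring

end BoundedDifferences

/-! ### Linear and quadratic forms in independent variables -/

section CentredForm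

section Algebra

variable {E : Type*} {n : ℕ}

/-- The linear form with coefficients `u` in the variables `h (x j)`. -/
def linearForm (h : E → ℂ) (u : Fin n → ℂ) (x : Fin n → E) : ℂ :=
  ∑ j, u j * h (x j)

lemma norm_linearForm_le {h : E → ℂ} {m : ℝ} (hm : ∀ x, ‖h x‖ ≤ m) (u : Fin n → ℂ)
    (x : Fin n → E) : ‖linearForm h u x‖ ≤ (∑ j, ‖u j‖) * m := by
  rw [Finset.sum_mul]
  refine norm_sum_le_of_le _ fun j _ => ?_
  rw [norm_mul]
  gcongr
  exact hm _

lemma linearForm_cons (h : E → ℂ) (u : Fin (n + 1) → ℂ) (x : E) (y : Fin n → E) :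
    linearForm h u (Fin.cons x y) = linearForm h (fun j => u j.succ) y + u 0 * h x := by
  simp only [linearForm, Fin.sum_univ_succ, Fin.cons_zero, Fin.cons_succ]
  rw [add_comm]

/-- The quadratic form with matrix `B` in the variables `h (x i)`, centred under the assumption
that these are independent with mean zero and variance `v`. -/
def centredForm (h : E → ℂ) (v : ℝ) (B : Matrix (Fin n) (Fin n) ℂ) (x : Fin n → E) : ℂ :=
  ∑ i, ∑ j, B i j * (conj (h (x i)) * h (x j)) - (v : ℂ) * ∑ i, B i i

/-- The part of the quadratic form `centredForm h v B` that involves the first variable. -/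
def centredIncrement (h : E → ℂ) (v : ℝ) (B : Matrix (Fin (n + 1)) (Fin (n + 1)) ℂ)
    (p : E × (Fin n → E)) : ℂ :=
  conj (h p.1) * linearForm h (fun j => B 0 j.succ) p.2 +
    h p.1 * linearForm (fun x => conj (h x)) (fun i => B i.succ 0) p.2 +
    B 0 0 * ((‖h p.1‖ ^ 2 - v : ℝ) : ℂ)

lemma centredForm_cons (h : E → ℂ) (v : ℝ) (B : Matrix (Fin (n + 1)) (Fin (n + 1)) ℂ)
    (x : E) (y : Fin n → E) :
    centredForm h v B (Fin.cons x y) =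
      centredForm h v (B.submatrix Fin.succ Fin.succ) y + centredIncrement h v B (x, y) := by
  simp only [centredForm, centredIncrement, linearForm, Fin.sum_univ_succ, Fin.cons_zero,
    Fin.cons_succ, submatrix_apply, Finset.sum_add_distrib, Finset.mul_sum]
  push_cast
  rw [← Complex.conj_mul']
  have hrow (i : Fin n) :
      B 0 i.succ * (conj (h x) * h (y i)) = conj (h x) * (B 0 i.succ * h (y i)) := by ring
  have hcol (i : Fin n) :
      B i.succ 0 * (conj (h (y i)) * h x) = h x * (B i.succ 0 * conj (h (y i))) := by ring
  simp only [hrow, hcol, mul_add, Finset.mul_sum]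
  ring

lemma norm_centredForm_le {h : E → ℂ} {m : ℝ} (hm : ∀ x, ‖h x‖ ≤ m) (v : ℝ)
    (B : Matrix (Fin n) (Fin n) ℂ) (x : Fin n → E) :
    ‖centredForm h v B x‖ ≤ (∑ i, ∑ j, ‖B i j‖ * (m * m)) + ‖(v : ℂ) * ∑ i, B i i‖ := by
  refine (norm_sub_le _ _).trans (add_le_add ?_ le_rfl)
  refine norm_sum_le_of_le _ fun i _ => norm_sum_le_of_le _ fun j _ => ?_
  rw [norm_mul, norm_mul, RCLike.norm_conj]
  gcongr
  · exact (norm_nonneg _).trans (hm (x i))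
  · exact hm _
  · exact hm _

end Algebra

variable {E : Type*} [MeasurableSpace E] {ρ : Measure E} {h : E → ℂ} {m τ : ℝ}

/-- The random variable `h` has mean zero under `ρ` and is bounded by `m`. -/
structure IsBoundedCentred (ρ : Measure E) (h : E → ℂ) (m : ℝ) : Prop where
  measurable : Measurable h
  norm_le : ∀ x, ‖h x‖ ≤ m
  integral_eq_zero : ∫ x, h x ∂ρ = 0

lemma measurable_centredForm {n : ℕ} (hh : Measurable h) (v : ℝ)
    (B : Matrix (Fin n) (Fin n) ℂ) : Measurable (centredForm h v B) := by
  have : Measurable fun x => conj (h x) := Complex.continuous_conj.measurable.comp hh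
  unfold centredForm
  fun_prop

lemma measurable_linearForm {n : ℕ} (hh : Measurable h) (u : Fin n → ℂ) :
    Measurable (linearForm h u) := by
  unfold linearForm
  fun_prop

lemma measurable_centredIncrement {n : ℕ} (hh : Measurable h) (v : ℝ)
    (B : Matrix (Fin (n + 1)) (Fin (n + 1)) ℂ) : Measurable (centredIncrement h v B) := by
  have hconj : Measurable fun x => conj (h x) := Complex.continuous_conj.measurable.comp hh
  have hrow := measurable_linearForm hh fun j : Fin n => B 0 j.succ
  have hcol := measurable_linearForm hconj fun i : Fin n => B i.succ 0
  unfold centredIncrement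
  fun_prop

namespace IsBoundedCentred

lemma conjugate (hh : IsBoundedCentred ρ h m) : IsBoundedCentred ρ (fun x => conj (h x)) m where
  measurable := Complex.continuous_conj.measurable.comp hh.measurable
  norm_le x := (RCLike.norm_conj (h x)).trans_le (hh.norm_le x)
  integral_eq_zero := by rw [integral_conj, hh.integral_eq_zero, map_zero]

variable [IsProbabilityMeasure ρ]

lemma bound_nonneg (hh : IsBoundedCentred ρ h m) : 0 ≤ m := by
  obtain ⟨x⟩ : Nonempty E := ρ.nonempty_of_neZero
  exact (norm_nonneg _).trans (hh.norm_le x)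

lemma integrable (hh : IsBoundedCentred ρ h m) : Integrable h ρ :=
  integrable_of_norm_le hh.measurable hh.norm_le

lemma norm_norm_sq_sub_le (hh : IsBoundedCentred ρ h m) (x : E) :
    ‖((‖h x‖ ^ 2 - ∫ x, ‖h x‖ ^ 2 ∂ρ : ℝ) : ℂ)‖ ≤ m ^ 2 := by
  have hx : ‖h x‖ ^ 2 ≤ m ^ 2 := by
    gcongr
    exact hh.norm_le x
  have hvar : ∫ x, ‖h x‖ ^ 2 ∂ρ ≤ m ^ 2 :=
    integral_norm_pow_le_of_norm_le hh.measurable hh.norm_le 2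
  rw [Complex.norm_real]
  exact abs_sub_le_of_nonneg_of_le (sq_nonneg _) hx (integral_nonneg fun x => sq_nonneg _) hvar

theorem fourth_moment_linearForm {n : ℕ} (hh : IsBoundedCentred ρ h m) (u : Fin n → ℂ) :
    ∫ x, ‖linearForm h u x‖ ^ 4 ∂(Measure.pi fun _ => ρ) ≤ (4 * m ^ 2 * sqNorm u) ^ 2 := by
  induction n with
  | zero => simpa [linearForm] using sq_nonneg (4 * m ^ 2 * sqNorm u)
  | succ n ih =>
    have hd : Measurable fun p : E × (Fin n → E) => u 0 * h p.1 :=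
      (hh.measurable.comp measurable_fst).const_mul _
    have hdC (p : E × (Fin n → E)) : ‖u 0 * h p.1‖ ≤ ‖u 0‖ * m := by
      rw [norm_mul]
      gcongr
      exact hh.norm_le _
    refine (fourth_moment_pi_succ_le (linearForm_cons h u) (measurable_linearForm hh.measurable _)
      hd (norm_linearForm_le hh.norm_le _) hdC
      (fun y => by rw [integral_const_mul, hh.integral_eq_zero, mul_zero])
      (mul_nonneg (by positivity) (sqNorm_nonneg _)) (D := (‖u 0‖ * m) ^ 2) (by positivity) (ih _)
      ((integral_norm_pow_le_of_norm_le hd hdC 4).trans_eq (by ring))).trans_eq ?_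
    simp only [sqNorm, Fin.sum_univ_succ]
    ring

lemma norm_centredIncrement_le {n : ℕ} (hh : IsBoundedCentred ρ h m)
    {B : Matrix (Fin (n + 1)) (Fin (n + 1)) ℂ} (hB : ‖B 0 0‖ ≤ τ) (p : E × (Fin n → E)) :
    ‖centredIncrement h (∫ x, ‖h x‖ ^ 2 ∂ρ) B p‖ ≤
      m * ‖linearForm h (fun j => B 0 j.succ) p.2‖ +
        m * ‖linearForm (fun x => conj (h x)) (fun i => B i.succ 0) p.2‖ +
        τ * m ^ 2 := by
  have := hh.bound_nonneg
  refine norm_add₃_le.trans ?_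
  rw [norm_mul, norm_mul, norm_mul, RCLike.norm_conj]
  gcongr
  · exact hh.norm_le _
  · exact hh.norm_le _
  · exact (norm_nonneg _).trans hB
  · exact hh.norm_norm_sq_sub_le _

lemma integral_centredIncrement {n : ℕ} (hh : IsBoundedCentred ρ h m)
    (B : Matrix (Fin (n + 1)) (Fin (n + 1)) ℂ) (y : Fin n → E) :
    ∫ x, centredIncrement h (∫ x, ‖h x‖ ^ 2 ∂ρ) B (x, y) ∂ρ = 0 := by
  have hsq : Integrable (fun x => ‖h x‖ ^ 2) ρ :=
    integrable_norm_pow_of_norm_le hh.measurable hh.norm_le 2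
  have hcentred : Integrable (fun x => ((‖h x‖ ^ 2 - ∫ x, ‖h x‖ ^ 2 ∂ρ : ℝ) : ℂ)) ρ :=
    (hsq.sub (integrable_const _)).ofReal
  simp only [centredIncrement]
  rw [integral_add_three (hh.conjugate.integrable.mul_const _) (hh.integrable.mul_const _)
    (hcentred.const_mul _), integral_mul_const, integral_mul_const,
    hh.conjugate.integral_eq_zero, hh.integral_eq_zero, integral_const_mul,
    integral_complex_ofReal, integral_sub hsq (integrable_const _), integral_const, probReal_univ,
    one_smul, sub_self, Complex.ofReal_zero, mul_zero, zero_mul, zero_mul, add_zero, add_zero]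

lemma fourth_moment_linearForm_snd_le {n : ℕ} (hh : IsBoundedCentred ρ h m) {u : Fin n → ℂ}
    (hu : sqNorm u ≤ τ ^ 2) :
    ∫ p : E × (Fin n → E), ‖linearForm h u p.2‖ ^ 4 ∂(ρ.prod (Measure.pi fun _ => ρ)) ≤
      (4 * m ^ 2 * τ ^ 2) ^ 2 := by
  have hu0 := sqNorm_nonneg u
  rw [integral_fun_snd (fun y => ‖linearForm h u y‖ ^ 4), probReal_univ, one_smul]
  exact (hh.fourth_moment_linearForm u).trans (by gcongr)

lemma fourth_moment_centredIncrement_le {n : ℕ} (hh : IsBoundedCentred ρ h m)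
    {B : Matrix (Fin (n + 1)) (Fin (n + 1)) ℂ} (hB : ‖B 0 0‖ ≤ τ)
    (hrow : sqNorm (fun j : Fin n => B 0 j.succ) ≤ τ ^ 2)
    (hcol : sqNorm (fun i : Fin n => B i.succ 0) ≤ τ ^ 2) :
    ∫ p, ‖centredIncrement h (∫ x, ‖h x‖ ^ 2 ∂ρ) B p‖ ^ 4 ∂(ρ.prod (Measure.pi fun _ => ρ)) ≤
      (30 * (m ^ 4 * τ ^ 2)) ^ 2 := by
  set U := fun p : E × (Fin n → E) => linearForm h (fun j => B 0 j.succ) p.2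
  set W := fun p : E × (Fin n → E) =>
    linearForm (fun x => conj (h x)) (fun i => B i.succ 0) p.2
  have hU : Integrable (fun p => ‖U p‖ ^ 4) (ρ.prod (Measure.pi fun _ => ρ)) :=
    integrable_norm_pow_of_norm_le ((measurable_linearForm hh.measurable _).comp measurable_snd)
      (fun p => norm_linearForm_le hh.norm_le _ p.2) 4
  have hW : Integrable (fun p => ‖W p‖ ^ 4) (ρ.prod (Measure.pi fun _ => ρ)) :=
    integrable_norm_pow_of_norm_le
      ((measurable_linearForm hh.conjugate.measurable _).comp measurable_snd)
      (fun p => norm_linearForm_le hh.conjugate.norm_le _ p.2) 4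
  have hpointwise (p : E × (Fin n → E)) :
      ‖centredIncrement h (∫ x, ‖h x‖ ^ 2 ∂ρ) B p‖ ^ 4 ≤
        27 * m ^ 4 * ‖U p‖ ^ 4 + 27 * m ^ 4 * ‖W p‖ ^ 4 + 27 * (τ * m ^ 2) ^ 4 :=
    calc _ ≤ (m * ‖U p‖ + m * ‖W p‖ + τ * m ^ 2) ^ 4 := by
          gcongr
          exact hh.norm_centredIncrement_le hB p
      _ ≤ _ := add_three_pow_four_le _ _ _
      _ = _ := by ring
  calc ∫ p, ‖centredIncrement h (∫ x, ‖h x‖ ^ 2 ∂ρ) B p‖ ^ 4 ∂(ρ.prod (Measure.pi fun _ => ρ))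
      ≤ ∫ p, (27 * m ^ 4 * ‖U p‖ ^ 4 + 27 * m ^ 4 * ‖W p‖ ^ 4 + 27 * (τ * m ^ 2) ^ 4)
          ∂(ρ.prod (Measure.pi fun _ => ρ)) :=
        integral_mono_of_nonneg (Eventually.of_forall fun p => by positivity)
          (((hU.const_mul _).add (hW.const_mul _)).add (integrable_const _))
          (Eventually.of_forall hpointwise)
    _ = 27 * m ^ 4 * ∫ p, ‖U p‖ ^ 4 ∂(ρ.prod (Measure.pi fun _ => ρ)) +
          27 * m ^ 4 * ∫ p, ‖W p‖ ^ 4 ∂(ρ.prod (Measure.pi fun _ => ρ)) +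
          27 * (τ * m ^ 2) ^ 4 := by
        rw [integral_add_three (hU.const_mul _) (hW.const_mul _) (integrable_const _),
          integral_const_mul, integral_const_mul, integral_const, probReal_univ, one_smul]
    _ ≤ 27 * m ^ 4 * (4 * m ^ 2 * τ ^ 2) ^ 2 + 27 * m ^ 4 * (4 * m ^ 2 * τ ^ 2) ^ 2 +
          27 * (τ * m ^ 2) ^ 4 := by
        gcongr
        · exact hh.fourth_moment_linearForm_snd_le hrow
        · exact hh.conjugate.fourth_moment_linearForm_snd_le hcol
    _ = 891 * (m ^ 4 * τ ^ 2) ^ 2 := by ring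
    _ ≤ (30 * (m ^ 4 * τ ^ 2)) ^ 2 := by nlinarith [sq_nonneg (m ^ 4 * τ ^ 2)]

end IsBoundedCentred

lemma sqNorm_comp_succ_le {n : ℕ} {u : Fin (n + 1) → ℂ} {a : ℝ} (hu : sqNorm u ≤ a) :
    sqNorm (fun j : Fin n => u j.succ) ≤ a := by
  refine le_trans ?_ hu
  rw [sqNorm, sqNorm, Fin.sum_univ_succ]
  exact le_add_of_nonneg_left (by positivity)

theorem IsBoundedCentred.fourth_moment_centredForm [IsProbabilityMeasure ρ] {n : ℕ}
    (hh : IsBoundedCentred ρ h m) (hτ : 0 ≤ τ) {B : Matrix (Fin n) (Fin n) ℂ}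
    (hrow : ∀ i, ∑ j, ‖B i j‖ ^ 2 ≤ τ ^ 2) (hcol : ∀ j, ∑ i, ‖B i j‖ ^ 2 ≤ τ ^ 2) :
    ∫ x, ‖centredForm h (∫ x, ‖h x‖ ^ 2 ∂ρ) B x‖ ^ 4 ∂(Measure.pi fun _ => ρ) ≤
      (120 * n * (m ^ 4 * τ ^ 2)) ^ 2 := by
  have hm := hh.bound_nonneg
  set v := ∫ x, ‖h x‖ ^ 2 ∂ρ
  induction n with
  | zero => simp [centredForm]
  | succ n ih =>
    have hB : ‖B 0 0‖ ≤ τ := le_of_sq_le_sq ((Finset.single_le_sum (f := fun j => ‖B 0 j‖ ^ 2)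
      (fun _ _ => sq_nonneg _) (Finset.mem_univ 0)).trans (hrow 0)) hτ
    have hincrement (p : E × (Fin n → E)) : ‖centredIncrement h v B p‖ ≤
        m * ((∑ j : Fin n, ‖B 0 j.succ‖) * m) + m * ((∑ i : Fin n, ‖B i.succ 0‖) * m) +
          τ * m ^ 2 := by
      refine (hh.norm_centredIncrement_le hB p).trans ?_
      gcongr
      · exact norm_linearForm_le hh.norm_le _ p.2
      · exact norm_linearForm_le hh.conjugate.norm_le _ p.2
    have htail : ∫ y, ‖centredForm h v (B.submatrix Fin.succ Fin.succ) y‖ ^ 4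
        ∂(Measure.pi fun _ => ρ) ≤ (120 * n * (m ^ 4 * τ ^ 2)) ^ 2 :=
      ih (fun i => sqNorm_comp_succ_le (u := B i.succ) (hrow i.succ))
        fun j => sqNorm_comp_succ_le (u := fun i => B i j.succ) (hcol j.succ)
    refine (fourth_moment_pi_succ_le (centredForm_cons h v B)
      (measurable_centredForm hh.measurable v _) (measurable_centredIncrement hh.measurable v B)
      (norm_centredForm_le hh.norm_le v _) hincrement (hh.integral_centredIncrement B)
      (A := 120 * n * (m ^ 4 * τ ^ 2)) (D := 30 * (m ^ 4 * τ ^ 2)) (by positivity)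
      (by positivity) htail
      (hh.fourth_moment_centredIncrement_le hB (sqNorm_comp_succ_le (u := B 0) (hrow 0))
        (sqNorm_comp_succ_le (u := fun i => B i 0) (hcol 0)))).trans_eq ?_
    push_cast
    ring

end CentredForm

/-! ### Truncation -/

section Truncation

/-- Truncation at modulus `n`: larger values are replaced by `0`. -/
def truncate (n : ℕ) (x : ℂ) : ℂ := if ‖x‖ ≤ n then x else 0

lemma measurable_truncate (n : ℕ) : Measurable (truncate n) :=
  .ite (measurableSet_le measurable_norm measurable_const) measurable_id measurable_const

lemma norm_truncate_le (n : ℕ) (x : ℂ) : ‖truncate n x‖ ≤ n := by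
  by_cases hx : ‖x‖ ≤ n <;> simp [truncate, hx]

lemma norm_truncate_le_norm (n : ℕ) (x : ℂ) : ‖truncate n x‖ ≤ ‖x‖ := by
  by_cases hx : ‖x‖ ≤ n <;> simp [truncate, hx]

lemma norm_sub_truncate_le_norm (n : ℕ) (x : ℂ) : ‖x - truncate n x‖ ≤ ‖x‖ := by
  by_cases hx : ‖x‖ ≤ n <;> simp [truncate, hx]

lemma tendsto_truncate (x : ℂ) : Tendsto (fun n => truncate n x) atTop (𝓝 x) := by
  refine tendsto_const_nhds.congr' ?_
  filter_upwards [tendsto_natCast_atTop_atTop.eventually_ge_atTop ‖x‖] with n hn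
  simp [truncate, hn]

variable {μ : Measure ℂ}

lemma integrable_norm_sq_of_integral_eq_one (h1 : ∫ x, ‖x‖ ^ 2 ∂μ = 1) :
    Integrable (fun x : ℂ => ‖x‖ ^ 2) μ :=
  .of_integral_ne_zero (h1.trans_ne one_ne_zero)

lemma norm_integral_truncate_le (hid : Integrable (fun x : ℂ => x) μ) (n : ℕ) :
    ‖∫ x, truncate n x ∂μ‖ ≤ ∫ x, ‖x‖ ∂μ :=
  norm_integral_le_of_norm_le hid.norm (Eventually.of_forall (norm_truncate_le_norm n))

variable (μ) in
/-- The truncation of the identity, recentred to have mean zero under `μ`. -/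
def centredTruncate (n : ℕ) (x : ℂ) : ℂ := truncate n x - ∫ y, truncate n y ∂μ

lemma norm_centredTruncate_le (hid : Integrable (fun x : ℂ => x) μ) (n : ℕ) (x : ℂ) :
    ‖centredTruncate μ n x‖ ≤ ‖x‖ + ∫ y, ‖y‖ ∂μ :=
  (norm_sub_le _ _).trans
    (add_le_add (norm_truncate_le_norm n x) (norm_integral_truncate_le hid n))

lemma norm_sub_centredTruncate_le (hid : Integrable (fun x : ℂ => x) μ) (n : ℕ) (x : ℂ) :
    ‖x - centredTruncate μ n x‖ ≤ ‖x‖ + ∫ y, ‖y‖ ∂μ := by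
  rw [centredTruncate, ← sub_add]
  exact (norm_add_le _ _).trans
    (add_le_add (norm_sub_truncate_le_norm n x) (norm_integral_truncate_le hid n))

lemma tendsto_centredTruncate (hid : Integrable (fun x : ℂ => x) μ) (h0 : ∫ x, x ∂μ = 0) (x : ℂ) :
    Tendsto (fun n => centredTruncate μ n x) atTop (𝓝 x) := by
  have hmean : Tendsto (fun n => ∫ x, truncate n x ∂μ) atTop (𝓝 0) := h0 ▸
    tendsto_integral_of_dominated_convergence (fun x => ‖x‖)
      (fun n => (measurable_truncate n).aestronglyMeasurable) hid.norm
      (fun n => Eventually.of_forall (norm_truncate_le_norm n))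
      (Eventually.of_forall tendsto_truncate)
  simpa only [centredTruncate, sub_zero] using (tendsto_truncate x).sub hmean

variable [IsProbabilityMeasure μ]

lemma integrable_id_of_integrable_norm_sq (hsq : Integrable (fun x : ℂ => ‖x‖ ^ 2) μ) :
    Integrable (fun x : ℂ => x) μ :=
  ((memLp_two_iff_integrable_sq_norm aestronglyMeasurable_id).2 hsq).integrable one_le_two

lemma isBoundedCentred_centredTruncate (n : ℕ) :
    IsBoundedCentred μ (centredTruncate μ n) (n + n) where
  measurable := (measurable_truncate n).sub_const _
  norm_le x := (norm_sub_le _ _).trans (add_le_add (norm_truncate_le n x)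
    (norm_integral_le_of_forall_norm_le (norm_truncate_le n)))
  integral_eq_zero := by
    unfold centredTruncate
    rw [integral_sub (integrable_of_norm_le (measurable_truncate n) (norm_truncate_le n))
      (integrable_const _), integral_const, probReal_univ, one_smul, sub_self]

lemma tendsto_integral_norm_sq_of_norm_le (hsq : Integrable (fun x : ℂ => ‖x‖ ^ 2) μ)
    {F : ℕ → ℂ → ℂ} {G : ℂ → ℂ} (hF : ∀ n, Measurable (F n)) {I : ℝ}
    (hFI : ∀ n x, ‖F n x‖ ≤ ‖x‖ + I) (hlim : ∀ x, Tendsto (fun n => F n x) atTop (𝓝 (G x))) :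
    Tendsto (fun n => ∫ x, ‖F n x‖ ^ 2 ∂μ) atTop (𝓝 (∫ x, ‖G x‖ ^ 2 ∂μ)) := by
  refine tendsto_integral_of_dominated_convergence (fun x => 2 * ‖x‖ ^ 2 + 2 * I ^ 2)
    (fun n => ((hF n).norm.pow_const 2).aestronglyMeasurable)
    ((hsq.const_mul 2).add (integrable_const _)) (fun n => Eventually.of_forall fun x => ?_)
    (Eventually.of_forall fun x => (hlim x).norm.pow 2)
  rw [norm_pow, norm_norm]
  calc ‖F n x‖ ^ 2 ≤ (‖x‖ + I) ^ 2 := by gcongr; exact hFI n x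
    _ ≤ 2 * ‖x‖ ^ 2 + 2 * I ^ 2 := by nlinarith [sq_nonneg (‖x‖ - I)]

variable (μ) in
/-- `h` is a bounded centred approximation of a variable with law `μ` and unit variance: the squared
`L²`-error and the error of the variance are at most `η ^ 2`. -/
structure IsTruncation (η : ℝ) (h : ℂ → ℂ) (m : ℝ) : Prop extends IsBoundedCentred μ h m where
  integral_error_le : ∫ x, ‖x - h x‖ ^ 2 ∂μ ≤ η ^ 2
  abs_variance_sub_one_le : |∫ x, ‖h x‖ ^ 2 ∂μ - 1| ≤ η ^ 2

lemma IsBoundedCentred.integrable_error {h : ℂ → ℂ} {m : ℝ} (hh : IsBoundedCentred μ h m)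
    (hsq : Integrable (fun x : ℂ => ‖x‖ ^ 2) μ) : Integrable (fun x => ‖x - h x‖ ^ 2) μ :=
  (((memLp_two_iff_integrable_sq_norm aestronglyMeasurable_id).2 hsq).sub
    (.of_bound hh.measurable.aestronglyMeasurable m (.of_forall hh.norm_le))).integrable_norm_pow
      two_ne_zero

lemma IsBoundedCentred.integrable_norm_sq {h : ℂ → ℂ} {m : ℝ} (hh : IsBoundedCentred μ h m) :
    Integrable (fun x => ‖h x‖ ^ 2) μ :=
  integrable_norm_pow_of_norm_le hh.measurable hh.norm_le 2

lemma exists_isTruncation (h0 : ∫ x, x ∂μ = 0) (h1 : ∫ x, ‖x‖ ^ 2 ∂μ = 1) {η : ℝ} (hη : 0 < η) :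
    ∃ h m, IsTruncation μ η h m := by
  have hsq := integrable_norm_sq_of_integral_eq_one h1
  have hid := integrable_id_of_integrable_norm_sq hsq
  have hmeas (n : ℕ) := (isBoundedCentred_centredTruncate (μ := μ) n).measurable
  have hlim := tendsto_centredTruncate hid h0
  have herror : Tendsto (fun n => ∫ x, ‖x - centredTruncate μ n x‖ ^ 2 ∂μ) atTop (𝓝 0) := by
    simpa using tendsto_integral_norm_sq_of_norm_le hsq (fun n => measurable_id.sub (hmeas n))
      (norm_sub_centredTruncate_le hid) fun x => (hlim x).const_sub x
  have hvariance : Tendsto (fun n => ∫ x, ‖centredTruncate μ n x‖ ^ 2 ∂μ) atTop (𝓝 1) :=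
    h1 ▸ tendsto_integral_norm_sq_of_norm_le hsq hmeas (norm_centredTruncate_le hid) hlim
  obtain ⟨n, hn_error, hn_variance⟩ := ((herror.eventually (ge_mem_nhds (pow_pos hη 2))).and
    (hvariance.eventually (Metric.closedBall_mem_nhds 1 (pow_pos hη 2)))).exists
  exact ⟨_, _, isBoundedCentred_centredTruncate n, hn_error,
    (Real.dist_eq _ _).symm.trans_le hn_variance⟩

end Truncation

/-! ### Quadratic forms of bounded matrices -/

section BoundedForm

variable {N : ℕ} {τ η v : ℝ} {B : Matrix (Fin N) (Fin N) ℂ}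

/-- The operator norm of `B` is at most `τ`, in the form in which it is used. -/
structure BoundedForm (τ : ℝ) (B : Matrix (Fin N) (Fin N) ℂ) : Prop where
  sqNorm_mulVec_le : ∀ y, sqNorm (B *ᵥ y) ≤ τ ^ 2 * sqNorm y
  row_le : ∀ i, ∑ j, ‖B i j‖ ^ 2 ≤ τ ^ 2
  col_le : ∀ j, ∑ i, ‖B i j‖ ^ 2 ≤ τ ^ 2

lemma BoundedForm.norm_sum_diag_le (hB : BoundedForm τ B) (hτ : 0 ≤ τ) :
    ‖∑ i, B i i‖ ≤ N * τ := by
  refine (norm_sum_le_of_le _ fun i _ => ?_).trans_eq (b := ∑ _i : Fin N, τ) (by simp)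
  exact le_of_sq_le_sq ((Finset.single_le_sum (f := fun j => ‖B i j‖ ^ 2)
    (fun _ _ => sq_nonneg _) (Finset.mem_univ i)).trans (hB.row_le i)) hτ

lemma BoundedForm.norm_dotProduct_mulVec_le (hB : BoundedForm τ B) (hτ : 0 ≤ τ)
    (x y : Fin N → ℂ) : ‖star x ⬝ᵥ B *ᵥ y‖ ≤ τ * (√(sqNorm x) * √(sqNorm y)) := by
  have hBy : √(sqNorm (B *ᵥ y)) ≤ τ * √(sqNorm y) := by
    rw [← Real.sqrt_sq hτ, ← Real.sqrt_mul (sq_nonneg τ)]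
    exact Real.sqrt_le_sqrt (hB.sqNorm_mulVec_le y)
  calc ‖star x ⬝ᵥ B *ᵥ y‖ ≤ √(sqNorm x) * √(sqNorm (B *ᵥ y)) := by
        simpa only [sqNorm_star] using norm_dotProduct_le (star x) (B *ᵥ y)
    _ ≤ √(sqNorm x) * (τ * √(sqNorm y)) := by gcongr
    _ = τ * (√(sqNorm x) * √(sqNorm y)) := by ring

lemma sqrt_mul_sqrt_le {a b : ℝ} (ha : 0 ≤ a) (hb : 0 ≤ b) (hη : 0 < η) :
    √a * √b ≤ η * a / 2 + b / (2 * η) := by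
  have hsquare : η * a / 2 + b / (2 * η) - √a * √b = (η * √a - √b) ^ 2 / (2 * η) := by
    field_simp
    nlinarith [Real.sq_sqrt ha, Real.sq_sqrt hb]
  have : 0 ≤ (η * √a - √b) ^ 2 / (2 * η) := by positivity
  linarith

lemma form_eq_centredForm (B : Matrix (Fin N) (Fin N) ℂ) (h : ℂ → ℂ) (v : ℝ) (x : Fin N → ℂ) :
    star (h ∘ x) ⬝ᵥ B *ᵥ (h ∘ x) = centredForm h v B x + (v : ℂ) * ∑ i, B i i := by
  simp only [centredForm, dotProduct, mulVec, sub_add_cancel, Finset.mul_sum]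
  refine Finset.sum_congr rfl fun i _ => Finset.sum_congr rfl fun j _ => ?_
  simp only [Pi.star_apply, starRingEnd_apply, Function.comp_apply]
  ring

lemma BoundedForm.norm_cross_terms_le (hB : BoundedForm τ B) (hτ : 0 ≤ τ) (hη : 0 < η)
    (x z w : Fin N → ℂ) : ‖star x ⬝ᵥ B *ᵥ w + star w ⬝ᵥ B *ᵥ z‖ ≤
      τ * (η * (sqNorm x + sqNorm z) / 2 + sqNorm w / η) :=
  calc ‖star x ⬝ᵥ B *ᵥ w + star w ⬝ᵥ B *ᵥ z‖
      ≤ τ * (√(sqNorm x) * √(sqNorm w)) + τ * (√(sqNorm w) * √(sqNorm z)) :=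
        norm_add_le_of_le (hB.norm_dotProduct_mulVec_le hτ x w)
          (hB.norm_dotProduct_mulVec_le hτ w z)
    _ = τ * (√(sqNorm x) * √(sqNorm w) + √(sqNorm z) * √(sqNorm w)) := by ring
    _ ≤ τ * ((η * sqNorm x / 2 + sqNorm w / (2 * η)) +
          (η * sqNorm z / 2 + sqNorm w / (2 * η))) := by
        gcongr <;> exact sqrt_mul_sqrt_le (sqNorm_nonneg _) (sqNorm_nonneg _) hη
    _ = τ * (η * (sqNorm x + sqNorm z) / 2 + sqNorm w / η) := by ring

lemma BoundedForm.norm_scaled_sum_diag_le (hB : BoundedForm τ B) (hτ : 0 ≤ τ) :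
    ‖((1 / (N : ℝ) : ℝ) : ℂ) * ∑ i, B i i‖ ≤ τ := by
  rw [norm_mul, Complex.norm_real, Real.norm_of_nonneg (by positivity)]
  calc 1 / (N : ℝ) * ‖∑ i, B i i‖ ≤ 1 / N * (N * τ) := by gcongr; exact hB.norm_sum_diag_le hτ
    _ = N / N * τ := by ring
    _ ≤ 1 * τ := by gcongr; exact div_self_le_one _
    _ = τ := one_mul τ

/-- The difference between the normalized quadratic form of `B` at `x` and the normalized trace of
`B`. -/
def formDeviation (B : Matrix (Fin N) (Fin N) ℂ) (x : Fin N → ℂ) : ℂ :=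
  ((1 / (N : ℝ) : ℝ) : ℂ) * (star x ⬝ᵥ B *ᵥ x) - ((1 / (N : ℝ) : ℝ) : ℂ) * ∑ i, B i i

lemma formDeviation_eq (B : Matrix (Fin N) (Fin N) ℂ) (h : ℂ → ℂ) (v : ℝ) (x : Fin N → ℂ) :
    formDeviation B x =
      ((1 / (N : ℝ) : ℝ) : ℂ) * (star x ⬝ᵥ B *ᵥ (x - h ∘ x) + star (x - h ∘ x) ⬝ᵥ B *ᵥ (h ∘ x)) +
        (v - 1 : ℝ) * (((1 / (N : ℝ) : ℝ) : ℂ) * ∑ i, B i i) +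
        ((1 / (N : ℝ) : ℝ) : ℂ) * centredForm h v B x := by
  have hcross : star x ⬝ᵥ B *ᵥ (x - h ∘ x) + star (x - h ∘ x) ⬝ᵥ B *ᵥ (h ∘ x) =
      star x ⬝ᵥ B *ᵥ x - star (h ∘ x) ⬝ᵥ B *ᵥ (h ∘ x) := by
    rw [star_sub, mulVec_sub, dotProduct_sub, sub_dotProduct]
    ring
  rw [formDeviation, hcross, form_eq_centredForm B h v x]
  push_cast
  ring

/-- The mean of `‖x i‖ ^ 2` over all coordinates `i`. -/
def meanSq (x : Fin N → ℂ) : ℝ := 1 / (N : ℝ) * sqNorm x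

/-- An upper bound for the part of `formDeviation` that comes from replacing each coordinate by its
truncation under `h`, whose variance is `v`; the parameter `η` is the weight in the inequality
between the arithmetic and the geometric mean. -/
def truncationError (τ η : ℝ) (h : ℂ → ℂ) (v : ℝ) (x : Fin N → ℂ) : ℝ :=
  τ * (η * (meanSq x + meanSq (h ∘ x)) / 2 + meanSq (x - h ∘ x) / η) + |v - 1| * τ

lemma BoundedForm.norm_formDeviation_le (hB : BoundedForm τ B) (hτ : 0 ≤ τ) (hη : 0 < η)
    (h : ℂ → ℂ) (v : ℝ) (x : Fin N → ℂ) : ‖formDeviation B x‖ ≤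
      truncationError τ η h v x + ‖((1 / (N : ℝ) : ℝ) : ℂ) * centredForm h v B x‖ := by
  rw [formDeviation_eq B h v x]
  refine norm_add₃_le.trans (add_le_add_left (add_le_add ?_ ?_) _)
  · rw [norm_mul, Complex.norm_real, Real.norm_of_nonneg (by positivity)]
    calc _ ≤ 1 / (N : ℝ) *
          (τ * (η * (sqNorm x + sqNorm (h ∘ x)) / 2 + sqNorm (x - h ∘ x) / η)) := by
          gcongr
          exact hB.norm_cross_terms_le hτ hη x (h ∘ x) (x - h ∘ x)
      _ = _ := by unfold meanSq; ring
  · rw [norm_mul, Complex.norm_real, Real.norm_eq_abs]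
    gcongr
    exact hB.norm_scaled_sum_diag_le hτ

variable {μ : Measure ℂ} [IsProbabilityMeasure μ] {h : ℂ → ℂ} {m : ℝ}

lemma integrable_comp_eval {f : ℂ → ℝ} (hf : Integrable f μ) (i : Fin N) :
    Integrable (fun x : Fin N → ℂ => f (x i)) (Measure.pi fun _ => μ) :=
  (measurePreserving_eval (fun _ : Fin N => μ) i).integrable_comp_of_integrable hf

lemma integrable_meanSq_comp {f : ℂ → ℂ} (hf : Integrable (fun x => ‖f x‖ ^ 2) μ) :
    Integrable (fun x : Fin N → ℂ => meanSq (f ∘ x)) (Measure.pi fun _ => μ) :=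
  (integrable_finsetSum _ fun i _ => integrable_comp_eval hf i).const_mul _

lemma integral_meanSq_comp {f : ℂ → ℂ} (hf : Integrable (fun x => ‖f x‖ ^ 2) μ) (hN : N ≠ 0) :
    ∫ x : Fin N → ℂ, meanSq (f ∘ x) ∂(Measure.pi fun _ => μ) = ∫ x, ‖f x‖ ^ 2 ∂μ := by
  have heval (i : Fin N) :
      ∫ x : Fin N → ℂ, ‖f (x i)‖ ^ 2 ∂(Measure.pi fun _ => μ) = ∫ x, ‖f x‖ ^ 2 ∂μ :=
    integral_comp_eval (μ := fun _ : Fin N => μ) hf.aestronglyMeasurable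
  have : (N : ℝ) ≠ 0 := Nat.cast_ne_zero.2 hN
  simp only [meanSq, sqNorm, Function.comp_apply]
  rw [integral_const_mul, integral_finsetSum _ fun i _ => integrable_comp_eval hf i]
  simp only [heval, Finset.sum_const, Finset.card_univ, Fintype.card_fin, nsmul_eq_mul]
  field_simp

lemma truncationError_mean_le {e : ℝ} (hτ : 0 ≤ τ) (hη : 0 < η) (hη1 : η ≤ 1) (he : e ≤ η ^ 2)
    (hv : |v - 1| ≤ η ^ 2) : τ * (η * (1 + v) / 2 + e / η) + |v - 1| * τ ≤ 4 * τ * η := by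
  have hη2 : η ^ 2 ≤ η := pow_le_of_le_one hη.le hη1 two_ne_zero
  have hv2 : v ≤ 2 := by linarith [le_abs_self (v - 1)]
  calc τ * (η * (1 + v) / 2 + e / η) + |v - 1| * τ
      ≤ τ * (η * (1 + 2) / 2 + η ^ 2 / η) + η * τ := by gcongr; exact hv.trans hη2
    _ = 7 / 2 * (τ * η) := by field_simp; ring
    _ ≤ 4 * τ * η := by nlinarith [mul_nonneg hτ hη.le]

lemma integrable_truncationError (hh : IsBoundedCentred μ h m)
    (hsq : Integrable (fun x : ℂ => ‖x‖ ^ 2) μ) :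
    Integrable (truncationError (N := N) τ η h v) (Measure.pi fun _ => μ) :=
  (((((integrable_meanSq_comp (f := id) hsq).add (integrable_meanSq_comp
    hh.integrable_norm_sq)).const_mul η).div_const 2).add ((integrable_meanSq_comp
      (hh.integrable_error hsq)).div_const η)).const_mul τ |>.add (integrable_const _)

lemma integral_truncationError_le (h1 : ∫ x, ‖x‖ ^ 2 ∂μ = 1) (hh : IsTruncation μ η h m)
    (hτ : 0 ≤ τ) (hη : 0 < η) (hη1 : η ≤ 1) (hN : N ≠ 0) :
    ∫ x : Fin N → ℂ, truncationError τ η h (∫ x, ‖h x‖ ^ 2 ∂μ) x ∂(Measure.pi fun _ => μ) ≤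
      4 * τ * η := by
  have hsq := integrable_norm_sq_of_integral_eq_one h1
  have hid := integrable_meanSq_comp (N := N) (f := id) hsq
  have htrunc := integrable_meanSq_comp (N := N) hh.integrable_norm_sq
  have herror := integrable_meanSq_comp (N := N) (hh.integrable_error hsq)
  have hweighted := ((hid.fun_add htrunc).const_mul η).div_const 2
  have hid_one : ∫ x : Fin N → ℂ, meanSq (id ∘ x) ∂(Measure.pi fun _ => μ) = 1 :=
    (integral_meanSq_comp (f := id) hsq hN).trans h1
  refine (le_of_eq ?_).trans (truncationError_mean_le hτ hη hη1 hh.integral_error_le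
    hh.abs_variance_sub_one_le)
  change ∫ x : Fin N → ℂ, (τ * (η * (meanSq (id ∘ x) + meanSq (h ∘ x)) / 2 +
    meanSq ((fun z => z - h z) ∘ x) / η) + _) ∂(Measure.pi fun _ => μ) = _
  rw [integral_add ((hweighted.fun_add (herror.div_const η)).const_mul τ) (integrable_const _),
    integral_const_mul, integral_add hweighted (herror.div_const η), integral_div, integral_div,
    integral_const_mul, integral_add hid htrunc, hid_one,
    integral_meanSq_comp hh.integrable_norm_sq hN,
    integral_meanSq_comp (hh.integrable_error hsq) hN, integral_const, probReal_univ, one_smul]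

lemma fourth_moment_scaled_centredForm (hh : IsBoundedCentred μ h m) (hB : BoundedForm τ B)
    (hτ : 0 ≤ τ) :
    ∫ x, ‖((1 / (N : ℝ) : ℝ) : ℂ) * centredForm h (∫ x, ‖h x‖ ^ 2 ∂μ) B x‖ ^ 4
      ∂(Measure.pi fun _ => μ) ≤ (120 * (m ^ 4 * τ ^ 2)) ^ 2 * (1 / (N : ℝ) ^ 2) := by
  simp only [norm_mul, mul_pow _ _ 4, Complex.norm_real,
    Real.norm_of_nonneg (by positivity : 0 ≤ 1 / (N : ℝ))]
  rw [integral_const_mul]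
  rcases eq_or_ne N 0 with rfl | hN
  · simp
  · have : (0 : ℝ) < N := Nat.cast_pos.2 (Nat.pos_of_ne_zero hN)
    calc _ ≤ (1 / (N : ℝ)) ^ 4 * (120 * N * (m ^ 4 * τ ^ 2)) ^ 2 := by
          gcongr
          exact hh.fourth_moment_centredForm hτ hB.row_le hB.col_le
      _ = _ := by field_simp

lemma le_add_pow_four_div {z : ℝ} (hη : 0 < η) (hz : 0 ≤ z) : z ≤ η + z ^ 4 / η ^ 3 := by
  rcases le_total z η with hzη | hηz
  · exact hzη.trans (le_add_of_nonneg_right (by positivity))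
  · refine le_trans ?_ (le_add_of_nonneg_left hη.le)
    rw [le_div_iff₀ (by positivity)]
    calc z * η ^ 3 ≤ z * z ^ 3 := by gcongr
      _ = z ^ 4 := by ring

lemma lintegral_enorm_le_ofReal_integral {X : Type*} [MeasurableSpace X] {ρ : Measure X}
    {f : X → ℂ} {g : X → ℝ} (hg : Integrable g ρ) (hfg : ∀ x, ‖f x‖ ≤ g x) :
    ∫⁻ x, ‖f x‖ₑ ∂ρ ≤ ENNReal.ofReal (∫ x, g x ∂ρ) := by
  rw [ofReal_integral_eq_lintegral_ofReal hg (.of_forall fun x => (norm_nonneg _).trans (hfg x))]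
  refine lintegral_mono fun x => ?_
  rw [← ofReal_norm]
  exact ENNReal.ofReal_le_ofReal (hfg x)

lemma BoundedForm.lintegral_formDeviation_le (hB : BoundedForm τ B)
    (h1 : ∫ x, ‖x‖ ^ 2 ∂μ = 1) (hh : IsTruncation μ η h m) (hτ : 0 ≤ τ) (hη : 0 < η)
    (hη1 : η ≤ 1) (hN : N ≠ 0) :
    ∫⁻ x, ‖formDeviation B x‖ₑ ∂(Measure.pi fun _ => μ) ≤ ENNReal.ofReal
      (4 * τ * η + (η + (120 * (m ^ 4 * τ ^ 2)) ^ 2 * (1 / (N : ℝ) ^ 2) / η ^ 3)) := by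
  set v := ∫ x, ‖h x‖ ^ 2 ∂μ
  set Z : (Fin N → ℂ) → ℂ := fun x => ((1 / (N : ℝ) : ℝ) : ℂ) * centredForm h v B x
  have hZ : Integrable (fun x => ‖Z x‖ ^ 4) (Measure.pi fun _ => μ) :=
    integrable_norm_pow_of_norm_le ((measurable_centredForm hh.measurable v B).const_mul _)
      (fun x => norm_mul_le_of_le le_rfl (norm_centredForm_le hh.norm_le v B x)) 4
  have herror := integrable_truncationError (N := N) (τ := τ) (η := η) (v := v)
    hh.toIsBoundedCentred (integrable_norm_sq_of_integral_eq_one h1)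
  have hrest := (integrable_const (μ := Measure.pi fun _ : Fin N => μ) η).fun_add
    (hZ.div_const (η ^ 3))
  refine (lintegral_enorm_le_ofReal_integral (herror.fun_add hrest) fun x =>
    (hB.norm_formDeviation_le hτ hη h v x).trans (add_le_add_right
      (le_add_pow_four_div hη (norm_nonneg _)) _)).trans (ENNReal.ofReal_le_ofReal ?_)
  rw [integral_add herror hrest, integral_add (integrable_const _) (hZ.div_const _),
    integral_const, probReal_univ, one_smul, integral_div]
  gcongr
  · exact integral_truncationError_le h1 hh hτ hη hη1 hN
  · exact fourth_moment_scaled_centredForm hh.toIsBoundedCentred hB hτ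

theorem exists_forall_lintegral_formDeviation_le (h0 : ∫ x, x ∂μ = 0)
    (h1 : ∫ x, ‖x‖ ^ 2 ∂μ = 1) (hτ : 0 ≤ τ) {ε : ℝ} (hε : 0 < ε) :
    ∃ N₀ : ℕ, ∀ N ≥ N₀, ∀ B : Matrix (Fin N) (Fin N) ℂ, BoundedForm τ B →
      ∫⁻ x, ‖formDeviation B x‖ₑ ∂(Measure.pi fun _ => μ) ≤ ENNReal.ofReal ε := by
  set η := min 1 (ε / (2 * (4 * τ + 1)))
  have hη : 0 < η := by positivity
  have hηε : (4 * τ + 1) * η ≤ ε / 2 := by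
    have : η ≤ ε / (2 * (4 * τ + 1)) := min_le_right _ _
    rw [le_div_iff₀ (by positivity)] at this
    linarith
  obtain ⟨h, m, hh⟩ := exists_isTruncation h0 h1 hη
  have hlim : Tendsto (fun N : ℕ => 4 * τ * η + (η + (120 * (m ^ 4 * τ ^ 2)) ^ 2 *
      (1 / (N : ℝ) ^ 2) / η ^ 3)) atTop (𝓝 (4 * τ * η + (η + 0))) := by
    simpa using! ((((tendsto_const_nhds (x := (1 : ℝ))).div_atTop ((tendsto_pow_atTop
      two_ne_zero).comp tendsto_natCast_atTop_atTop)).const_mul _).div_const _).const_add η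
        |>.const_add (4 * τ * η)
  obtain ⟨N₀, hN₀⟩ := eventually_atTop.1 (hlim.eventually_le_const
    (by linarith : 4 * τ * η + (η + 0) < ε))
  refine ⟨N₀ + 1, fun N hN B hB => (hB.lintegral_formDeviation_le h1 hh hτ hη (min_le_left _ _)
    (by lia)).trans (ENNReal.ofReal_le_ofReal (hN₀ N (by lia)))⟩

end BoundedForm

/-! ### Concentration of the defect of the resolvent trace -/

section Block

variable {ι : Type*} [Fintype ι] [DecidableEq ι] {N : ℕ}

lemma sqNorm_ite_eq (m : ι) (y : Fin N → ℂ) :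
    sqNorm (fun p : ι × Fin N => if p.1 = m then y p.2 else 0) = sqNorm y := by
  rw [sqNorm, Fintype.sum_prod_type, Finset.sum_eq_single m]
  · simp [sqNorm]
  · intro b _ hb; simp [hb]
  · simp

lemma sqNorm_block_mulVec_le (R : Matrix (ι × Fin N) (ι × Fin N) ℂ) (l m : ι) (y : Fin N → ℂ) :
    sqNorm (block R l m *ᵥ y) ≤ sqNorm (R *ᵥ fun p => if p.1 = m then y p.2 else 0) := by
  have hrow (i : Fin N) :
      (block R l m *ᵥ y) i = (R *ᵥ fun p => if p.1 = m then y p.2 else 0) (l, i) := by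
    simp only [block, mulVec, dotProduct, of_apply, Fintype.sum_prod_type, mul_ite, mul_zero]
    rw [Finset.sum_eq_single m]
    · simp
    · intro b _ hb; simp [hb]
    · simp
  simp only [sqNorm, hrow, Fintype.sum_prod_type]
  exact Finset.single_le_sum
    (f := fun l => ∑ i, ‖(R *ᵥ fun p => if p.1 = m then y p.2 else 0) (l, i)‖ ^ 2)
    (fun _ _ => Finset.sum_nonneg fun _ _ => sq_nonneg _) (Finset.mem_univ l)

lemma CoerciveWith.boundedForm_block_inv {D : Matrix (ι × Fin N) (ι × Fin N) ℂ} {τ : ℝ}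
    (h : CoerciveWith τ D) (hτ : 0 < τ) (l m : ι) : BoundedForm (1 / τ) (block D⁻¹ l m) where
  sqNorm_mulVec_le y := by
    rw [← sqNorm_ite_eq m y]
    exact (sqNorm_block_mulVec_le _ l m y).trans (h.sqNorm_inv_mulVec_le hτ _)
  row_le i := by
    refine le_trans ?_ (h.sum_norm_sq_inv_row_le hτ (l, i))
    rw [Fintype.sum_prod_type]
    exact Finset.single_le_sum (f := fun m => ∑ j, ‖D⁻¹ (l, i) (m, j)‖ ^ 2)
      (fun _ _ => Finset.sum_nonneg fun _ _ => sq_nonneg _) (Finset.mem_univ m)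
  col_le j := by
    refine le_trans ?_ (h.sum_norm_sq_inv_col_le hτ (m, j))
    rw [Fintype.sum_prod_type]
    exact Finset.single_le_sum (f := fun l => ∑ i, ‖D⁻¹ (l, i) (m, j)‖ ^ 2)
      (fun _ _ => Finset.sum_nonneg fun _ _ => sq_nonneg _) (Finset.mem_univ l)

end Block

section Continuity

variable {ι : Type*} [Fintype ι] [DecidableEq ι] {N : ℕ} {κ : Type*} [Fintype κ] {σ : ℝ}

omit [Fintype ι] in
lemma continuous_covMatrix (σ : ℝ) :
    Continuous fun p : (κ → ι → ℂ) × (κ → Fin N → ℂ) => covMatrix σ p.1 p.2 := by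
  have hβ (k : κ) :
      Continuous fun p : (κ → ι → ℂ) × (κ → Fin N → ℂ) => tensorVec (p.1 k) (p.2 k) := by
    unfold tensorVec
    fun_prop
  have hsum : Continuous fun p : (κ → ι → ℂ) × (κ → Fin N → ℂ) =>
      ∑ k, vecMulVec (tensorVec (p.1 k) (p.2 k)) (star (tensorVec (p.1 k) (p.2 k))) :=
    continuous_finsetSum _ fun k _ => (hβ k).matrix_vecMulVec (hβ k).star
  exact (hsum.const_smul ((1 / (N : ℝ) : ℝ) : ℂ)).add continuous_const

lemma continuous_covMatrix_inv (hσ : 0 < σ) :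
    Continuous fun p : (κ → ι → ℂ) × (κ → Fin N → ℂ) => (covMatrix σ p.1 p.2)⁻¹ := by
  simp only [inv_def, Ring.inverse_eq_inv']
  have h := continuous_covMatrix (ι := ι) (N := N) (κ := κ) σ
  refine Continuous.smul (h.matrix_det.inv₀ fun p => ?_) h.matrix_adjugate
  exact ((isUnit_iff_isUnit_det _).1 (covMatrix_posDef hσ p.1 p.2).isUnit).ne_zero

lemma continuous_block_covMatrix_inv (hσ : 0 < σ) (l m : ι) :
    Continuous fun p : (κ → ι → ℂ) × (κ → Fin N → ℂ) => block (covMatrix σ p.1 p.2)⁻¹ l m := by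
  have h := continuous_covMatrix_inv (ι := ι) (N := N) (κ := κ) hσ
  exact continuous_matrix fun i j => h.matrix_elem (l, i) (m, j)

lemma continuous_resolventTrace (hσ : 0 < σ) :
    Continuous fun p : (κ → ι → ℂ) × (κ → Fin N → ℂ) => resolventTrace σ p.1 p.2 := by
  refine continuous_matrix fun l m => ?_
  simp only [resolventTrace, blockTrace_apply]
  exact continuous_const.mul (continuous_finsetSum _ fun i _ =>
    (continuous_covMatrix_inv hσ).matrix_elem _ _)

lemma continuous_defect (hσ : 0 < σ) (l m : ι) :
    Continuous fun p : (κ → ι → ℂ) × (κ → Fin N → ℂ) =>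
      defect σ N p.1 (resolventTrace σ p.1 p.2) l m := by
  have hT := continuous_resolventTrace (ι := ι) (N := N) (κ := κ) hσ
  simp only [defect, Matrix.sub_apply, Matrix.smul_apply, Matrix.sum_apply, rankOneTerm_apply,
    smul_eq_mul]
  refine (continuous_const.sub (continuous_const.mul (hT.matrix_elem _ _))).sub
    (continuous_const.mul (continuous_finsetSum _ fun k _ => ?_))
  have hk : Continuous fun p : (κ → ι → ℂ) × (κ → Fin N → ℂ) => p.1 k := by fun_prop
  have hv := hT.matrix_mulVec hk
  exact Continuous.div (((continuous_apply l).comp hv).mul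
    (Complex.continuous_conj.comp ((continuous_apply m).comp hk)))
    (continuous_const.add (hk.star.dotProduct hv))
    fun p => denom_ne_zero (resolventTrace_posSemidef hσ _ _) _

lemma measurable_resolventTrace (hσ : 0 < σ) (a : κ → ι → ℂ) (l m : ι) :
    Measurable fun x : κ → Fin N → ℂ => resolventTrace σ a x l m :=
  (((continuous_resolventTrace hσ).comp (.prodMk_right a)).matrix_elem l m).measurable

lemma measurable_defect (hσ : 0 < σ) (a : κ → ι → ℂ) (l m : ι) :
    Measurable fun x : κ → Fin N → ℂ => defect σ N a (resolventTrace σ a x) l m :=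
  ((continuous_defect hσ l m).comp (.prodMk_right a)).measurable

lemma measurable_userForm [DecidableEq κ] (hσ : 0 < σ) (a : κ → ι → ℂ) (k : κ) (l m : ι) :
    Measurable fun x : κ → Fin N → ℂ => userForm σ a x k l m := by
  have hpair : Continuous fun x : κ → Fin N → ℂ => (Function.update a k 0, x) :=
    .prodMk_right _
  have hblock := (continuous_block_covMatrix_inv (N := N) hσ l m).comp hpair
  have hk : Continuous fun x : κ → Fin N → ℂ => x k := continuous_apply k
  exact (continuous_const.mul (hk.star.dotProduct (hblock.matrix_mulVec hk))).measurable

end Continuity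

section DefectBounds

variable {ι : Type*} [Fintype ι] [DecidableEq ι] {N : ℕ} {κ : Type*} [Fintype κ] {σ M τ δ : ℝ}
  {a : κ → ι → ℂ}

lemma norm_defect_le (hσ : 0 < σ) (hM : 0 ≤ M) (ha : ∀ k l, ‖a k l‖ ≤ M) (x : κ → Fin N → ℂ)
    (l m : ι) :
    ‖defect σ N a (resolventTrace σ a x) l m‖ ≤
      1 + 1 + 1 / N * (Fintype.card κ * (Fintype.card ι * (1 / σ ^ 2 * M) * M)) := by
  simp only [defect, Matrix.sub_apply, Matrix.smul_apply, Matrix.sum_apply, smul_eq_mul]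
  refine norm_sub_le_of_le (norm_sub_le_of_le ?_ ?_) ?_
  · rw [one_apply]; split_ifs <;> simp
  · rw [norm_mul, Complex.norm_real, Real.norm_of_nonneg (by positivity)]
    calc σ ^ 2 * ‖resolventTrace σ a x l m‖ ≤ σ ^ 2 * (1 / σ ^ 2) := by
          gcongr; exact norm_resolventTrace_le hσ a x l m
      _ = 1 := by field_simp
  · rw [norm_mul, Complex.norm_real, Real.norm_of_nonneg (by positivity)]
    gcongr
    refine (norm_sum_le_of_le _ fun k _ => norm_rankOneTerm_le (resolventTrace_posSemidef hσ a x)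
      (by positivity) hM (norm_resolventTrace_le hσ a x) (ha k) l m).trans_eq ?_
    simp

lemma norm_defect_sub_le (hM : 0 ≤ M) (ha : ∀ k l, ‖a k l‖ ≤ M) {A B : Matrix ι ι ℂ}
    (hA : A.PosSemidef) (hB : B.PosSemidef) (hτ : 0 ≤ τ) (hδ : 0 ≤ δ) (hBτ : ∀ l m, ‖B l m‖ ≤ τ)
    (hAB : ∀ l m, ‖A l m - B l m‖ ≤ δ) (l m : ι) :
    ‖defect σ N a A l m - defect σ N a B l m‖ ≤
      (σ ^ 2 + Fintype.card κ / N * lipConst (Fintype.card ι) τ M) * δ := by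
  have hsplit : defect σ N a A l m - defect σ N a B l m =
      -(((σ ^ 2 : ℝ) : ℂ) * (A l m - B l m)) -
        ((1 / (N : ℝ) : ℝ) : ℂ) * ∑ k, (rankOneTerm A (a k) l m - rankOneTerm B (a k) l m) := by
    simp only [defect, Matrix.sub_apply, Matrix.smul_apply, Matrix.sum_apply, smul_eq_mul,
      Finset.sum_sub_distrib]
    ring
  have hsum : ‖∑ k, (rankOneTerm A (a k) l m - rankOneTerm B (a k) l m)‖ ≤
      Fintype.card κ * (lipConst (Fintype.card ι) τ M * δ) :=
    (norm_sum_le_of_le Finset.univ fun k _ =>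
      norm_rankOneTerm_sub_le hA hB hτ hM hδ hBτ (ha k) hAB l m).trans_eq (by simp)
  rw [hsplit]
  calc ‖-(((σ ^ 2 : ℝ) : ℂ) * (A l m - B l m)) -
        ((1 / (N : ℝ) : ℝ) : ℂ) * ∑ k, (rankOneTerm A (a k) l m - rankOneTerm B (a k) l m)‖
      ≤ σ ^ 2 * δ + 1 / N * (Fintype.card κ * (lipConst (Fintype.card ι) τ M * δ)) := by
        refine norm_sub_le_of_le ?_ ?_
        · rw [norm_neg, norm_mul, Complex.norm_real, Real.norm_of_nonneg (by positivity)]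
          gcongr
          exact hAB l m
        · rw [norm_mul, Complex.norm_real, Real.norm_of_nonneg (by positivity)]
          gcongr
    _ = (σ ^ 2 + Fintype.card κ / N * lipConst (Fintype.card ι) τ M) * δ := by ring

lemma norm_resolventTrace_update_signature_sub_le [DecidableEq κ] (hσ : 0 < σ) (a : κ → ι → ℂ)
    (x : κ → Fin N → ℂ) (k : κ) (y : Fin N → ℂ) (l m : ι) :
    ‖resolventTrace σ a (Function.update x k y) l m - resolventTrace σ a x l m‖ ≤
      2 / (N * σ ^ 2) := by
  refine (norm_resolventTrace_sub_le hσ {k} (fun j hj => ?_) l m).trans_eq (by simp)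
  rw [Function.update_of_ne (by simpa using hj)]

lemma norm_defect_update_signature_sub_le [DecidableEq κ] (hσ : 0 < σ) (hM : 0 ≤ M)
    (ha : ∀ k l, ‖a k l‖ ≤ M) (l m : ι) (x : κ → Fin N → ℂ) (k : κ) (y : Fin N → ℂ) :
    ‖defect σ N a (resolventTrace σ a (Function.update x k y)) l m -
        defect σ N a (resolventTrace σ a x) l m‖ ≤
      (σ ^ 2 + Fintype.card κ / N * lipConst (Fintype.card ι) (1 / σ ^ 2) M) *
        (2 / (N * σ ^ 2)) :=
  norm_defect_sub_le hM ha (resolventTrace_posSemidef hσ a _) (resolventTrace_posSemidef hσ a x)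
    (by positivity) (by positivity) (norm_resolventTrace_le hσ a x)
    (norm_resolventTrace_update_signature_sub_le hσ a x k y) l m

lemma norm_defect_le_sum [DecidableEq κ] (hσ : 0 < σ) (hN : N ≠ 0) (hM : 0 ≤ M)
    (ha : ∀ k l, ‖a k l‖ ≤ M) (x : κ → Fin N → ℂ) (l m : ι) :
    ‖defect σ N a (resolventTrace σ a x) l m‖ ≤
      1 / N * lipConst (Fintype.card ι) (1 / σ ^ 2) M *
        ∑ q : κ × ι × ι, ‖userForm σ a x q.1 q.2.1 q.2.2 - resolventTrace σ a x q.2.1 q.2.2‖ := by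
  have hdefect : defect σ N a (resolventTrace σ a x) l m = ((1 / (N : ℝ) : ℝ) : ℂ) *
      ∑ k, (rankOneTerm (userForm σ a x k) (a k) l m -
        rankOneTerm (resolventTrace σ a x) (a k) l m) := by
    rw [defect, one_eq_resolventTrace_add hσ hN a x]
    simp only [Matrix.sub_apply, Matrix.add_apply, Matrix.smul_apply, Matrix.sum_apply,
      smul_eq_mul, Finset.sum_sub_distrib]
    ring
  rw [hdefect, norm_mul, Complex.norm_real, Real.norm_of_nonneg (by positivity), mul_assoc]
  gcongr
  simp only [Fintype.sum_prod_type]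
  rw [Finset.mul_sum]
  exact norm_sum_le_of_le _ fun k _ =>
    norm_rankOneTerm_sub_le (userForm_posSemidef hσ a x k) (resolventTrace_posSemidef hσ a x)
      (by positivity) hM (by positivity) (norm_resolventTrace_le hσ a x) (ha k)
      (le_sum_sum (f := fun l m => ‖userForm σ a x k l m - resolventTrace σ a x l m‖)
        fun _ _ => norm_nonneg _) l m

end DefectBounds

section Concentration

variable {ι : Type*} [Fintype ι] [DecidableEq ι] {K N : ℕ} {σ M c' ε : ℝ}
  {μ : Measure ℂ} [IsProbabilityMeasure μ] {a : Fin K → ι → ℂ}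

/-- The law of `K` independent signatures of length `N`. -/
def signatureLaw (μ : Measure ℂ) (K N : ℕ) : Measure (Fin K → Fin N → ℂ) :=
  Measure.pi fun _ => Measure.pi fun _ => μ

instance (K N : ℕ) : IsProbabilityMeasure (signatureLaw μ K N) := by
  unfold signatureLaw; infer_instance

lemma lintegral_signatureLaw_le {F : (Fin K → Fin N → ℂ) → ℝ≥0∞} (hF : Measurable F)
    (k : Fin K) {C : ℝ≥0∞}
    (h : ∀ x, ∫⁻ y, F (Function.update x k y) ∂(Measure.pi fun _ => μ) ≤ C) :
    ∫⁻ x, F x ∂(signatureLaw μ K N) ≤ C := by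
  have hmarginal := lintegral_le_of_lmarginal_le
    (μ := fun _ : Fin K => Measure.pi fun _ : Fin N => μ) {k} (f := F) (g := fun _ => C) hF
    measurable_const fun x => by
      rw [lmarginal_singleton, lmarginal_singleton]
      simpa using h x
  simpa [signatureLaw] using hmarginal

lemma fourth_moment_arith {κ lip s : ℝ} (hκ : 0 ≤ κ) (hκN : κ ≤ c' * N) (hlip : 0 ≤ lip)
    (hs : 0 ≤ s) :
    (4 * κ * ((s + κ / N * lip) * (2 / (N * s))) ^ 2) ^ 2 ≤
      (4 * c' * ((s + c' * lip) * (2 / s)) ^ 2) ^ 2 * (1 / (N : ℝ) ^ 2) := by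
  rcases N.eq_zero_or_pos with rfl | hN
  · simp
  have hN' : (0 : ℝ) < N := by exact_mod_cast hN
  have hc' : 0 ≤ c' := nonneg_of_mul_nonneg_left (hκ.trans hκN) hN'
  have hratio : κ / N ≤ c' := (div_le_iff₀ hN').2 hκN
  calc (4 * κ * ((s + κ / N * lip) * (2 / (N * s))) ^ 2) ^ 2
      ≤ (4 * (c' * N) * ((s + c' * lip) * (2 / (N * s))) ^ 2) ^ 2 := by gcongr
    _ = (4 * (c' * N) * ((s + c' * lip) * (2 / s) * (1 / N)) ^ 2) ^ 2 := by
        rw [mul_comm (N : ℝ) s, ← div_div, ← mul_one_div (2 / s), mul_assoc (s + c' * lip)]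
    _ = (4 * c' * ((s + c' * lip) * (2 / s)) ^ 2) ^ 2 * (1 / (N : ℝ) ^ 2) := by
        generalize (s + c' * lip) * (2 / s) = G
        field_simp

theorem lintegral_fourth_moment_defect_le (hσ : 0 < σ) (hM : 0 ≤ M) (ha : ∀ k l, ‖a k l‖ ≤ M)
    (hK : (K : ℝ) ≤ c' * N) (l m : ι) :
    ∫⁻ x, ENNReal.ofReal (‖defect σ N a (resolventTrace σ a x) l m -
        ∫ z, defect σ N a (resolventTrace σ a z) l m ∂(signatureLaw μ K N)‖ ^ 4)
          ∂(signatureLaw μ K N) ≤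
      ENNReal.ofReal ((4 * c' * ((σ ^ 2 + c' * lipConst (Fintype.card ι) (1 / σ ^ 2) M) *
        (2 / σ ^ 2)) ^ 2) ^ 2 * (1 / (N : ℝ) ^ 2)) := by
  have hmeas := measurable_defect (N := N) hσ a l m
  have hbound := fun x => norm_defect_le (N := N) hσ hM ha x l m
  have hcentred := fun x => norm_sub_le_of_le (hbound x)
    (norm_integral_le_of_forall_norm_le (ρ := signatureLaw μ K N) hbound)
  rw [← ofReal_integral_eq_lintegral_ofReal
    (integrable_norm_pow_of_norm_le (hmeas.sub_const _) hcentred 4)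
    (Eventually.of_forall fun x => by positivity)]
  refine ENNReal.ofReal_le_ofReal ((fourth_moment_bddDiff K hmeas hbound
    (norm_defect_update_signature_sub_le hσ hM ha l m)).trans ?_)
  rw [Fintype.card_fin]
  exact fourth_moment_arith K.cast_nonneg hK (lipConst_nonneg _ (by positivity) hM) (sq_nonneg σ)

lemma lintegral_userForm_sub_le (hσ : 0 < σ) (hε : 0 ≤ ε)
    (hform : ∀ B : Matrix (Fin N) (Fin N) ℂ, BoundedForm (1 / σ ^ 2) B →
      ∫⁻ x, ‖formDeviation B x‖ₑ ∂(Measure.pi fun _ => μ) ≤ ENNReal.ofReal ε)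
    (a : Fin K → ι → ℂ) (k : Fin K) (l m : ι) :
    ∫⁻ x, ‖userForm σ a x k l m - resolventTrace σ a x l m‖ₑ ∂(signatureLaw μ K N) ≤
      ENNReal.ofReal (ε + 1 / (N * σ ^ 2)) := by
  set a' := Function.update a k 0 with ha'
  have hmeas : Measurable fun x : Fin K → Fin N → ℂ =>
      ‖userForm σ a x k l m - resolventTrace σ a' x l m‖ₑ :=
    ((measurable_userForm hσ a k l m).sub (measurable_resolventTrace hσ a' l m)).enorm
  calc ∫⁻ x, ‖userForm σ a x k l m - resolventTrace σ a x l m‖ₑ ∂(signatureLaw μ K N)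
      ≤ ∫⁻ x, (‖userForm σ a x k l m - resolventTrace σ a' x l m‖ₑ +
          ENNReal.ofReal (1 / (N * σ ^ 2))) ∂(signatureLaw μ K N) := by
        refine lintegral_mono fun x => ?_
        rw [← sub_add_sub_cancel _ (resolventTrace σ a' x l m)]
        refine (enorm_add_le _ _).trans ?_
        gcongr
        rw [← ofReal_norm]
        exact ENNReal.ofReal_le_ofReal (norm_resolventTrace_sub_update_le hσ a x k l m)
    _ = ∫⁻ x, ‖userForm σ a x k l m - resolventTrace σ a' x l m‖ₑ ∂(signatureLaw μ K N) +
          ENNReal.ofReal (1 / (N * σ ^ 2)) := by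
        rw [lintegral_add_right _ measurable_const, lintegral_const, measure_univ, mul_one]
    _ ≤ ENNReal.ofReal ε + ENNReal.ofReal (1 / (N * σ ^ 2)) := by
        gcongr
        refine lintegral_signatureLaw_le hmeas k fun x => ?_
        simp only [userForm, resolventTrace, ha', covMatrix_update_zero, Function.update_self]
        exact hform _ ((covMatrix_coercive σ _ x).boundedForm_block_inv (by positivity) l m)
    _ = ENNReal.ofReal (ε + 1 / (N * σ ^ 2)) := (ENNReal.ofReal_add hε (by positivity)).symm

omit [IsProbabilityMeasure μ] in
lemma lintegral_defect_le (hσ : 0 < σ) (hN : N ≠ 0) (hM : 0 ≤ M) (ha : ∀ k l, ‖a k l‖ ≤ M)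
    (hε : 0 ≤ ε)
    (hform : ∀ k l m, ∫⁻ x, ‖userForm σ a x k l m - resolventTrace σ a x l m‖ₑ
      ∂(signatureLaw μ K N) ≤ ENNReal.ofReal ε) (l m : ι) :
    ∫⁻ x, ‖defect σ N a (resolventTrace σ a x) l m‖ₑ ∂(signatureLaw μ K N) ≤
      ENNReal.ofReal (1 / N * lipConst (Fintype.card ι) (1 / σ ^ 2) M *
        (K * (Fintype.card ι * Fintype.card ι) * ε)) := by
  set r := 1 / N * lipConst (Fintype.card ι) (1 / σ ^ 2) M
  have hlip := lipConst_nonneg (τ := 1 / σ ^ 2) (Fintype.card ι) (by positivity) hM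
  have hr : 0 ≤ r := by positivity
  have hmeas (q : Fin K × ι × ι) : Measurable fun x : Fin K → Fin N → ℂ =>
      ‖userForm σ a x q.1 q.2.1 q.2.2 - resolventTrace σ a x q.2.1 q.2.2‖ₑ :=
    ((measurable_userForm hσ a q.1 q.2.1 q.2.2).sub
      (measurable_resolventTrace hσ a q.2.1 q.2.2)).enorm
  calc ∫⁻ x, ‖defect σ N a (resolventTrace σ a x) l m‖ₑ ∂(signatureLaw μ K N)
      ≤ ∫⁻ x, ENNReal.ofReal r * ∑ q : Fin K × ι × ι,
          ‖userForm σ a x q.1 q.2.1 q.2.2 - resolventTrace σ a x q.2.1 q.2.2‖ₑ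
            ∂(signatureLaw μ K N) := by
        refine lintegral_mono fun x => ?_
        simp only [← ofReal_norm]
        rw [← ENNReal.ofReal_sum_of_nonneg fun _ _ => norm_nonneg _, ← ENNReal.ofReal_mul hr]
        exact ENNReal.ofReal_le_ofReal (norm_defect_le_sum hσ hN hM ha x l m)
    _ = ENNReal.ofReal r * ∑ q : Fin K × ι × ι,
          ∫⁻ x, ‖userForm σ a x q.1 q.2.1 q.2.2 - resolventTrace σ a x q.2.1 q.2.2‖ₑ
            ∂(signatureLaw μ K N) := by
        rw [lintegral_const_mul _ (Finset.measurable_sum _ fun q _ => hmeas q),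
          lintegral_finsetSum _ fun q _ => hmeas q]
    _ ≤ ENNReal.ofReal r * ∑ _q : Fin K × ι × ι, ENNReal.ofReal ε := by
        gcongr with q
        exact hform q.1 q.2.1 q.2.2
    _ = ENNReal.ofReal (r * (K * (Fintype.card ι * Fintype.card ι) * ε)) := by
        rw [← ENNReal.ofReal_sum_of_nonneg fun _ _ => hε, ← ENNReal.ofReal_mul hr]
        simp

theorem exists_forall_norm_integral_defect_le (h0 : ∫ x, x ∂μ = 0) (h1 : ∫ x, ‖x‖ ^ 2 ∂μ = 1)
    (hσ : 0 < σ) (hM : 0 ≤ M) (hc' : 0 ≤ c') (hε : 0 < ε) :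
    ∃ N₀ : ℕ, ∀ N ≥ N₀, ∀ K : ℕ, (K : ℝ) ≤ c' * N → ∀ a : Fin K → ι → ℂ,
      (∀ k l, ‖a k l‖ ≤ M) → ∀ l m,
        ‖∫ x, defect σ N a (resolventTrace σ a x) l m ∂(signatureLaw μ K N)‖ ≤ ε := by
  set d : ℝ := (Fintype.card ι : ℝ)
  set Λ := lipConst (Fintype.card ι) (1 / σ ^ 2) M
  have hΛ : 0 ≤ Λ := lipConst_nonneg _ (by positivity) hM
  set G := c' * Λ * (d * d)
  have hG : 0 ≤ G := by positivity
  set ε' := ε / (2 * (G + 1))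
  have hε' : 0 < ε' := by positivity
  obtain ⟨N₁, hN₁⟩ := exists_forall_lintegral_formDeviation_le h0 h1 (τ := 1 / σ ^ 2)
    (by positivity) hε'
  obtain ⟨N₂, hN₂⟩ := exists_nat_ge (1 / (ε' * σ ^ 2))
  refine ⟨max N₁ (N₂ + 1), fun N hN K hK a ha l m => ?_⟩
  have hN0 : 0 < N := N₂.succ_pos.trans_le (le_of_max_le_right hN)
  have : (0 : ℝ) < N := by exact_mod_cast hN0
  have hremainder : 1 / (N * σ ^ 2) ≤ ε' := by
    have : (N₂ : ℝ) ≤ N := by exact_mod_cast N₂.le_succ.trans (le_of_max_le_right hN)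
    have hN₂N := hN₂.trans this
    rw [div_le_iff₀ (by positivity)] at hN₂N ⊢
    linarith
  have hform := fun k l m => (lintegral_userForm_sub_le hσ hε'.le (hN₁ N (le_of_max_le_left hN)) a
    k l m).trans (ENNReal.ofReal_le_ofReal (add_le_add_right hremainder ε'))
  have henorm := (enorm_integral_le_lintegral_enorm _).trans
    (lintegral_defect_le hσ hN0.ne' hM ha (by positivity) hform l m)
  rw [← ofReal_norm, ENNReal.ofReal_le_ofReal_iff (by positivity)] at henorm
  calc ‖∫ x, defect σ N a (resolventTrace σ a x) l m ∂(signatureLaw μ K N)‖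
      ≤ 1 / N * Λ * (K * (d * d) * (ε' + ε')) := henorm
    _ ≤ 1 / N * Λ * (c' * N * (d * d) * (ε' + ε')) := by gcongr
    _ = G * (2 * ε') := by simp only [G]; field_simp; ring
    _ ≤ (G + 1) * (2 * ε') := by gcongr; linarith
    _ = ε := by simp only [ε']; field_simp

end Concentration

/-! ### Almost sure convergence -/

section General

variable {Ω : Type*} [MeasurableSpace Ω] {P : Measure Ω}

lemma map_signatures_eq_signatureLaw [IsProbabilityMeasure P] {s : ℕ → ℕ → Ω → ℂ}
    (hs_meas : ∀ i j, Measurable (s i j)) (hs_indep : iIndepFun (fun p : ℕ × ℕ => s p.1 p.2) P)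
    (hs_ident : ∀ i j, IdentDistrib (s i j) (s 0 0) P P) (K N : ℕ) :
    P.map (fun ω (k : Fin K) (i : Fin N) => s i k ω) = signatureLaw (P.map (s 0 0)) K N := by
  have : IsProbabilityMeasure (P.map (s 0 0)) :=
    Measure.isProbabilityMeasure_map (hs_meas 0 0).aemeasurable
  have hinj : Function.Injective fun p : Fin K × Fin N => ((p.2 : ℕ), (p.1 : ℕ)) :=
    fun _ _ h => Prod.ext (Fin.ext (Prod.mk.inj h).2) (Fin.ext (Prod.mk.inj h).1)
  have hpi := (iIndepFun_iff_map_fun_eq_pi_map fun p => (hs_meas _ _).aemeasurable).1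
    (hs_indep.precomp hinj)
  simp only [(hs_ident _ _).map_eq] at hpi
  rw [← Measure.infinitePi_eq_pi] at hpi
  have hcurry := congrArg (Measure.map (MeasurableEquiv.curry (Fin K) (Fin N) ℂ)) hpi
  rw [Measure.infinitePi_map_curry (fun _ _ => P.map (s 0 0)),
    Measure.map_map (MeasurableEquiv.measurable _) (by fun_prop)] at hcurry
  simp only [signatureLaw, ← Measure.infinitePi_eq_pi]
  exact hcurry

lemma lintegral_le_of_indepFun [IsProbabilityMeasure P] {A B : Type*} [MeasurableSpace A]
    [MeasurableSpace B] {X : Ω → A} {Y : Ω → B} (hX : Measurable X) (hY : Measurable Y)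
    (h : IndepFun X Y P) {F : A × B → ℝ≥0∞} (hF : Measurable F) {C : ℝ≥0∞}
    (hC : ∀ ω, ∫⁻ b, F (X ω, b) ∂(P.map Y) ≤ C) : ∫⁻ ω, F (X ω, Y ω) ∂P ≤ C := by
  have : IsProbabilityMeasure (P.map Y) := Measure.isProbabilityMeasure_map hY.aemeasurable
  calc ∫⁻ ω, F (X ω, Y ω) ∂P = ∫⁻ p, F p ∂((P.map X).prod (P.map Y)) := by
        rw [← (indepFun_iff_map_prod_eq_prod_map_map hX.aemeasurable hY.aemeasurable).1 h,
          lintegral_map hF (hX.prodMk hY)]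
    _ = ∫⁻ ω, ∫⁻ b, F (X ω, b) ∂(P.map Y) ∂P := by
        rw [lintegral_prod _ hF.aemeasurable, lintegral_map hF.lintegral_prod_right' hX]
    _ ≤ ∫⁻ _, C ∂P := lintegral_mono hC
    _ = C := by rw [lintegral_const, measure_univ, mul_one]

lemma ae_tendsto_zero_of_lintegral_le {Z : ℕ → Ω → ℝ≥0∞} {C : ℝ}
    (h : ∀ᶠ N : ℕ in atTop, Measurable (Z N) ∧
      ∫⁻ ω, Z N ω ∂P ≤ ENNReal.ofReal (C * (1 / (N : ℝ) ^ 2))) :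
    ∀ᵐ ω ∂P, Tendsto (fun N => Z N ω) atTop (𝓝 0) := by
  obtain ⟨N₀, hN₀⟩ := eventually_atTop.1 h
  have hmeas (N : ℕ) : Measurable (Z (N + N₀)) := (hN₀ _ (Nat.le_add_left _ _)).1
  have hbound (N : ℕ) : ∫⁻ ω, Z (N + N₀) ω ∂P ≤
      ENNReal.ofReal (|C| * (1 / ((N + N₀ : ℕ) : ℝ) ^ 2)) :=
    (hN₀ _ (Nat.le_add_left _ _)).2.trans
      (ENNReal.ofReal_le_ofReal (by gcongr; exact le_abs_self C))
  have hsummable : Summable fun N : ℕ => |C| * (1 / ((N + N₀ : ℕ) : ℝ) ^ 2) :=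
    ((summable_nat_add_iff N₀).2 (Real.summable_one_div_nat_pow.2 one_lt_two)).mul_left _
  have hfinite : ∫⁻ ω, ∑' N, Z (N + N₀) ω ∂P ≠ ∞ := by
    rw [lintegral_tsum fun N => (hmeas N).aemeasurable]
    refine ne_top_of_le_ne_top ?_ (ENNReal.tsum_le_tsum hbound)
    rw [← ENNReal.ofReal_tsum_of_nonneg (fun N => by positivity) hsummable]
    exact ENNReal.ofReal_ne_top
  filter_upwards [ae_lt_top (Measurable.tsum hmeas) hfinite] with ω hω
  rw [← tendsto_add_atTop_iff_nat N₀]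
  exact ENNReal.tendsto_atTop_zero_of_tsum_ne_top hω.ne

lemma tendsto_zero_of_tendsto_ofReal_norm_pow {z : ℕ → ℂ} {k : ℕ} (hk : k ≠ 0)
    (h : Tendsto (fun N => ENNReal.ofReal (‖z N‖ ^ k)) atTop (𝓝 0)) :
    Tendsto z atTop (𝓝 0) := by
  have hpow : Tendsto (fun N => ‖z N‖ ^ k) atTop (𝓝 0) := by
    refine ((ENNReal.tendsto_toReal ENNReal.zero_ne_top).comp h).congr fun N => ?_
    exact ENNReal.toReal_ofReal (by positivity)
  have hroot := hpow.rpow_const (p := (k : ℝ)⁻¹) (Or.inr (by positivity))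
  rw [Real.zero_rpow (by positivity)] at hroot
  exact tendsto_zero_iff_norm_tendsto_zero.2
    (hroot.congr fun N => Real.pow_rpow_inv_natCast (norm_nonneg _) hk)

lemma ae_tendsto_zero_of_fourth_moment_le {Z : ℕ → Ω → ℂ} {C : ℝ}
    (h : ∀ᶠ N : ℕ in atTop, Measurable (Z N) ∧
      ∫⁻ ω, ENNReal.ofReal (‖Z N ω‖ ^ 4) ∂P ≤ ENNReal.ofReal (C * (1 / (N : ℝ) ^ 2))) :
    ∀ᵐ ω ∂P, Tendsto (fun N => Z N ω) atTop (𝓝 0) :=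
  (ae_tendsto_zero_of_lintegral_le (h.mono fun _ hN =>
    ⟨(hN.1.norm.pow_const 4).ennreal_ofReal, hN.2⟩)).mono fun _ hω =>
      tendsto_zero_of_tendsto_ofReal_norm_pow four_ne_zero hω

lemma ae_tendsto_zero_of_forall_eventually_norm_le {Z : ℕ → Ω → ℂ}
    (h : ∀ δ > 0, ∀ᵐ ω ∂P, ∀ᶠ N in atTop, ‖Z N ω‖ ≤ δ) :
    ∀ᵐ ω ∂P, Tendsto (fun N => Z N ω) atTop (𝓝 0) := by
  have hae : ∀ᵐ ω ∂P, ∀ n : ℕ, ∀ᶠ N in atTop, ‖Z N ω‖ ≤ 1 / ((n : ℝ) + 1) :=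
    ae_all_iff.2 fun n => h _ (by positivity)
  filter_upwards [hae] with ω hω
  rw [tendsto_zero_iff_norm_tendsto_zero, Metric.tendsto_nhds]
  intro ε hε
  obtain ⟨n, hn⟩ := exists_nat_one_div_lt hε
  filter_upwards [hω n] with N hN
  rw [dist_zero_right, norm_norm]
  exact hN.trans_lt hn

end General

section Averages

variable {Ω : Type*} [MeasurableSpace Ω] {P : Measure Ω} {y : ℕ → Ω → ℂ}

lemma ae_tendsto_average (hy : ∀ i, Measurable (y i)) (hindep : iIndepFun y P)
    (hident : ∀ i, IdentDistrib (y i) (y 0) P P) {f : ℂ → ℝ} (hf : Measurable f)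
    (hfi : Integrable f (P.map (y 0))) :
    ∀ᵐ ω ∂P, Tendsto (fun N : ℕ => 1 / (N : ℝ) * ∑ i : Fin N, f (y i ω)) atTop
      (𝓝 (∫ x, f x ∂(P.map (y 0)))) := by
  have h := strong_law_ae_real (μ := P) (fun i ω => f (y i ω)) (hfi.comp_measurable (hy 0))
    (fun i j hij => (hindep.indepFun hij).comp hf hf) fun i => (hident i).comp hf
  filter_upwards [h] with ω hω
  rw [integral_map (hy 0).aemeasurable hf.aestronglyMeasurable]
  refine hω.congr fun N => ?_
  rw [Finset.sum_range, div_eq_inv_mul, one_div]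

lemma ae_tendsto_truncationError [IsProbabilityMeasure P] (hy : ∀ i, Measurable (y i))
    (hindep : iIndepFun y P) (hident : ∀ i, IdentDistrib (y i) (y 0) P P)
    (h1 : ∫ x, ‖x‖ ^ 2 ∂(P.map (y 0)) = 1)
    {h : ℂ → ℂ} {b : ℝ} (hh : IsBoundedCentred (P.map (y 0)) h b) (τ η v : ℝ) :
    ∀ᵐ ω ∂P, Tendsto (fun N : ℕ => truncationError τ η h v fun i : Fin N => y i ω) atTop
      (𝓝 (τ * (η * (1 + ∫ x, ‖h x‖ ^ 2 ∂(P.map (y 0))) / 2 +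
        (∫ x, ‖x - h x‖ ^ 2 ∂(P.map (y 0))) / η) + |v - 1| * τ)) := by
  have : IsProbabilityMeasure (P.map (y 0)) :=
    Measure.isProbabilityMeasure_map (hy 0).aemeasurable
  have hsq := integrable_norm_sq_of_integral_eq_one h1
  have hmeas := hh.measurable
  filter_upwards [ae_tendsto_average hy hindep hident (f := fun x => ‖x‖ ^ 2) (by fun_prop) hsq,
    ae_tendsto_average hy hindep hident (f := fun x => ‖h x‖ ^ 2) (by fun_prop)
      hh.integrable_norm_sq,
    ae_tendsto_average hy hindep hident (f := fun x => ‖x - h x‖ ^ 2) (by fun_prop)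
      (hh.integrable_error hsq)] with ω hω hωh hωerror
  rw [h1] at hω
  exact (((((hω.add hωh).const_mul η).div_const 2).add
    (hωerror.div_const η)).const_mul τ).add_const (|v - 1| * τ)

end Averages

/-- The gain vectors with the one of user `0`, whose signal is the one to be detected, replaced by
zero. -/
def dropFirst {ι : Type*} {n : ℕ} (b : Fin n → ι → ℂ) : Fin n → ι → ℂ :=
  fun k => if (k : ℕ) = 0 then 0 else b k

lemma continuous_dropFirst {ι : Type*} {n : ℕ} :
    Continuous (dropFirst : (Fin n → ι → ℂ) → Fin n → ι → ℂ) :=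
  continuous_pi fun k => by
    unfold dropFirst
    split_ifs <;> fun_prop

lemma covMatrix_dropFirst_update {ι : Type*} [DecidableEq ι] {n N : ℕ} (hn : 0 < n) (σ : ℝ)
    (b : Fin n → ι → ℂ) (z : Fin n → Fin N → ℂ) (w : Fin N → ℂ) :
    covMatrix σ (dropFirst b) (Function.update z ⟨0, hn⟩ w) = covMatrix σ (dropFirst b) z := by
  refine covMatrix_congr fun k => ?_
  by_cases hk : (k : ℕ) = 0
  · simp [dropFirst, hk, tensorVec_zero]
  · rw [Function.update_of_ne fun h => hk (by rw [h])]

lemma eventually_le_mul_of_tendsto_div {K : ℕ → ℕ} {c : ℝ}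
    (hK : Tendsto (fun N : ℕ => (K N : ℝ) / (N : ℝ)) atTop (𝓝 c)) :
    ∀ᶠ N : ℕ in atTop, (K N : ℝ) ≤ (c + 1) * N := by
  filter_upwards [hK.eventually (ge_mem_nhds (lt_add_one c)), eventually_gt_atTop 0] with N hN h0
  rwa [div_le_iff₀ (by exact_mod_cast h0)] at hN

lemma eventually_pos_of_tendsto_div {K : ℕ → ℕ} {c : ℝ} (hc : 0 < c)
    (hK : Tendsto (fun N : ℕ => (K N : ℝ) / (N : ℝ)) atTop (𝓝 c)) :
    ∀ᶠ N : ℕ in atTop, 0 < K N := by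
  filter_upwards [hK.eventually (lt_mem_nhds hc)] with N hN
  refine Nat.pos_of_ne_zero fun h => ?_
  simp [h] at hN

/-- A sequence of random systems: `K N ∼ c N` users with gain vectors `a N`, independent of the
signatures `x N`, whose coordinates are independent with law `μ`. -/
structure IsRandomSystem {Ω ι : Type*} [MeasurableSpace Ω] (P : Measure Ω) (μ : Measure ℂ) (c : ℝ)
    (K : ℕ → ℕ) (a : ∀ N, Ω → Fin (K N) → ι → ℂ) (x : ∀ N, Ω → Fin (K N) → Fin N → ℂ) :
    Prop where
  tendsto_div : Tendsto (fun N : ℕ => (K N : ℝ) / (N : ℝ)) atTop (𝓝 c)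
  measurable_gain : ∀ N, Measurable (a N)
  measurable_signature : ∀ N, Measurable (x N)
  indepFun : ∀ N, IndepFun (a N) (x N) P
  map_signature : ∀ N, P.map (x N) = signatureLaw μ (K N) N

namespace IsRandomSystem

variable {Ω ι : Type*} [MeasurableSpace Ω] {P : Measure Ω} {μ : Measure ℂ} {c σ : ℝ} {K : ℕ → ℕ}
  {a : ∀ N, Ω → Fin (K N) → ι → ℂ} {x : ∀ N, Ω → Fin (K N) → Fin N → ℂ}

lemma comp_gain (h : IsRandomSystem P μ c K a x) {g : (ι → ℂ) → ι → ℂ} (hg : Measurable g) :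
    IsRandomSystem P μ c K (fun N ω k => g (a N ω k)) x where
  tendsto_div := h.tendsto_div
  measurable_gain N := measurable_pi_lambda _ fun k =>
    hg.comp ((measurable_pi_apply k).comp (h.measurable_gain N))
  measurable_signature := h.measurable_signature
  indepFun N := (h.indepFun N).comp (φ := fun (b : Fin (K N) → ι → ℂ) k => g (b k))
    (measurable_pi_lambda _ fun k => hg.comp (measurable_pi_apply k)) measurable_id
  map_signature := h.map_signature

variable [Fintype ι] [DecidableEq ι] [IsProbabilityMeasure P] [IsProbabilityMeasure μ]

lemma ae_tendsto_defect_sub_integral (h : IsRandomSystem P μ c K a x) (hσ : 0 < σ) {M : ℝ}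
    (hM : 0 ≤ M) (ha : ∀ N ω k l, ‖a N ω k l‖ ≤ M) (l m : ι) :
    ∀ᵐ ω ∂P, Tendsto (fun N => defect σ N (a N ω) (resolventTrace σ (a N ω) (x N ω)) l m -
      ∫ z, defect σ N (a N ω) (resolventTrace σ (a N ω) z) l m ∂(signatureLaw μ (K N) N))
        atTop (𝓝 0) := by
  refine ae_tendsto_zero_of_fourth_moment_le ?_ (C := (4 * (c + 1) * ((σ ^ 2 + (c + 1) *
    lipConst (Fintype.card ι) (1 / σ ^ 2) M) * (2 / σ ^ 2)) ^ 2) ^ 2)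
  filter_upwards [eventually_le_mul_of_tendsto_div h.tendsto_div] with N hN
  have hdefect : Measurable fun p : (Fin (K N) → ι → ℂ) × (Fin (K N) → Fin N → ℂ) =>
      defect σ N p.1 (resolventTrace σ p.1 p.2) l m := (continuous_defect hσ l m).measurable
  have hmean := (hdefect.stronglyMeasurable.integral_prod_right'
    (ν := signatureLaw μ (K N) N)).measurable
  have hdiff := hdefect.sub (hmean.comp measurable_fst)
  have hpair := (h.measurable_gain N).prodMk (h.measurable_signature N)
  have hcomp := hdiff.comp hpair
  refine ⟨hcomp, ?_⟩
  refine lintegral_le_of_indepFun (h.measurable_gain N) (h.measurable_signature N) (h.indepFun N)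
    (hdiff.norm.pow_const 4).ennreal_ofReal fun ω => ?_
  rw [h.map_signature N]
  exact lintegral_fourth_moment_defect_le hσ hM (ha N ω) hN l m

theorem ae_tendsto_defect (h : IsRandomSystem P μ c K a x) (h0 : ∫ z, z ∂μ = 0)
    (h1 : ∫ z, ‖z‖ ^ 2 ∂μ = 1) (hc : 0 ≤ c) (hσ : 0 < σ) {M : ℝ} (hM : 0 ≤ M)
    (ha : ∀ N ω k l, ‖a N ω k l‖ ≤ M) (l m : ι) :
    ∀ᵐ ω ∂P, Tendsto (fun N => defect σ N (a N ω) (resolventTrace σ (a N ω) (x N ω)) l m)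
      atTop (𝓝 0) := by
  have hmean (ω : Ω) : Tendsto (fun N => ∫ z, defect σ N (a N ω) (resolventTrace σ (a N ω) z) l m
      ∂(signatureLaw μ (K N) N)) atTop (𝓝 0) := by
    rw [Metric.tendsto_nhds]
    intro ε hε
    obtain ⟨N₀, hN₀⟩ := exists_forall_norm_integral_defect_le (ι := ι) h0 h1 hσ hM
      (by linarith : 0 ≤ c + 1) (half_pos hε)
    filter_upwards [eventually_ge_atTop N₀, eventually_le_mul_of_tendsto_div h.tendsto_div]
      with N hN hKN
    rw [dist_zero_right]
    exact (hN₀ N hN (K N) hKN _ (ha N ω) l m).trans_lt (half_lt_self hε)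
  filter_upwards [h.ae_tendsto_defect_sub_integral hσ hM ha l m] with ω hω
  simpa only [sub_add_cancel, add_zero] using hω.add (hmean ω)

omit [IsProbabilityMeasure P] in
lemma measurable_centredForm_block {n N : ℕ} (hσ : 0 < σ) {h : ℂ → ℂ} (hh : Measurable h) (v : ℝ)
    (l m : ι) (k : Fin n) :
    Measurable fun p : (Fin n → ι → ℂ) × (Fin n → Fin N → ℂ) =>
      centredForm h v (block (covMatrix σ (dropFirst p.1) p.2)⁻¹ l m) (p.2 k) := by
  have hpair : Continuous fun p : (Fin n → ι → ℂ) × (Fin n → Fin N → ℂ) =>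
      (dropFirst p.1, p.2) := (continuous_dropFirst.comp continuous_fst).prodMk continuous_snd
  have hblock := (continuous_block_covMatrix_inv (N := N) hσ l m).comp hpair
  have hentry (i j : Fin N) : Measurable fun p : (Fin n → ι → ℂ) × (Fin n → Fin N → ℂ) =>
      block (covMatrix σ (dropFirst p.1) p.2)⁻¹ l m i j := (hblock.matrix_elem i j).measurable
  have : Measurable fun z => conj (h z) := Complex.continuous_conj.measurable.comp hh
  unfold centredForm
  fun_prop

omit [IsProbabilityMeasure P] in
lemma lintegral_fourth_moment_centredForm_block_le {n N : ℕ} (hσ : 0 < σ) {h : ℂ → ℂ} {b : ℝ}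
    (hh : IsBoundedCentred μ h b) (α : Fin n → ι → ℂ) (l m : ι) (hn : 0 < n) :
    ∫⁻ z, ENNReal.ofReal (‖((1 / (N : ℝ) : ℝ) : ℂ) * centredForm h (∫ z, ‖h z‖ ^ 2 ∂μ)
        (block (covMatrix σ (dropFirst α) z)⁻¹ l m) (z ⟨0, hn⟩)‖ ^ 4) ∂(signatureLaw μ n N) ≤
      ENNReal.ofReal ((120 * (b ^ 4 * (1 / σ ^ 2) ^ 2)) ^ 2 * (1 / (N : ℝ) ^ 2)) := by
  have hmeas := (((measurable_centredForm_block (N := N) hσ hh.measurable (∫ z, ‖h z‖ ^ 2 ∂μ)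
    l m ⟨0, hn⟩).comp (measurable_prodMk_left (x := α))).const_mul ((1 / (N : ℝ) : ℝ) : ℂ))
  refine lintegral_signatureLaw_le (hmeas.norm.pow_const 4).ennreal_ofReal ⟨0, hn⟩ fun z => ?_
  simp only [Function.comp_apply, covMatrix_dropFirst_update, Function.update_self]
  set B := block (covMatrix σ (dropFirst α) z)⁻¹ l m
  have hB : BoundedForm (1 / σ ^ 2) B :=
    (covMatrix_coercive σ _ z).boundedForm_block_inv (by positivity) l m
  rw [← ofReal_integral_eq_lintegral_ofReal (integrable_norm_pow_of_norm_le
    ((measurable_centredForm hh.measurable _ B).const_mul _)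
    (fun w => norm_mul_le_of_le le_rfl (norm_centredForm_le hh.norm_le _ B w)) 4)
    (Eventually.of_forall fun w => by positivity)]
  exact ENNReal.ofReal_le_ofReal (fourth_moment_scaled_centredForm hh hB (by positivity))

variable {y : ℕ → Ω → ℂ}

lemma ae_tendsto_centredForm (hsys : IsRandomSystem P μ c K a x) (hc : 0 < c) (hσ : 0 < σ)
    (hxy : ∀ N ω (k : Fin (K N)), (k : ℕ) = 0 → x N ω k = fun i : Fin N => y i ω)
    {h : ℂ → ℂ} {b : ℝ} (hh : IsBoundedCentred μ h b) (l m : ι) :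
    ∀ᵐ ω ∂P, Tendsto (fun N : ℕ => ((1 / (N : ℝ) : ℝ) : ℂ) * centredForm h (∫ z, ‖h z‖ ^ 2 ∂μ)
      (block (covMatrix σ (dropFirst (a N ω)) (x N ω))⁻¹ l m) fun i : Fin N => y i ω)
        atTop (𝓝 0) := by
  refine ae_tendsto_zero_of_fourth_moment_le (C := (120 * (b ^ 4 * (1 / σ ^ 2) ^ 2)) ^ 2) ?_
  filter_upwards [eventually_pos_of_tendsto_div hc hsys.tendsto_div] with N hN
  have hmeas := (measurable_centredForm_block (N := N) hσ hh.measurable (∫ z, ‖h z‖ ^ 2 ∂μ)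
    l m ⟨0, hN⟩).const_mul ((1 / (N : ℝ) : ℝ) : ℂ)
  have hfirst (ω : Ω) : (fun i : Fin N => y i ω) = x N ω ⟨0, hN⟩ := (hxy N ω ⟨0, hN⟩ rfl).symm
  simp only [hfirst]
  have hpair := (hsys.measurable_gain N).prodMk (hsys.measurable_signature N)
  have hcomp := hmeas.comp hpair
  refine ⟨hcomp, ?_⟩
  refine lintegral_le_of_indepFun (hsys.measurable_gain N) (hsys.measurable_signature N)
    (hsys.indepFun N) (hmeas.norm.pow_const 4).ennreal_ofReal fun ω => ?_
  rw [hsys.map_signature N]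
  exact lintegral_fourth_moment_centredForm_block_le hσ hh (a N ω) l m hN

theorem ae_tendsto_blockForm_sub_resolventTrace (hsys : IsRandomSystem P μ c K a x)
    (h0 : ∫ z, z ∂μ = 0) (h1 : ∫ z, ‖z‖ ^ 2 ∂μ = 1) (hc : 0 < c) (hσ : 0 < σ)
    (hxy : ∀ N ω (k : Fin (K N)), (k : ℕ) = 0 → x N ω k = fun i : Fin N => y i ω)
    (hy : ∀ i, Measurable (y i)) (hindep : iIndepFun y P)
    (hident : ∀ i, IdentDistrib (y i) (y 0) P P) (hlaw : P.map (y 0) = μ) (l m : ι) :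
    ∀ᵐ ω ∂P, Tendsto (fun N => blockForm (covMatrix σ (dropFirst (a N ω)) (x N ω))⁻¹
      (fun i : Fin N => y i ω) l m - resolventTrace σ (dropFirst (a N ω)) (x N ω) l m)
        atTop (𝓝 0) := by
  refine ae_tendsto_zero_of_forall_eventually_norm_le fun δ hδ => ?_
  set τ := 1 / σ ^ 2
  have hτ : 0 ≤ τ := by positivity
  set η := min 1 (δ / (4 * τ + 1))
  have hη : 0 < η := by positivity
  have hη_lt : 4 * τ * η < δ := by
    have : η * (4 * τ + 1) ≤ δ := (le_div_iff₀ (by positivity)).1 (min_le_right _ _)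
    linarith
  obtain ⟨h, b, hh⟩ := exists_isTruncation h0 h1 hη
  subst hlaw
  filter_upwards [hsys.ae_tendsto_centredForm hc hσ hxy hh.toIsBoundedCentred l m,
    ae_tendsto_truncationError hy hindep hident h1 hh.toIsBoundedCentred τ η
      (∫ z, ‖h z‖ ^ 2 ∂(P.map (y 0)))] with ω hcentred hbulk
  have hlim := hbulk.add hcentred.norm
  rw [norm_zero, add_zero] at hlim
  have hlim_lt := (truncationError_mean_le hτ hη (min_le_left _ _) hh.integral_error_le
    hh.abs_variance_sub_one_le).trans_lt hη_lt
  filter_upwards [hlim.eventually (ge_mem_nhds hlim_lt)] with N hN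
  exact (((covMatrix_coercive σ _ (x N ω)).boundedForm_block_inv (by positivity) l
    m).norm_formDeviation_le hτ hη h _ _).trans hN

end IsRandomSystem

section Probability

variable {Ω : Type*} [MeasurableSpace Ω] {P : Measure Ω} {L : ℕ} {c σ : ℝ} {K : ℕ → ℕ}

lemma card_cutoff_ne_le {κ : Type*} [Fintype κ] (M : ℕ) (α : κ → Fin L → ℂ) :
    ((Finset.univ.filter fun k => cutoff M (α k) ≠ α k).card : ℝ) ≤ ∑ k, tailFun M (α k) := by
  rw [Finset.card_eq_sum_ones, Nat.cast_sum, Nat.cast_one]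
  refine (Finset.sum_le_sum fun k hk => one_le_tailFun (Finset.mem_filter.1 hk).2).trans ?_
  exact Finset.sum_le_univ_sum_of_nonneg fun k => tailFun_nonneg M _

lemma norm_resolventTrace_cutoff_sub_le {n N : ℕ} (hσ : 0 < σ) (M : ℕ) (α : Fin n → Fin L → ℂ)
    (x : Fin n → Fin N → ℂ) (l m : Fin L) :
    ‖resolventTrace σ (fun k => cutoff M (α k)) x l m - resolventTrace σ (dropFirst α) x l m‖ ≤
      (∑ k, tailFun M (α k) + 1) * (2 / σ ^ 2 * (1 / (N : ℝ))) := by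
  classical
  set cut := Finset.univ.filter fun k => cutoff M (α k) ≠ α k
  set first := Finset.univ.filter fun k : Fin n => (k : ℕ) = 0
  have hagree (k) (hk : k ∉ cut ∪ first) :
      tensorVec (cutoff M (α k)) (x k) = tensorVec (dropFirst α k) (x k) := by
    simp only [cut, first, Finset.mem_union, Finset.mem_filter, Finset.mem_univ, true_and, not_or,
      not_not] at hk
    simp only [dropFirst, hk.1, if_neg hk.2]
  have hfirst : first.card ≤ 1 := Finset.card_le_one.2 fun i hi j hj => Fin.ext
    ((Finset.mem_filter.1 hi).2.trans (Finset.mem_filter.1 hj).2.symm)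
  have hcard : ((cut ∪ first).card : ℝ) ≤ ∑ k, tailFun M (α k) + 1 :=
    calc ((cut ∪ first).card : ℝ) ≤ cut.card + first.card := mod_cast Finset.card_union_le _ _
      _ ≤ ∑ k, tailFun M (α k) + 1 := add_le_add (card_cutoff_ne_le M α) (mod_cast hfirst)
  calc _ ≤ (cut ∪ first).card * (2 / (N * σ ^ 2)) :=
        norm_resolventTrace_sub_le hσ (cut ∪ first) hagree l m
    _ = (cut ∪ first).card * (2 / σ ^ 2 * (1 / (N : ℝ))) := by
        rw [div_mul_div_comm, mul_one, mul_comm (σ ^ 2)]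
    _ ≤ (∑ k, tailFun M (α k) + 1) * (2 / σ ^ 2 * (1 / (N : ℝ))) := by gcongr

namespace IsRandomSystem

variable [IsProbabilityMeasure P] {μ : Measure ℂ} [IsProbabilityMeasure μ]
  {a : ∀ N, Ω → Fin (K N) → Fin L → ℂ} {x : ∀ N, Ω → Fin (K N) → Fin N → ℂ}

lemma ae_isCutoffApproximation (h : IsRandomSystem P μ c K a x) (h0 : ∫ z, z ∂μ = 0)
    (h1 : ∫ z, ‖z‖ ^ 2 ∂μ = 1) (hc : 0 ≤ c) (hσ : 0 < σ) :
    ∀ᵐ ω ∂P, IsCutoffApproximation σ (fun N => a N ω)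
      (fun M N => resolventTrace σ (fun k => cutoff M (a N ω k)) (x N ω))
      (fun N => resolventTrace σ (dropFirst (a N ω)) (x N ω)) (1 / σ ^ 2) (2 / σ ^ 2) := by
  have hdefect : ∀ᵐ ω ∂P, ∀ (M : ℕ) (l m : Fin L), Tendsto (fun N =>
      defect σ N (fun k => cutoff M (a N ω k))
        (resolventTrace σ (fun k => cutoff M (a N ω k)) (x N ω)) l m) atTop (𝓝 0) :=
    ae_all_iff.2 fun M => ae_all_iff.2 fun l => ae_all_iff.2 fun m =>
      (h.comp_gain (continuous_cutoff M).measurable).ae_tendsto_defect h0 h1 hc hσ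
        (by positivity : (0 : ℝ) ≤ M + 2) (fun N ω k l => norm_cutoff_apply_le M _ l) l m
  filter_upwards [hdefect] with ω hω
  exact {
    posSemidef := fun M N => resolventTrace_posSemidef hσ _ _
    norm_le := fun M N l m => norm_resolventTrace_le hσ _ _ l m
    norm_le' := fun N l m => norm_resolventTrace_le hσ _ _ l m
    tendsto_defect := fun M => tendsto_matrix_iff.2 (hω M)
    norm_sub_le := fun M N l m => norm_resolventTrace_cutoff_sub_le hσ M _ _ l m }

theorem ae_exists_isSolution_tendsto (h : IsRandomSystem P μ c K a x) (h0 : ∫ z, z ∂μ = 0)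
    (h1 : ∫ z, ‖z‖ ^ 2 ∂μ = 1) (hc : 0 < c) (hσ : 0 < σ) {y : ℕ → Ω → ℂ}
    (hxy : ∀ N ω (k : Fin (K N)), (k : ℕ) = 0 → x N ω k = fun i : Fin N => y i ω)
    (hy : ∀ i, Measurable (y i)) (hindep : iIndepFun y P)
    (hident : ∀ i, IdentDistrib (y i) (y 0) P P) (hlaw : P.map (y 0) = μ)
    {H : ProbabilityMeasure (Fin L → ℂ)} (hav : ∀ᵐ ω ∂P, AveragesTendsto c H fun N => a N ω) :
    ∀ᵐ ω ∂P, ∃ A, IsSolution c σ H A ∧ Tendsto (fun N =>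
      blockForm (covMatrix σ (dropFirst (a N ω)) (x N ω))⁻¹ fun i : Fin N => y i ω)
        atTop (𝓝 A) := by
  have hform : ∀ᵐ ω ∂P, ∀ l m : Fin L, Tendsto (fun N =>
      blockForm (covMatrix σ (dropFirst (a N ω)) (x N ω))⁻¹ (fun i : Fin N => y i ω) l m -
        resolventTrace σ (dropFirst (a N ω)) (x N ω) l m) atTop (𝓝 0) :=
    ae_all_iff.2 fun l => ae_all_iff.2 fun m =>
      h.ae_tendsto_blockForm_sub_resolventTrace h0 h1 hc hσ hxy hy hindep hident hlaw l m
  filter_upwards [hav, h.ae_isCutoffApproximation h0 h1 hc.le hσ, hform] with ω hω happrox hformω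
  obtain ⟨A, hA, hlim⟩ := happrox.exists_isSolution_tendsto hc.le hσ hω
  refine ⟨A, hA, tendsto_matrix_iff.2 fun l m => ?_⟩
  simpa only [sub_add_cancel, zero_add] using (hformω l m).add (tendsto_matrix_iff.1 hlim l m)

end IsRandomSystem

end Probability

/-! ### The signal to interference ratio -/

section Signal

variable {L : ℕ} {c σ : ℝ} {K : ℕ → ℕ}

lemma integral_empiricalDist (n : ℕ) (α : ℕ → Fin L → ℂ) {f : (Fin L → ℂ) → ℂ}
    (hf : Continuous f) :
    ∫ x, f x ∂(empiricalDist n α : Measure (Fin L → ℂ)) = (n : ℂ)⁻¹ * ∑ k : Fin n, f (α k) := by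
  have hi : ∀ k ∈ Finset.range n, Integrable f
      ((diracProba (α k)).toFiniteMeasure : Measure (Fin L → ℂ)) := fun k _ =>
    integrable_dirac' hf.stronglyMeasurable (by simp)
  rw [empiricalDist, FiniteMeasure.toMeasure_smul, integral_smul_nnreal_measure,
    FiniteMeasure.toMeasure_sum, integral_finsetSum_measure hi, Finset.sum_range, NNReal.smul_def,
    Complex.real_smul, NNReal.coe_inv, NNReal.coe_natCast, Complex.ofReal_inv,
    Complex.ofReal_natCast]
  congr 1
  exact Finset.sum_congr rfl fun k _ => integral_dirac' _ _ hf.stronglyMeasurable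

lemma averagesTendsto_of_tendsto_empiricalDist {H : ProbabilityMeasure (Fin L → ℂ)}
    (hK : Tendsto (fun N : ℕ => (K N : ℝ) / (N : ℝ)) atTop (𝓝 c)) {α : ℕ → ℕ → Fin L → ℂ}
    (h : Tendsto (fun N => empiricalDist (K N) (α N)) atTop (𝓝 H.toFiniteMeasure)) :
    AveragesTendsto c H fun N (k : Fin (K N)) => α N k := by
  intro f hf ⟨C, hC⟩
  have hmean := (FiniteMeasure.tendsto_iff_forall_integral_rclike_tendsto ℂ).1 h
    (BoundedContinuousFunction.ofNormedAddCommGroup f hf C hC)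
  simp only [BoundedContinuousFunction.coe_ofNormedAddCommGroup,
    integral_empiricalDist _ _ hf] at hmean
  refine (((Complex.continuous_ofReal.tendsto c).comp hK).mul hmean).congr fun N => ?_
  rcases Nat.eq_zero_or_pos (K N) with h0 | hpos
  · have : IsEmpty (Fin (K N)) := by rw [h0]; infer_instance
    simp
  · have : ((K N : ℕ) : ℂ) ≠ 0 := by exact_mod_cast hpos.ne'
    simp only [Function.comp_apply]
    push_cast
    rw [← mul_assoc]
    congr 1
    field_simp

lemma continuous_gainVec : Continuous fun p : ℝ × (Fin L → ℂ) => gainVec p.1 p.2 := by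
  unfold gainVec
  fun_prop

lemma continuous_limitValue (A : Matrix (Fin L) (Fin L) ℂ) :
    Continuous fun p : ℝ × (Fin L → ℂ) => limitValue p.1 p.2 A := by
  unfold limitValue
  fun_prop

lemma limitValue_eq {T : ℝ} (hT : 0 ≤ T) (γ : Fin L → ℂ) (A : Matrix (Fin L) (Fin L) ℂ) :
    limitValue T γ A = star (gainVec T γ) ⬝ᵥ A *ᵥ gainVec T γ := by
  have hsqrt : (T : ℂ) = (Real.sqrt T : ℂ) * Real.sqrt T := by
    rw [← Complex.ofReal_mul, Real.mul_self_sqrt hT]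
  simp only [limitValue, gainVec, dotProduct, mulVec, Pi.star_apply, star_mul', Finset.mul_sum,
    RCLike.star_def, Complex.conj_ofReal]
  refine Finset.sum_congr rfl fun l _ => Finset.sum_congr rfl fun m _ => ?_
  rw [hsqrt]
  ring

lemma userBeta_eq (N : ℕ) (T : ℕ → ℝ) (γ : ℕ → Fin L → ℂ) (s : ℕ → ℕ → ℂ) (k : ℕ) :
    userBeta N T γ s k = tensorVec (gainVec (T k) (γ k)) (fun i : Fin N => s i k) := by
  funext p
  simp only [userBeta, beta, tensorVec, gainVec, mul_assoc]

lemma interference_add_eq_covMatrix {n : ℕ} (N : ℕ) (σ : ℝ) (T : ℕ → ℝ) (γ : ℕ → Fin L → ℂ)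
    (s : ℕ → ℕ → ℂ) :
    interference N n T γ s + ((σ ^ 2 : ℝ) : ℂ) • (1 : Matrix (Fin L × Fin N) (Fin L × Fin N) ℂ) =
      covMatrix σ (dropFirst fun k : Fin n => gainVec (T k) (γ k))
        fun k (i : Fin N) => s i k := by
  have hIco : Finset.Ico 1 n = (Finset.range n).filter (· ≠ 0) := by
    ext k
    simp only [Finset.mem_Ico, Finset.mem_filter, Finset.mem_range]
    omega
  rw [interference, covMatrix, hIco, Finset.sum_filter, Finset.sum_range]
  congr 2
  · push_cast
    rfl
  · refine Finset.sum_congr rfl fun k _ => ?_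
    by_cases hk : (k : ℕ) = 0
    · simp [dropFirst, hk, tensorVec_zero]
    · simp only [ne_eq, hk, not_false_eq_true, if_true, dropFirst, if_false, userBeta_eq]

lemma sir_eq {n : ℕ} (N : ℕ) (σ : ℝ) (T : ℕ → ℝ) (γ : ℕ → Fin L → ℂ) (s : ℕ → ℕ → ℂ) :
    sir N n σ T γ s = star (gainVec (T 0) (γ 0)) ⬝ᵥ
      blockForm (covMatrix σ (dropFirst fun k : Fin n => gainVec (T k) (γ k))
        (fun k (i : Fin N) => s i k))⁻¹ (fun i : Fin N => s i 0) *ᵥ gainVec (T 0) (γ 0) := by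
  rw [sir, interference_add_eq_covMatrix, userBeta_eq, ← tensorVec_dotProduct_mulVec]
  push_cast
  rfl

lemma tendsto_star_dotProduct_mulVec_sub {ι β : Type*} [Fintype ι] {F : Filter β}
    {B : β → Matrix ι ι ℂ} {A : Matrix ι ι ℂ} (hB : Tendsto B F (𝓝 A)) {v : β → ι → ℂ} {M : ℝ}
    (hv : ∀ᶠ N in F, ‖v N‖ ≤ M) :
    Tendsto (fun N => star (v N) ⬝ᵥ B N *ᵥ v N - star (v N) ⬝ᵥ A *ᵥ v N) F (𝓝 0) := by
  set δ := fun N => ∑ l, ∑ m, ‖B N l m - A l m‖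
  have hbound : Tendsto (fun N => (Fintype.card ι : ℝ) * (M * (Fintype.card ι * (δ N * M)))) F
      (𝓝 0) := by
    simpa using ((((tendsto_sum_norm_sub hB).mul_const M).const_mul (Fintype.card ι : ℝ)).const_mul
      M).const_mul (Fintype.card ι : ℝ)
  refine squeeze_zero_norm' ?_ hbound
  filter_upwards [hv] with N hN
  rw [← dotProduct_sub, ← sub_mulVec]
  exact norm_star_dotProduct_mulVec_le
    (fun l m => le_sum_sum (f := fun l m => ‖B N l m - A l m‖) (fun _ _ => norm_nonneg _) l m)
    (fun l => (norm_le_pi_norm _ l).trans hN) (by positivity) ((norm_nonneg _).trans hN)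

section Realization

variable {T : ℕ → ℕ → ℝ} {γ : ℕ → ℕ → Fin L → ℂ} {s : ℕ → ℕ → ℂ} {A : Matrix (Fin L) (Fin L) ℂ}

lemma tendsto_sir_sub_limitValue (hT : ∀ᶠ N in atTop, 0 ≤ T N 0)
    (hA : Tendsto (fun N => blockForm (covMatrix σ
      (dropFirst fun k : Fin (K N) => gainVec (T N k) (γ N k)) fun k (i : Fin N) => s i k)⁻¹
        fun i : Fin N => s i 0) atTop (𝓝 A))
    {M : ℝ} (hM : ∀ᶠ N in atTop, ‖gainVec (T N 0) (γ N 0)‖ ≤ M) :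
    Tendsto (fun N => sir N (K N) σ (T N) (γ N) s - limitValue (T N 0) (γ N 0) A) atTop
      (𝓝 0) := by
  refine (tendsto_star_dotProduct_mulVec_sub hA hM).congr' ?_
  filter_upwards [hT] with N hN
  rw [sir_eq, limitValue_eq hN]

lemma tendsto_sir (hT : ∀ᶠ N in atTop, 0 ≤ T N 0)
    (hA : Tendsto (fun N => blockForm (covMatrix σ
      (dropFirst fun k : Fin (K N) => gainVec (T N k) (γ N k)) fun k (i : Fin N) => s i k)⁻¹
        fun i : Fin N => s i 0) atTop (𝓝 A))
    {T₁ : ℝ} {γ₁ : Fin L → ℂ} (hT₁ : Tendsto (fun N => T N 0) atTop (𝓝 T₁))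
    (hγ₁ : Tendsto (fun N => γ N 0) atTop (𝓝 γ₁)) :
    Tendsto (fun N => sir N (K N) σ (T N) (γ N) s) atTop (𝓝 (limitValue T₁ γ₁ A)) := by
  have hpair := hT₁.prodMk_nhds hγ₁
  have hgain := ((continuous_gainVec.tendsto (T₁, γ₁)).comp hpair).norm
  have hlimit := ((continuous_limitValue A).tendsto (T₁, γ₁)).comp hpair
  have hbounded := hgain.eventually (ge_mem_nhds (lt_add_one _))
  simpa only [Function.comp_apply, sub_add_cancel, zero_add] using
    (tendsto_sir_sub_limitValue hT hA hbounded).add hlimit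

end Realization

section Randomness

variable {Ω : Type*} [MeasurableSpace Ω] {P : Measure Ω} [IsProbabilityMeasure P]
  {s : ℕ → ℕ → Ω → ℂ}

lemma isRandomSystem_gainVec (hs_meas : ∀ i j, Measurable (s i j))
    (hs_indep : iIndepFun (fun p : ℕ × ℕ => s p.1 p.2) P)
    (hs_ident : ∀ i j, IdentDistrib (s i j) (s 0 0) P P)
    (hK : Tendsto (fun N : ℕ => (K N : ℝ) / (N : ℝ)) atTop (𝓝 c))
    {T : ℕ → ℕ → Ω → ℝ} {γ : ℕ → ℕ → Fin L → Ω → ℂ}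
    (hT_meas : ∀ N, ∀ k < K N, Measurable (T N k))
    (hγ_meas : ∀ N, ∀ k < K N, ∀ l, Measurable (γ N k l))
    (h_indep : ∀ N, IndepFun (fun ω => fun k : Fin (K N) => (T N k ω, fun l => γ N k l ω))
      (fun ω => fun p : Fin N × Fin (K N) => s p.1 p.2 ω) P) :
    IsRandomSystem P (P.map (s 0 0)) c K
      (fun N ω (k : Fin (K N)) => gainVec (T N k ω) fun l => γ N k l ω)
      (fun N ω k i => s i k ω) where
  tendsto_div := hK
  measurable_gain N := measurable_pi_lambda _ fun k => continuous_gainVec.measurable.comp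
    ((hT_meas N k k.2).prodMk (measurable_pi_lambda _ fun l => hγ_meas N k k.2 l))
  measurable_signature N := measurable_pi_lambda _ fun k => measurable_pi_lambda _ fun i =>
    hs_meas i k
  indepFun N := (h_indep N).comp (φ := fun q (k : Fin (K N)) => gainVec (q k).1 (q k).2)
    (ψ := fun q (k : Fin (K N)) (i : Fin N) => q (i, k))
    (measurable_pi_lambda _ fun k => continuous_gainVec.measurable.comp (measurable_pi_apply k))
    (by fun_prop)
  map_signature N := map_signatures_eq_signatureLaw hs_meas hs_indep hs_ident (K N) N

theorem ae_exists_isSolution_tendsto_blockForm (hc : 0 < c) (hσ : 0 < σ)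
    (hs_meas : ∀ i j, Measurable (s i j)) (hs_indep : iIndepFun (fun p : ℕ × ℕ => s p.1 p.2) P)
    (hs_ident : ∀ i j, IdentDistrib (s i j) (s 0 0) P P) (hs_mean : ∫ ω, s 0 0 ω ∂P = 0)
    (hs_var : ∫ ω, ‖s 0 0 ω‖ ^ 2 ∂P = 1) {α : ℕ → ℕ → Ω → Fin L → ℂ}
    (hsys : IsRandomSystem P (P.map (s 0 0)) c K (fun N ω (k : Fin (K N)) => α N k ω)
      fun N ω k i => s i k ω)
    {H : ProbabilityMeasure (Fin L → ℂ)}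
    (hH : ∀ᵐ ω ∂P, Tendsto (fun N => empiricalDist (K N) fun k => α N k ω) atTop
      (𝓝 H.toFiniteMeasure)) :
    ∀ᵐ ω ∂P, ∃ A, IsSolution c σ H A ∧ Tendsto (fun N =>
      blockForm (covMatrix σ (dropFirst fun k : Fin (K N) => α N k ω)
        fun k (i : Fin N) => s i k ω)⁻¹ fun i : Fin N => s i 0 ω) atTop (𝓝 A) := by
  have : IsProbabilityMeasure (P.map (s 0 0)) :=
    Measure.isProbabilityMeasure_map (hs_meas 0 0).aemeasurable
  have hmean : ∫ z, z ∂(P.map (s 0 0)) = 0 := by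
    rw [integral_map (hs_meas 0 0).aemeasurable (by fun_prop), hs_mean]
  have hvar : ∫ z, ‖z‖ ^ 2 ∂(P.map (s 0 0)) = 1 := by
    rw [integral_map (hs_meas 0 0).aemeasurable (by fun_prop), hs_var]
  have hcol : Function.Injective fun i : ℕ => (i, 0) := fun i j h => (Prod.mk.inj h).1
  have hav : ∀ᵐ ω ∂P, AveragesTendsto c H fun N (k : Fin (K N)) => α N k ω :=
    hH.mono fun ω hω => averagesTendsto_of_tendsto_empiricalDist (α := fun N k => α N k ω)
      hsys.tendsto_div hω
  exact hsys.ae_exists_isSolution_tendsto (y := fun i => s i 0) hmean hvar hc hσ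
    (fun N ω k hk => by simp only [hk]) (fun i => hs_meas i 0) (hs_indep.precomp hcol)
    (fun i => hs_ident i 0) rfl hav

end Randomness

end Signal

end CDMA
end

theorem theorem1p1 {Ω : Type*} [MeasurableSpace Ω] (P : Measure Ω) [IsProbabilityMeasure P]
    (L : ℕ) (c σ : ℝ) (hc : 0 < c) (hσ : 0 < σ)
    (s : ℕ → ℕ → Ω → ℂ)
    (hs_meas : ∀ i j, Measurable (s i j))
    (hs_indep : iIndepFun (fun p : ℕ × ℕ => s p.1 p.2) P)
    (hs_ident : ∀ i j, IdentDistrib (s i j) (s 0 0) P P)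
    (hs_mean : ∫ ω, s 0 0 ω ∂P = 0)
    (hs_var : ∫ ω, ‖s 0 0 ω‖ ^ 2 ∂P = 1)
    (K : ℕ → ℕ)
    (hK : Tendsto (fun N : ℕ => (K N : ℝ) / (N : ℝ)) atTop (𝓝 c))
    -- powers `T N k` and gains `γ N k l` of the users `k < K N` in the `N`-th system
    (T : ℕ → ℕ → Ω → ℝ) (γ : ℕ → ℕ → Fin L → Ω → ℂ)
    (hT_meas : ∀ N, ∀ k < K N, Measurable (T N k))
    (hT_nonneg : ∀ N, ∀ k < K N, ∀ ω, 0 ≤ T N k ω)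
    (hγ_meas : ∀ N, ∀ k < K N, ∀ l, Measurable (γ N k l))
    (h_indep : ∀ N, IndepFun
      (fun ω => fun k : Fin (K N) => (T N k ω, fun l : Fin L => γ N k l ω))
      (fun ω => fun p : Fin N × Fin (K N) => s p.1 p.2 ω) P)
    (H : ProbabilityMeasure (Fin L → ℂ))
    (hH : ∀ᵐ ω ∂P, Tendsto
      (fun N => CDMA.empiricalDist (K N)
        (fun k => CDMA.gainVec (T N k ω) (fun l => γ N k l ω)))
      atTop (𝓝 H.toFiniteMeasure)) :
    ∃ A : Matrix (Fin L) (Fin L) ℂ,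
      CDMA.IsSolution c σ H A ∧
      (∀ B : Matrix (Fin L) (Fin L) ℂ, CDMA.IsSolution c σ H B → B = A) ∧
      ∀ᵐ ω ∂P,
        -- the first user's power and gains do not vary with `N`, or converge
        (∀ (T₁ : ℝ) (γ₁ : Fin L → ℂ),
          Tendsto (fun N => T N 0 ω) atTop (𝓝 T₁) →
          (∀ l, Tendsto (fun N => γ N 0 l ω) atTop (𝓝 (γ₁ l))) →
          Tendsto
            (fun N => CDMA.sir N (K N) σ (fun k => T N k ω) (fun k l => γ N k l ω)
              (fun i k => s i k ω))
            atTop (𝓝 (CDMA.limitValue T₁ γ₁ A))) ∧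
        -- they vary with `N` and the vectors `√T γ` of the first user stay bounded
        ((∃ M : ℝ, ∀ N, ‖CDMA.gainVec (T N 0 ω) (fun l => γ N 0 l ω)‖ ≤ M) →
          Tendsto
            (fun N => CDMA.sir N (K N) σ (fun k => T N k ω) (fun k l => γ N k l ω)
                (fun i k => s i k ω) -
              CDMA.limitValue (T N 0 ω) (fun l => γ N 0 l ω) A)
            atTop (𝓝 0)) := by
  have hsys := CDMA.isRandomSystem_gainVec hs_meas hs_indep hs_ident hK hT_meas hγ_meas h_indep
  have hae := CDMA.ae_exists_isSolution_tendsto_blockForm hc hσ hs_meas hs_indep hs_ident hs_mean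
    hs_var (α := fun N k ω => CDMA.gainVec (T N k ω) fun l => γ N k l ω) hsys hH
  obtain ⟨-, A, hA, -⟩ := hae.exists
  refine ⟨A, hA, fun B hB => hB.unique hc.le hσ hA, ?_⟩
  filter_upwards [hae] with ω ⟨A', hA', hlim⟩
  rw [hA'.unique hc.le hσ hA] at hlim
  have hT₀ : ∀ᶠ N in atTop, 0 ≤ T N 0 ω :=
    (CDMA.eventually_pos_of_tendsto_div hc hK).mono fun N hN => hT_nonneg N 0 hN ω
  exact ⟨fun T₁ γ₁ hT₁ hγ₁ => CDMA.tendsto_sir (T := fun N k => T N k ω)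
      (γ := fun N k l => γ N k l ω) (s := fun i k => s i k ω) hT₀ hlim hT₁ (tendsto_pi_nhds.2 hγ₁),
    fun ⟨M, hM⟩ => CDMA.tendsto_sir_sub_limitValue (T := fun N k => T N k ω)
      (γ := fun N k l => γ N k l ω) (s := fun i k => s i k ω) hT₀ hlim (.of_forall hM)⟩
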